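/- **Setting.** Let $d\in\{2,3\}$, let $\Omega\subset\mathbb R^d$ be bounded and open, $\lambda>0$, $\nu>0$, $\gamma\ge 0$, $\alpha\in(0,1)$, $T>0$, and let $k,s\ge 0$ be integers. Put $$\Omega_\lambda=\{y\in\mathbb R^d\setminus\Omega:\ |x-y|\le\lambda\text{ for some }x\in\Omega\},\qquad D=\Omega\cup\Omega_\lambda,\qquad \mathcal B_\lambda(x)=\{y\in D:\ |x-y|\le\lambda\},$$ $$X=\{v\in H^1(D)^d:\ v=0\text{ a.e. outside }\Omega\},\qquad Q=\Big\{q\in L^2(\Omega):\int_\Omega q\,dx=0\Big\},$$ $$b(u,v,w)=\int_\Omega (u\cdot\nabla)v\cdot w\,dx,\qquad \widetilde b(u,v,w)=\tfrac12 b(u,v,w)-\tfrac12 b(u,w,v),$$ $$a_\lambda(u,v)=\frac{C_{d,\alpha}}2\int_{D}\int_{\mathcal B_\lambda(x)}\frac{(u(x)-u(y))\cdot(v(x)-v(y))}{|x-y|^{d+2\alpha}}\,dy\,dx,\qquad C_{d,\alpha}=\alpha 2^{2\alpha}\frac{\Gamma(\frac{d+2}{2})}{\Gamma(\frac12)\Gamma(1-\alpha)}.$$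 All norms $\|\cdot\|$ below are those of $L^2(\Omega)$. **Exact solution.** Let $(u_\lambda,p_\lambda)$ solve the truncated problem with body force $f$: $u_\lambda(t)\in X$ for $t\in[0,T]$, and for every $t\in(0,T]$ one has $p_\lambda(t)\in Q$, $$\int_\Omega\partial_tu_\lambda\cdot v\,dx+b(u_\lambda,u_\lambda,v)+\nu\int_\Omega\nabla u_\lambda:\nabla v\,dx-\int_\Omega p_\lambda\,\nabla\!\cdot v\,dx+\gamma\,a_\lambda(u_\lambda,v)=\int_\Omega f\cdot v\,dx\quad\forall v\in X,$$ $$\int_\Omega(\nabla\cdot u_\lambda)\,q\,dx=0\quad\forall q\in Q .$$ Assume that $u_\lambda\in L^\infty(0,T;H^1(\Omega))\cap L^4(0,T;H^{k+1}(\Omega))\cap H^2(0,T;L^2(\Omega))\cap H^1(0,T;H^{k+1}(\Omega))$ (continuous representatives in time), that $f\in L^2(0,T;L^2(\Omega))$, and that $p_\lambda(t)\in H^{s+1}(\Omega)$ for $t\in(0,T]$, $p_\lambda\in L^2(0,T;H^{s+1}(\Omega))$, with the discrete norms bounded independently of the time step: $\sup_{N_T\ge1}\sum_{n=1}^{N_T}\frac{T}{N_T}\big\|p_\lambda\big(\tfrac{nT}{N_T}\big)\big\|_{H^{s+1}(\Omega)}^2<\infty$.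 **Discretization.** Let $h>0$ be the mesh size and let $X_h\subset X$, $Q_h\subset Q$ be conforming (finite-dimensional) velocity and pressure finite element spaces that satisfy, with constants $\beta,C_0>0$ independent of $h$, the discrete inf-sup condition $$\sup_{0\ne v_h\in X_h}\frac{\int_\Omega q_h\,\nabla\!\cdot v_h\,dx}{\|\nabla v_h\|}\ \ge\ \beta\,\|q_h\|\qquad\forall q_h\in Q_h$$ and the approximation properties $$\inf_{v_h\in X_h}\|v-v_h\|\le C_0h^{k+1}\|v\|_{H^{k+1}(\Omega)},\qquad \inf_{v_h\in X_h}\|\nabla(v-v_h)\|\le C_0h^{k}\|v\|_{H^{k+1}(\Omega)}\qquad\forall v\in X\cap H^{k+1}(\Omega)^d,$$ $$\inf_{q_h\in Q_h}\|q-q_h\|\le C_0h^{s+1}\|q\|_{H^{s+1}(\Omega)}\qquad\forall q\in Q\cap H^{s+1}(\Omega).$$ Let $N_T\ge1$, $\Delta t=T/N_T$, $t^n=n\Delta t$, $f^n=f(t^n)$. Given $u_{h,\lambda}^0\in X_h$, let $u_{h,\lambda}^{n+1}\in X_h$, $p_{h,\lambda}^{n+1}\in Q_h$ $(0\le n<N_T)$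 satisfy the IMEX Euler scheme $$\int_\Omega\frac{u_{h,\lambda}^{n+1}-u_{h,\lambda}^n}{\Delta t}\cdot v\,dx+\widetilde b(u_{h,\lambda}^n,u_{h,\lambda}^{n+1},v)+\nu\int_\Omega\nabla u_{h,\lambda}^{n+1}:\nabla v\,dx+\gamma\,a_\lambda(u_{h,\lambda}^{n+1},v)-\int_\Omega p_{h,\lambda}^{n+1}\,\nabla\!\cdot v\,dx=\int_\Omega f^{n+1}\cdot v\,dx\quad\forall v\in X_h,$$ $$\int_\Omega(\nabla\cdot u_{h,\lambda}^{n+1})\,q\,dx=0\quad\forall q\in Q_h .$$ **Theorem.** Let $e_{h,\lambda}^n=u_\lambda(t^n)-u_{h,\lambda}^n$. There is a constant $C>0$, independent of $h$, of $\Delta t$, of the spaces $X_h,Q_h$ (except through $\beta$ and $C_0$) and of the discrete solution, such that for all $0\le N\le N_T$ $$\frac12\|e_{h,\lambda}^N\|^2+\frac12\Delta t\sum_{n=0}^{N-1}\nu\|\nabla e_{h,\lambda}^{n+1}\|^2\le C\big(\|\nabla e_{h,\lambda}^0\|^2+\|e_{h,\lambda}^0\|^2+h^{2k}+h^{2s+2}+\Delta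 t^2\big).$$ -/

import Mathlib

open MeasureTheory Set Filter Topology
open scoped ENNReal NNReal ContDiff

noncomputable section

namespace FracNSE

/-! ### Sobolev spaces of square-integrable functions -/

/-- The Euclidean space of dimension `d`. -/
abbrev Sp (d : ℕ) : Type := EuclideanSpace ℝ (Fin d)

/-- The Lebesgue space of square-integrable `F`-valued functions on `D`. -/
abbrev L2 {d : ℕ} (D : Set (Sp d)) (F : Type) [NormedAddCommGroup F] : Type :=
  Lp F 2 (volume.restrict D)

/-- Smooth functions whose support is compact and contained in `D`. -/
structure IsTest {d : ℕ} (D : Set (Sp d)) (φ : Sp d → ℝ) : Prop where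
  smooth : ContDiff ℝ ∞ φ
  compact : HasCompactSupport φ
  support : tsupport φ ⊆ D

/-- The classical partial derivative of order `j` of `φ` in the coordinate directions
`I 0, …, I (j-1)`. -/
def partialDeriv {d j : ℕ} (I : Fin j → Fin d) (φ : Sp d → ℝ) (x : Sp d) : ℝ :=
  iteratedFDeriv ℝ j φ x (fun i => EuclideanSpace.single (I i) (1 : ℝ))

/-- `w` is the weak partial derivative of `v` on `D` in the coordinate directions `I`. -/
def IsWeakPartial {d j : ℕ} {F : Type} [NormedAddCommGroup F] [NormedSpace ℝ F]
    (D : Set (Sp d)) (I : Fin j → Fin d) (v w : Sp d → F) : Prop :=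
  ∀ φ : Sp d → ℝ, IsTest D φ →
    ∫ x in D, partialDeriv I φ x • v x = (-1 : ℝ) ^ j • ∫ x in D, φ x • w x

/-- Partial derivatives of order at most `m`, listed by order and coordinate directions. -/
abbrev DerivIdx (d m : ℕ) : Type := Σ j : Fin (m + 1), (Fin (j : ℕ) → Fin d)

/-- The index of the function itself. -/
def idx0 (d m : ℕ) : DerivIdx d m := ⟨⟨0, Nat.succ_pos m⟩, Fin.elim0⟩

/-- The index of the first-order derivative in direction `i`. -/
def idx1 {d : ℕ} (i : Fin d) : DerivIdx d 1 := ⟨⟨1, Nat.lt_succ_self 1⟩, fun _ => i⟩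

lemma IsTest.integral_eq {d : ℕ} {F : Type} [NormedAddCommGroup F] [NormedSpace ℝ F]
    [CompleteSpace F] {D : Set (Sp d)} {φ : Sp d → ℝ} (hc : Continuous φ)
    (hs : HasCompactSupport φ) :
    ∃ L : L2 D F →L[ℝ] F, ∀ v : L2 D F, L v = ∫ x in D, φ x • v x := by
  have hφ : MemLp φ 2 (volume.restrict D) := hc.memLp_of_hasCompactSupport hs
  refine ⟨(ContinuousLinearMap.lsmul ℝ ℝ (E := F)).lpPairing (volume.restrict D) 2 2
    (hφ.toLp φ), fun v => ?_⟩
  rw [ContinuousLinearMap.lpPairing_eq_integral]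
  refine integral_congr_ae ?_
  filter_upwards [hφ.coeFn_toLp] with x hx
  simp [hx]

lemma IsTest.partialDeriv_continuous {d j : ℕ} {D : Set (Sp d)} {φ : Sp d → ℝ}
    (hφ : IsTest D φ) (I : Fin j → Fin d) : Continuous (partialDeriv I φ) := by
  have h := hφ.smooth.continuous_iteratedFDeriv (m := j) (by exact_mod_cast le_top)
  exact (ContinuousMultilinearMap.apply ℝ (fun _ : Fin j => Sp d) ℝ
    (fun i => EuclideanSpace.single (I i) (1 : ℝ))).continuous.comp h

lemma IsTest.partialDeriv_compact {d j : ℕ} {D : Set (Sp d)} {φ : Sp d → ℝ}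
    (hφ : IsTest D φ) (I : Fin j → Fin d) : HasCompactSupport (partialDeriv I φ) := by
  have h : HasCompactSupport (iteratedFDeriv ℝ j φ) := hφ.compact.iteratedFDeriv j
  refine h.mono' fun x hx => subset_tsupport _ ?_
  intro h0
  exact hx (by simp [partialDeriv, h0])

/-- The Sobolev space `H^m(D; F)`. An element is the family of all its weak derivatives of order
at most `m`, all of them in `L²(D; F)`, so that the norm inherited from the Hilbert sum is the
usual one: `‖v‖² = ∑_{j ≤ m} ∑_{I} ‖∂_I v‖²`, with `I` over all `j`-tuples of directions. -/
def SobolevSpace {d : ℕ} (m : ℕ) (D : Set (Sp d)) (F : Type) [NormedAddCommGroup F]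
    [NormedSpace ℝ F] [CompleteSpace F] : Submodule ℝ (PiLp 2 fun _ : DerivIdx d m => L2 D F) where
  carrier := {J | ∀ I : DerivIdx d m, IsWeakPartial D I.2 (J (idx0 d m)) (J I)}
  zero_mem' := by
    intro I φ hφ
    obtain ⟨L₁, h₁⟩ := IsTest.integral_eq (F := F) (D := D) (hφ.partialDeriv_continuous I.2)
      (hφ.partialDeriv_compact I.2)
    obtain ⟨L₂, h₂⟩ := IsTest.integral_eq (F := F) (D := D) hφ.smooth.continuous hφ.compact
    rw [← h₁, ← h₂]
    simp
  add_mem' := by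
    intro u v hu hv I φ hφ
    have hu' := hu I φ hφ
    have hv' := hv I φ hφ
    obtain ⟨L₁, h₁⟩ := IsTest.integral_eq (F := F) (D := D) (hφ.partialDeriv_continuous I.2)
      (hφ.partialDeriv_compact I.2)
    obtain ⟨L₂, h₂⟩ := IsTest.integral_eq (F := F) (D := D) hφ.smooth.continuous hφ.compact
    rw [← h₁, ← h₂] at hu' hv' ⊢
    simp only [PiLp.add_apply, map_add, hu', hv', smul_add]
  smul_mem' := by
    intro c u hu I φ hφ
    have hu' := hu I φ hφ
    obtain ⟨L₁, h₁⟩ := IsTest.integral_eq (F := F) (D := D) (hφ.partialDeriv_continuous I.2)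
      (hφ.partialDeriv_compact I.2)
    obtain ⟨L₂, h₂⟩ := IsTest.integral_eq (F := F) (D := D) hφ.smooth.continuous hφ.compact
    rw [← h₁, ← h₂] at hu' ⊢
    simp only [PiLp.smul_apply, map_smul, hu']
    rw [smul_comm]

/-- Sobolev spaces are complete, so that Bochner integrals with values in them are meaningful. -/
instance SobolevSpace.instComplete {d : ℕ} (m : ℕ) (D : Set (Sp d)) (F : Type)
    [NormedAddCommGroup F] [NormedSpace ℝ F] [CompleteSpace F] :
    CompleteSpace (SobolevSpace m D F) := by
  have hcl : IsClosed {J : PiLp 2 fun _ : DerivIdx d m => L2 D F |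
      ∀ I : DerivIdx d m, IsWeakPartial D I.2 (J (idx0 d m)) (J I)} := by
    simp only [IsWeakPartial, Set.ofPred_forall]
    refine isClosed_iInter fun I => isClosed_iInter fun φ => isClosed_iInter fun hφ => ?_
    obtain ⟨L₁, h₁⟩ := IsTest.integral_eq (F := F) (D := D) (hφ.partialDeriv_continuous I.2)
      (hφ.partialDeriv_compact I.2)
    obtain ⟨L₂, h₂⟩ := IsTest.integral_eq (F := F) (D := D) hφ.smooth.continuous hφ.compact
    simp only [← h₁, ← h₂]
    refine isClosed_eq (L₁.continuous.comp ?_) ((L₂.continuous.comp ?_).const_smul _)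
    · exact PiLp.continuous_apply 2 _ _
    · exact PiLp.continuous_apply 2 _ _
  exact hcl.completeSpace_coe

section Sobolev

variable {d : ℕ} {D : Set (Sp d)} {F : Type} [NormedAddCommGroup F] [NormedSpace ℝ F]
  [CompleteSpace F]

/-- The function underlying an element of a Sobolev space (meaningful a.e. on `D`). -/
def fn {m : ℕ} (v : SobolevSpace m D F) : Sp d → F := v.1 (idx0 d m)

/-- The weak derivative in direction `i` of an element of `H¹(D; F)` (meaningful a.e. on `D`). -/
def pd (i : Fin d) (v : SobolevSpace 1 D F) : Sp d → F := v.1 (idx1 i)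

/-- `V ∈ H^m(D; F)` is the restriction of `g` to `D`. -/
def Represents {m : ℕ} (V : SobolevSpace m D F) (g : Sp d → F) : Prop :=
  fn V =ᵐ[volume.restrict D] g

/-- The restriction to `Ω ⊆ D` of an element of `H^m(D; F)`, as an element of `L²(Ω; F)`. -/
def restrictL2 {m : ℕ} {Ω : Set (Sp d)} (h : Ω ⊆ D) (v : SobolevSpace m D F) : L2 Ω F :=
  ((Lp.memLp (v.1 (idx0 d m))).mono_measure (Measure.restrict_mono h le_rfl)).toLp (fn v)

end Sobolev

/-- `‖g‖_{L²(Ω)}`. -/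
def normL2 {d : ℕ} {F : Type} [NormedAddCommGroup F] (Ω : Set (Sp d)) (g : Sp d → F) : ℝ :=
  Real.sqrt (∫ x in Ω, ‖g x‖ ^ 2)

/-! ### Functions of time with values in a Banach space -/

section Time

variable {B : Type} [NormedAddCommGroup B]

/-- `u ∈ L^q(0,T; B)`. -/
def MemLTime (q : ℝ≥0∞) (T : ℝ) (u : ℝ → B) : Prop :=
  MemLp u q (volume.restrict (Ioo 0 T))

/-- `u` is the absolutely continuous function on `[0,T]` with derivative `u'`. -/
def IsTimeDeriv [NormedSpace ℝ B] (T : ℝ) (u u' : ℝ → B) : Prop :=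
  ∀ t ∈ Icc 0 T, u t = u 0 + ∫ r in (0 : ℝ)..t, u' r

/-- `u ∈ H¹(0,T; B)`, where `u` is the continuous representative. -/
def MemH1Time [NormedSpace ℝ B] (T : ℝ) (u : ℝ → B) : Prop :=
  MemLTime 2 T u ∧ ∃ u' : ℝ → B, MemLTime 2 T u' ∧ IsTimeDeriv T u u'

/-- `u ∈ H²(0,T; B)`, where `u` is the continuously differentiable representative. -/
def MemH2Time [NormedSpace ℝ B] (T : ℝ) (u : ℝ → B) : Prop :=
  MemLTime 2 T u ∧ ∃ u' : ℝ → B, IsTimeDeriv T u u' ∧ MemH1Time T u'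

end Time

/-! ### The truncated problem -/

section Problem

variable {d : ℕ}

/-- The interaction domain `Ω_λ`. -/
def interactionDomain (Ω : Set (Sp d)) (lam : ℝ) : Set (Sp d) :=
  {y | y ∉ Ω ∧ ∃ x ∈ Ω, dist x y ≤ lam}

/-- `Ω ∪ Ω_λ`. -/
def extDomain (Ω : Set (Sp d)) (lam : ℝ) : Set (Sp d) := Ω ∪ interactionDomain Ω lam

lemma subset_extDomain (Ω : Set (Sp d)) (lam : ℝ) : Ω ⊆ extDomain Ω lam := subset_union_left

/-- `H¹(Ω ∪ Ω_λ)`, for velocity fields. -/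
abbrev H1Vel (Ω : Set (Sp d)) (lam : ℝ) : Type :=
  SobolevSpace 1 (extDomain Ω lam) (Sp d)

/-- The velocity space `X`: the elements of `H¹(Ω ∪ Ω_λ)` that vanish outside `Ω`. -/
def velocitySpace (Ω : Set (Sp d)) (lam : ℝ) : Submodule ℝ (H1Vel Ω lam) where
  carrier := {v | ∀ᵐ x ∂(volume.restrict (extDomain Ω lam)), x ∉ Ω → fn v x = 0}
  zero_mem' := by
    filter_upwards [Lp.coeFn_zero (Sp d) 2 (volume.restrict (extDomain Ω lam))] with x hx _
    exact hx
  add_mem' := by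
    intro u v hu hv
    filter_upwards [hu, hv, Lp.coeFn_add (u.1 (idx0 d 1)) (v.1 (idx0 d 1))] with x h₁ h₂ h₃ hx
    refine h₃.trans ?_
    have e₁ : (u.1 (idx0 d 1)) x = 0 := h₁ hx
    have e₂ : (v.1 (idx0 d 1)) x = 0 := h₂ hx
    simp [e₁, e₂]
  smul_mem' := by
    intro c u hu
    filter_upwards [hu, Lp.coeFn_smul c (u.1 (idx0 d 1))] with x h₁ h₃ hx
    refine h₃.trans ?_
    have e₁ : (u.1 (idx0 d 1)) x = 0 := h₁ hx
    simp [e₁]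

/-- The pressure space `Q = L²₀(Ω)`: square-integrable functions of zero mean. For bounded `Ω`
the integral is the inner product with the constant `1`. -/
def IsPressure (Ω : Set (Sp d)) (q : L2 Ω ℝ) : Prop := ∫ x in Ω, q x = 0

variable {Ω : Set (Sp d)} {lam : ℝ}

/-- The divergence. -/
def div (v : H1Vel Ω lam) (x : Sp d) : ℝ := ∑ i, (pd i v x) i

/-- `∫_Ω ∇u : ∇v`. -/
def gradForm (u v : H1Vel Ω lam) : ℝ := ∫ x in Ω, ∑ i, inner ℝ (pd i u x) (pd i v x)

/-- `‖∇v‖_{L²(Ω)}`. -/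
def gradNorm (v : H1Vel Ω lam) : ℝ := Real.sqrt (∫ x in Ω, ∑ i, ‖pd i v x‖ ^ 2)

/-- `b_Ω(u,v,w) = ∫_Ω (u·∇)v · w`. -/
def convForm (u v w : H1Vel Ω lam) : ℝ :=
  ∫ x in Ω, inner ℝ (∑ i, fn u x i • pd i v x) (fn w x)

/-- The explicitly skew-symmetric form `½ ((u·∇)v, w) - ½ ((u·∇)w, v)`. -/
def skewForm (u v w : H1Vel Ω lam) : ℝ :=
  1 / 2 * convForm u v w - 1 / 2 * convForm u w v

/-- The constant `C_{d,α}` in the fractional Laplacian. -/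
def fracConst (d : ℕ) (α : ℝ) : ℝ :=
  α * 2 ^ (2 * α) * Real.Gamma (((d : ℝ) + 2) / 2) / (Real.Gamma (1 / 2) * Real.Gamma (1 - α))

/-- The nonlocal form
`C_{d,α}/2 ∫_{Ω∪Ω_λ} ∫_{(Ω∪Ω_λ) ∩ B_λ(x)} (u(x)-u(y))·(v(x)-v(y)) / |x-y|^{d+2α} dy dx`. -/
def nonlocalForm (α : ℝ) (u v : H1Vel Ω lam) : ℝ :=
  fracConst d α / 2 *
    ∫ x in extDomain Ω lam, ∫ y in extDomain Ω lam ∩ Metric.closedBall x lam,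
      inner ℝ (fn u x - fn u y) (fn v x - fn v y) / ‖x - y‖ ^ ((d : ℝ) + 2 * α)

/-- `(u, p)` solves the truncated variational problem on `(0,T]` with body force `f`. The time
derivative is that of `t ↦ u(t)|_Ω` in `L²(Ω)` (one-sided at `T`). -/
structure IsTruncatedSolution (ν γ α T : ℝ) (f : ℝ → L2 Ω (Sp d)) (u : ℝ → H1Vel Ω lam)
    (p : ℝ → L2 Ω ℝ) : Prop where
  mem_velocity : ∀ t ∈ Icc 0 T, u t ∈ velocitySpace Ω lam
  mem_pressure : ∀ t ∈ Ioc 0 T, IsPressure Ω (p t)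
  momentum : ∀ t ∈ Ioc 0 T, ∃ ut : L2 Ω (Sp d),
    HasDerivWithinAt (fun r => restrictL2 (subset_extDomain Ω lam) (u r)) ut (Icc 0 T) t ∧
    ∀ v ∈ velocitySpace Ω lam,
      (∫ x in Ω, inner ℝ (ut x) (fn v x)) + convForm (u t) (u t) v + ν * gradForm (u t) v
        - (∫ x in Ω, p t x * div v x) + γ * nonlocalForm α (u t) v
      = ∫ x in Ω, inner ℝ (f t x) (fn v x)
  incompressible : ∀ t ∈ Ioc 0 T, ∀ q : L2 Ω ℝ, IsPressure Ω q →
    ∫ x in Ω, div (u t) x * q x = 0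

/-- The regularity of the exact solution and of the body force:
`u ∈ L^∞(0,T; H¹(Ω)) ∩ L⁴(0,T; H^{k+1}(Ω)) ∩ H²(0,T; L²(Ω)) ∩ H¹(0,T; H^{k+1}(Ω))`,
`p ∈ L²(0,T; H^{s+1}(Ω))`, with discrete norms `(∑ₙ Δt ‖p(tₙ)‖²_{H^{s+1}(Ω)})^{1/2}` bounded
independently of `Δt`, and `f ∈ L²(0,T; L²(Ω))`. -/
structure IsRegular (k s : ℕ) (T : ℝ) (f : ℝ → L2 Ω (Sp d)) (u : ℝ → H1Vel Ω lam)
    (p : ℝ → L2 Ω ℝ) : Prop where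
  velocity_H1 : ∃ U : ℝ → SobolevSpace 1 Ω (Sp d),
    (∀ t ∈ Icc 0 T, Represents (U t) (fn (u t))) ∧ MemLTime ∞ T U
  velocity_Hk : ∃ U : ℝ → SobolevSpace (k + 1) Ω (Sp d),
    (∀ t ∈ Icc 0 T, Represents (U t) (fn (u t))) ∧ MemLTime 4 T U ∧ MemH1Time T U
  velocity_H2 : MemH2Time T (fun t => restrictL2 (subset_extDomain Ω lam) (u t))
  pressure : ∃ P : ℝ → SobolevSpace (s + 1) Ω ℝ,
    (∀ t ∈ Ioc 0 T, Represents (P t) (p t)) ∧ MemLTime 2 T P ∧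
    ∃ M : ℝ, ∀ NT : ℕ, 1 ≤ NT →
      ∑ n ∈ Finset.range NT, T / NT * ‖P ((n + 1 : ℕ) * (T / NT))‖ ^ 2 ≤ M
  force : MemLTime 2 T f

/-! ### The fully discrete scheme -/

/-- `Xh`, `Qh` are conforming finite element spaces of mesh size `h` that satisfy the discrete
inf-sup condition with constant `β` and the approximation properties of orders `k`, `s` with
constant `C₀`. -/
structure IsFEPair (k s : ℕ) (β C₀ h : ℝ) (Xh : Submodule ℝ (H1Vel Ω lam))
    (Qh : Submodule ℝ (L2 Ω ℝ)) : Prop where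
  finite_velocity : FiniteDimensional ℝ Xh
  finite_pressure : FiniteDimensional ℝ Qh
  conforming_velocity : Xh ≤ velocitySpace Ω lam
  conforming_pressure : ∀ q ∈ Qh, IsPressure Ω q
  inf_sup : ∀ q ∈ Qh,
    β * normL2 Ω q ≤
      ⨆ v : Xh, (∫ x in Ω, q x * div (v : H1Vel Ω lam) x) / gradNorm (v : H1Vel Ω lam)
  approx_velocity : ∀ v ∈ velocitySpace Ω lam, ∀ V : SobolevSpace (k + 1) Ω (Sp d),
    Represents V (fn v) →
      ⨅ vh : Xh, normL2 Ω (fn (v - (vh : H1Vel Ω lam))) ≤ C₀ * h ^ (k + 1) * ‖V‖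
  approx_gradient : ∀ v ∈ velocitySpace Ω lam, ∀ V : SobolevSpace (k + 1) Ω (Sp d),
    Represents V (fn v) →
      ⨅ vh : Xh, gradNorm (v - (vh : H1Vel Ω lam)) ≤ C₀ * h ^ k * ‖V‖
  approx_pressure : ∀ q : L2 Ω ℝ, IsPressure Ω q → ∀ P : SobolevSpace (s + 1) Ω ℝ,
    Represents P q →
      ⨅ qh : Qh, normL2 Ω (q - (qh : L2 Ω ℝ) : L2 Ω ℝ) ≤ C₀ * h ^ (s + 1) * ‖P‖

/-- `(uh n)` for `n ≤ NT` and `(ph n)` for `1 ≤ n ≤ NT` are computed by the IMEX Euler finite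
element scheme with time step `Δt`. -/
structure IsDiscreteSolution (ν γ α Δt : ℝ) (NT : ℕ) (f : ℝ → L2 Ω (Sp d))
    (Xh : Submodule ℝ (H1Vel Ω lam)) (Qh : Submodule ℝ (L2 Ω ℝ))
    (uh : ℕ → H1Vel Ω lam) (ph : ℕ → L2 Ω ℝ) : Prop where
  mem_velocity : ∀ n ≤ NT, uh n ∈ Xh
  mem_pressure : ∀ n < NT, ph (n + 1) ∈ Qh
  momentum : ∀ n < NT, ∀ v ∈ Xh,
    (∫ x in Ω, inner ℝ (Δt⁻¹ • (fn (uh (n + 1)) x - fn (uh n) x)) (fn v x))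
      + skewForm (uh n) (uh (n + 1)) v + ν * gradForm (uh (n + 1)) v
      + γ * nonlocalForm α (uh (n + 1)) v - (∫ x in Ω, ph (n + 1) x * div v x)
    = ∫ x in Ω, inner ℝ (f ((n + 1 : ℕ) * Δt) x) (fn v x)
  incompressible : ∀ n < NT, ∀ q ∈ Qh, ∫ x in Ω, div (uh (n + 1)) x * q x = 0

end Problem

end FracNSE

end

/-! The error is split as `u - uh = η - φ`, with `η = u - W` and `φ = uh - W`. Here `W` is a
discrete velocity whose gradient is the `L²`-orthogonal projection of `∇u(tⁿ)` onto the gradients of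
discretely divergence-free fields. This choice does four things. The viscous term of `η` vanishes
against `φ`. The inf-sup condition bounds `‖∇η‖` by a multiple of the best approximation error in
the whole velocity space (`norm_sub_projection_le`), hence by `h ^ k`. Contractivity of the
projection keeps `‖∇W‖` bounded. Its linearity makes the time increments of `η` projection errors of
increments of `u`, whose squares sum to `O(Δt)` because `∂ₜu ∈ L²(0,T; H^{k+1})`.

Subtracting the scheme from the equation and testing with `φ` gives `error_identity`. As `φ` is
discretely divergence-free, the pressure may be replaced by its best approximation error. The exact
velocity is divergence-free, so its convection form equals the skew-symmetric one, and advection of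
`φ` by the discrete velocity does no work. The nonlocal form is symmetric and nonnegative, so its
cross term is absorbed at the cost of its value at `η`, which is controlled by `‖∇η‖²`: translates
of an `H¹` function differ by `O(|z|)` in `L²`, and `|z|²` times the truncated kernel is integrable
for `α < 1`.

The delicate convection term is the one transported by the previous `φ`. Interpolating `L⁴` between
`L²` and `L⁶` bounds it by `(δ‖∇φⁿ‖ + K‖φⁿ‖)‖∇W‖‖∇φⁿ⁺¹‖` with `δ` as small as needed. The gradient
part is absorbed by viscosity at two consecutive steps, which is why `‖∇e⁰‖` enters the estimate.
The rest is lagged in time and goes into a Gronwall argument without restriction on `Δt`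
(`energy_absorb`, `discrete_gronwall`). The difference quotient is consistent to first order because
`u ∈ H²(0,T; L²)` (`exists_truncation_bound`).

No regularity of the boundary of `Ω` is available, so the functional analysis rests on
`exists_h1Approx`: the zero extension of a velocity component is an `H¹` limit of smooth functions
supported in one fixed compact set. Sobolev and Poincaré inequalities, integration by parts and the
translation estimate then pass to the limit from smooth functions. -/

namespace FracNSE

/-! ### Mollification in `L²` -/

section Mollify

variable {d : ℕ}

/-- A sequence that converges almost everywhere and whose norms do not exceed that of the limit
converges in `L²`. -/
lemma tendsto_eLpNorm_sub_of_ae_of_le {α : Type*} [MeasurableSpace α] {μ : Measure α}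
    {f : ℕ → α → ℝ} {g : α → ℝ} (hf : ∀ n, AEStronglyMeasurable (f n) μ) (hg : MemLp g 2 μ)
    (hle : ∀ n, eLpNorm (f n) 2 μ ≤ eLpNorm g 2 μ)
    (hlim : ∀ᵐ x ∂μ, Tendsto (fun n => f n x) atTop (𝓝 (g x))) :
    Tendsto (fun n => eLpNorm (f n - g) 2 μ) atTop (𝓝 0) := by
  have hfm : ∀ n, MemLp (f n) 2 μ := fun n => ⟨hf n, (hle n).trans_lt hg.2⟩
  let F : ℕ → Lp ℝ 2 μ := fun n => (hfm n).toLp (f n)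
  let G : Lp ℝ 2 μ := hg.toLp g
  have hFG : ∀ n, ‖F n‖ ≤ ‖G‖ := fun n => by
    simp only [F, G, Lp.norm_toLp]
    exact ENNReal.toReal_mono hg.2.ne (hle n)
  -- Fatou applied to `f n + g` gives `liminf ‖F n + G‖ ≥ 2‖G‖`. Together with `‖F n‖ ≤ ‖G‖`,
  -- uniform convexity of `L²` then forces strong convergence.
  have hsum : ∀ ε > 0, ∀ᶠ n in atTop, 2 * ‖G‖ - ε ≤ ‖F n + G‖ := by
    intro ε hε
    have h1 : eLpNorm (g + g) 2 μ ≤ atTop.liminf fun n => eLpNorm (f n + g) 2 μ := by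
      refine Lp.eLpNorm_lim_le_liminf_eLpNorm (fun n => (hf n).add hg.1) _ ?_
      filter_upwards [hlim] with x hx
      exact hx.add tendsto_const_nhds
    have h2 : eLpNorm (g + g) 2 μ = ENNReal.ofReal (2 * ‖G‖) := by
      have : ‖G + G‖ = 2 * ‖G‖ := by rw [← two_smul ℝ G, norm_smul]; simp
      rw [← this, ← MemLp.toLp_add, Lp.norm_toLp, ENNReal.ofReal_toReal]
      exact (hg.add hg).2.ne
    have h3 : ∀ n, eLpNorm (f n + g) 2 μ = ENNReal.ofReal ‖F n + G‖ := by
      intro n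
      rw [← MemLp.toLp_add, Lp.norm_toLp, ENNReal.ofReal_toReal]
      exact ((hfm n).add hg).2.ne
    rcases le_or_gt (2 * ‖G‖ - ε) 0 with h0 | h0
    · exact Eventually.of_forall fun n => h0.trans (norm_nonneg _)
    · have h4 : ENNReal.ofReal (2 * ‖G‖ - ε) < atTop.liminf fun n => eLpNorm (f n + g) 2 μ := by
        refine lt_of_lt_of_le ?_ h1
        rw [h2, ENNReal.ofReal_lt_ofReal_iff (by linarith)]
        linarith
      filter_upwards [eventually_lt_of_lt_liminf h4] with n hn
      rw [h3] at hn
      exact ((ENNReal.ofReal_lt_ofReal_iff' ).1 hn).1.le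
  have hlimF : Tendsto (fun n => ‖F n - G‖) atTop (𝓝 0) := by
    have hsq : Tendsto (fun n => ‖F n - G‖ ^ 2) atTop (𝓝 0) := by
      rw [Metric.tendsto_atTop]
      intro ε hε
      obtain ⟨δ, hδ, hδε⟩ : ∃ δ > 0, 4 * ‖G‖ * δ < ε := by
        refine ⟨ε / (8 * (‖G‖ + 1)), by positivity, ?_⟩
        rw [mul_div_assoc', div_lt_iff₀ (by positivity)]
        nlinarith [norm_nonneg G]
      obtain ⟨N, hN⟩ := eventually_atTop.1 (hsum δ hδ)
      refine ⟨N, fun n hn => ?_⟩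
      -- The parallelogram law yields `‖F n - G‖² ≤ 4‖G‖² - ‖F n + G‖²`, which is at most `4‖G‖δ`.
      have hp := parallelogram_law_with_norm ℝ (F n) G
      have h1 := hN n hn
      have h2 := hFG n
      rw [Real.dist_eq, sub_zero, abs_of_nonneg (by positivity)]
      rcases le_or_gt (2 * ‖G‖ - δ) 0 with h0 | h0
      · nlinarith [norm_nonneg (F n), norm_nonneg G, norm_nonneg (F n + G)]
      · nlinarith [norm_nonneg (F n), norm_nonneg G, norm_nonneg (F n + G)]
    have := hsq.sqrt
    simpa [Real.sqrt_sq] using this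
  have : ∀ n, eLpNorm (f n - g) 2 μ = ENNReal.ofReal ‖F n - G‖ := by
    intro n
    rw [← MemLp.toLp_sub, Lp.norm_toLp, ENNReal.ofReal_toReal]
    exact ((hfm n).sub hg).2.ne
  simp_rw [this]
  simpa using ENNReal.tendsto_ofReal hlimF

open scoped Convolution

/-- Convolution with a probability density does not increase the `L²` norm. -/
lemma eLpNorm_convolution_le {φ g : Sp d → ℝ} (hφ : Continuous φ) (hφ0 : ∀ x, 0 ≤ φ x)
    (hφ1 : ∫ x, φ x = 1) (hφc : HasCompactSupport φ) (hg : MemLp g 2 volume) :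
    eLpNorm (φ ⋆[ContinuousLinearMap.lsmul ℝ ℝ, volume] g) 2 volume ≤ eLpNorm g 2 volume := by
  have hφi : Integrable φ := hφ.integrable_of_hasCompactSupport hφc
  -- The convolution at `x` is an average of `t ↦ g (x - t)` against a probability measure. The
  -- inclusion of `L²` in `L¹` for that measure is the pointwise Jensen inequality; Tonelli and
  -- translation invariance finish the proof.
  let ν : Measure (Sp d) := volume.withDensity fun x => ENNReal.ofReal (φ x)
  have hφm : Measurable fun x => ENNReal.ofReal (φ x) := hφ.measurable.ennreal_ofReal
  have hν : IsProbabilityMeasure ν := by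
    refine ⟨?_⟩
    rw [withDensity_apply _ MeasurableSet.univ, Measure.restrict_univ,
      ← ofReal_integral_eq_lintegral_ofReal hφi (Eventually.of_forall hφ0), hφ1, ENNReal.ofReal_one]
  have hgx : ∀ x, AEStronglyMeasurable (fun t => g (x - t)) volume := fun x =>
    hg.1.comp_quasiMeasurePreserving
      (quasiMeasurePreserving_sub_left_of_right_invariant volume x)
  have hνac : ν ≪ volume := withDensity_absolutelyContinuous _ _
  have key : ∀ x, ‖(φ ⋆[ContinuousLinearMap.lsmul ℝ ℝ, volume] g) x‖ₑ ^ (2 : ℝ)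
      ≤ ∫⁻ t, ENNReal.ofReal (φ t) * ‖g (x - t)‖ₑ ^ (2 : ℝ) := by
    intro x
    have h1 : ‖(φ ⋆[ContinuousLinearMap.lsmul ℝ ℝ, volume] g) x‖ₑ
        ≤ eLpNorm (fun t => g (x - t)) 1 ν := by
      rw [convolution_def, eLpNorm_one_eq_lintegral_enorm,
        lintegral_withDensity_eq_lintegral_mul₀ hφm.aemeasurable (hgx x).enorm]
      refine (enorm_integral_le_lintegral_enorm _).trans (lintegral_mono fun t => ?_)
      simp only [ContinuousLinearMap.lsmul_apply, smul_eq_mul, Pi.mul_apply, enorm_mul]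
      rw [Real.enorm_of_nonneg (hφ0 t)]
    have h2 : eLpNorm (fun t => g (x - t)) 1 ν ≤ eLpNorm (fun t => g (x - t)) 2 ν :=
      eLpNorm_le_eLpNorm_of_exponent_le (by norm_num) ((hgx x).mono_ac hνac)
    have h3 : eLpNorm (fun t => g (x - t)) 2 ν ^ (2 : ℝ)
        = ∫⁻ t, ENNReal.ofReal (φ t) * ‖g (x - t)‖ₑ ^ (2 : ℝ) := by
      rw [eLpNorm_eq_lintegral_rpow_enorm_toReal (by norm_num) (by norm_num), ← ENNReal.rpow_mul]
      simp only [ENNReal.toReal_ofNat]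
      norm_num
      rw [lintegral_withDensity_eq_lintegral_mul₀ hφm.aemeasurable ((hgx x).enorm.pow_const _)]
      rfl
    rw [← h3]
    exact ENNReal.rpow_le_rpow (h1.trans h2) (by norm_num)
  rw [eLpNorm_eq_lintegral_rpow_enorm_toReal (by norm_num) (by norm_num),
    eLpNorm_eq_lintegral_rpow_enorm_toReal (by norm_num) (by norm_num)]
  simp only [ENNReal.toReal_ofNat]
  refine ENNReal.rpow_le_rpow ?_ (by norm_num)
  calc ∫⁻ x, ‖(φ ⋆[ContinuousLinearMap.lsmul ℝ ℝ, volume] g) x‖ₑ ^ (2 : ℝ)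
      ≤ ∫⁻ x, ∫⁻ t, ENNReal.ofReal (φ t) * ‖g (x - t)‖ₑ ^ (2 : ℝ) := lintegral_mono key
    _ = ∫⁻ t, ∫⁻ x, ENNReal.ofReal (φ t) * ‖g (x - t)‖ₑ ^ (2 : ℝ) := by
        refine lintegral_lintegral_swap ?_
        refine AEMeasurable.mul (hφm.comp measurable_snd).aemeasurable (AEMeasurable.pow_const ?_ _)
        exact (hg.1.comp_quasiMeasurePreserving
          (quasiMeasurePreserving_sub_of_right_invariant volume volume)).enorm
    _ = ∫⁻ t, ENNReal.ofReal (φ t) * ∫⁻ x, ‖g x‖ₑ ^ (2 : ℝ) := by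
        refine lintegral_congr fun t => ?_
        rw [lintegral_const_mul'' _ ?_, lintegral_sub_right_eq_self (fun x => ‖g x‖ₑ ^ (2 : ℝ)) t]
        exact ((hg.1.comp_quasiMeasurePreserving
          (measurePreserving_sub_right volume t).quasiMeasurePreserving).enorm.pow_const _)
    _ = ∫⁻ x, ‖g x‖ₑ ^ (2 : ℝ) := by
        rw [lintegral_mul_const _ hφm,
          ← ofReal_integral_eq_lintegral_ofReal hφi (Eventually.of_forall hφ0), hφ1]
        simp

end Mollify

/-! ### Weak gradients and their mollification -/

section WeakGradient

variable {d : ℕ}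

/-- The classical derivative of `ψ` in the coordinate direction `i`. -/
noncomputable def dirDeriv (i : Fin d) (ψ : Sp d → ℝ) (x : Sp d) : ℝ :=
  fderiv ℝ ψ x (EuclideanSpace.single i (1 : ℝ))

/-- `g` is the weak gradient of `v` on the whole space. -/
def HasWeakGrad (v : Sp d → ℝ) (g : Fin d → Sp d → ℝ) : Prop :=
  ∀ ψ : Sp d → ℝ, ContDiff ℝ ∞ ψ → HasCompactSupport ψ → ∀ i,
    ∫ x, dirDeriv i ψ x * v x = - ∫ x, ψ x * g i x

/-- The sequence `ψ` of smooth functions supported in `S` converges to `v` in `L²`, with gradients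
converging to `g`. -/
structure H1Approx (S : Set (Sp d)) (ψ : ℕ → Sp d → ℝ) (v : Sp d → ℝ)
    (g : Fin d → Sp d → ℝ) : Prop where
  smooth : ∀ n, ContDiff ℝ ∞ (ψ n)
  support : ∀ n, Function.support (ψ n) ⊆ S
  memLp : MemLp v 2 volume
  memLp_grad : ∀ i, MemLp (g i) 2 volume
  tendsto : Tendsto (fun n => eLpNorm (ψ n - v) 2 volume) atTop (𝓝 0)
  tendsto_grad : ∀ i, Tendsto (fun n => eLpNorm (dirDeriv i (ψ n) - g i) 2 volume) atTop (𝓝 0)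

lemma continuous_dirDeriv {ψ : Sp d → ℝ} (hψ : ContDiff ℝ ∞ ψ) (i : Fin d) :
    Continuous (dirDeriv i ψ) :=
  (hψ.continuous_fderiv (by simp)).clm_apply continuous_const

lemma support_dirDeriv_subset (ψ : Sp d → ℝ) (i : Fin d) :
    Function.support (dirDeriv i ψ) ⊆ tsupport ψ := by
  intro x hx
  refine support_fderiv_subset ℝ ?_
  intro h0
  exact hx (by simp [dirDeriv, h0])

lemma hasCompactSupport_dirDeriv {ψ : Sp d → ℝ} (hψ : HasCompactSupport ψ) (i : Fin d) :
    HasCompactSupport (dirDeriv i ψ) :=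
  hψ.mono' (support_dirDeriv_subset ψ i)

open scoped Convolution

/-- The derivative falls on `φ`, and `t ↦ φ (x - t)` is an admissible test function for the weak
gradient. The sign from the reflection cancels the sign of the integration by parts. -/
lemma dirDeriv_convolution {φ v : Sp d → ℝ} {g : Fin d → Sp d → ℝ} (hφ : ContDiff ℝ ∞ φ)
    (hφc : HasCompactSupport φ) (hv : LocallyIntegrable v) (hg : HasWeakGrad v g) (i : Fin d) :
    dirDeriv i (φ ⋆[ContinuousLinearMap.lsmul ℝ ℝ, volume] v)
      = φ ⋆[ContinuousLinearMap.lsmul ℝ ℝ, volume] g i := by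
  funext x
  have h1 := hφc.hasFDerivAt_convolution_left (ContinuousLinearMap.lsmul ℝ ℝ)
    (hφ.of_le (by simp)) hv x
  have hex := (hφc.fderiv (𝕜 := ℝ)).convolutionExists_left
    (ContinuousLinearMap.precompL (Sp d) (ContinuousLinearMap.lsmul ℝ ℝ : ℝ →L[ℝ] ℝ →L[ℝ] ℝ))
    (hφ.continuous_fderiv (by simp)) hv x
  rw [dirDeriv, h1.fderiv, convolution_def, ContinuousLinearMap.integral_apply hex]
  simp only [ContinuousLinearMap.precompL_apply, ContinuousLinearMap.lsmul_apply, smul_eq_mul]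
  rw [convolution_lsmul_swap]
  have hψ : ContDiff ℝ ∞ fun t => φ (x - t) := hφ.comp (contDiff_const.sub contDiff_id)
  have hψc : HasCompactSupport fun t => φ (x - t) :=
    hφc.comp_homeomorph (Homeomorph.subLeft x)
  have h2 := hg _ hψ hψc i
  have h3 : ∀ t, dirDeriv i (fun t => φ (x - t)) t = - dirDeriv i φ (x - t) := by
    intro t
    have ha : HasFDerivAt (fun t => x - t) (-ContinuousLinearMap.id ℝ (Sp d)) t := by
      simpa using (hasFDerivAt_id t).const_sub x
    have hb : HasFDerivAt φ (fderiv ℝ φ (x - t)) (x - t) :=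
      (hφ.differentiable (by simp) _).hasFDerivAt
    have hc : HasFDerivAt (fun t => φ (x - t)) _ t := hb.comp t ha
    rw [dirDeriv, hc.fderiv]
    simp [dirDeriv]
  simp only [h3, neg_mul, integral_neg, neg_inj] at h2
  simp only [smul_eq_mul]
  rw [← h2, ← integral_sub_left_eq_self _ _ x]
  simp [dirDeriv]

/-- Bumps with radii tending to zero. -/
noncomputable def shrinkingBump (d n : ℕ) : ContDiffBump (0 : Sp d) where
  rIn := 1 / (2 * ((n : ℝ) + 1))
  rOut := 1 / ((n : ℝ) + 1)
  rIn_pos := by positivity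
  rIn_lt_rOut := by
    apply one_div_lt_one_div_of_lt (by positivity)
    nlinarith [(Nat.cast_nonneg n : (0 : ℝ) ≤ n)]

/-- Lebesgue differentiation gives convergence almost everywhere, using that the outer radius is
only twice the inner one. Since mollification does not increase the norm,
`tendsto_eLpNorm_sub_of_ae_of_le` upgrades this to `L²` convergence. -/
lemma tendsto_mollify {v : Sp d → ℝ} (hv : MemLp v 2 volume) :
    Tendsto (fun n => eLpNorm (((shrinkingBump d n).normed volume
      ⋆[ContinuousLinearMap.lsmul ℝ ℝ, volume] v) - v) 2 volume) atTop (𝓝 0) := by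
  have hloc : LocallyIntegrable v := hv.locallyIntegrable (by norm_num)
  have hc : ∀ n, Continuous ((shrinkingBump d n).normed volume) := fun n =>
    ((shrinkingBump d n).contDiff_normed (n := 0)).continuous
  refine tendsto_eLpNorm_sub_of_ae_of_le (fun n => ?_) hv (fun n => ?_) ?_
  · exact ((shrinkingBump d n).hasCompactSupport_normed.continuous_convolution_left _
      (hc n) hloc).aestronglyMeasurable
  · exact eLpNorm_convolution_le (hc n) (shrinkingBump d n).nonneg_normed
      (shrinkingBump d n).integral_normed (shrinkingBump d n).hasCompactSupport_normed hv
  · refine ContDiffBump.ae_convolution_tendsto_right_of_locallyIntegrable (K := 2) ?_ ?_ hloc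
    · exact tendsto_one_div_add_atTop_nhds_zero_nat
    · refine Eventually.of_forall fun n => ?_
      simp only [shrinkingBump]
      field_simp
      exact le_rfl

/-- A compactly supported function with a weak gradient is a limit of smooth functions. -/
lemma HasWeakGrad.exists_approx {K : Set (Sp d)} {v : Sp d → ℝ} {g : Fin d → Sp d → ℝ}
    (hg : HasWeakGrad v g) (hv2 : MemLp v 2 volume) (hg2 : ∀ i, MemLp (g i) 2 volume)
    (hK : Function.support v ⊆ K) : ∃ ψ, H1Approx (Metric.cthickening 1 K) ψ v g := by
  have hloc : LocallyIntegrable v := hv2.locallyIntegrable (by norm_num)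
  have hs : ∀ n, ContDiff ℝ ∞ ((shrinkingBump d n).normed volume) := fun n =>
    (shrinkingBump d n).contDiff_normed
  refine ⟨fun n => (shrinkingBump d n).normed volume
    ⋆[ContinuousLinearMap.lsmul ℝ ℝ, volume] v, fun n => ?_, fun n => ?_, hv2, hg2,
    tendsto_mollify hv2, fun i => ?_⟩
  · exact (shrinkingBump d n).hasCompactSupport_normed.contDiff_convolution_left _ (hs n) hloc
  · refine (support_convolution_subset_swap _).trans ?_
    rintro _ ⟨x, hx, y, hy, rfl⟩
    refine Metric.mem_cthickening_of_dist_le _ x 1 K (hK hx) ?_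
    rw [(shrinkingBump d n).support_normed_eq, mem_ball_zero_iff] at hy
    have : (shrinkingBump d n).rOut ≤ 1 := by
      simp only [shrinkingBump]
      rw [div_le_one (by positivity)]
      linarith [(Nat.cast_nonneg n : (0 : ℝ) ≤ n)]
    simpa [dist_eq_norm] using hy.le.trans this
  · have : ∀ n, dirDeriv i ((shrinkingBump d n).normed volume
        ⋆[ContinuousLinearMap.lsmul ℝ ℝ, volume] v) = ((shrinkingBump d n).normed volume
        ⋆[ContinuousLinearMap.lsmul ℝ ℝ, volume] g i) := fun n =>
      dirDeriv_convolution (hs n) (shrinkingBump d n).hasCompactSupport_normed hloc hg i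
    simp_rw [this]
    exact tendsto_mollify (hg2 i)

end WeakGradient

/-! ### Limits of products and of their integrals -/

section Limits

variable {α : Type*} [MeasurableSpace α] {μ : Measure α}

/-- Products of convergent sequences converge, in the Hölder-conjugate norm. -/
lemma tendsto_eLpNorm_mul_sub {p q r : ℝ≥0∞} [hpqr : ENNReal.HolderTriple p q r] (hr : 1 ≤ r)
    {f g : ℕ → α → ℝ} {F G : α → ℝ}
    (hf : ∀ n, AEStronglyMeasurable (f n) μ) (hg : ∀ n, AEStronglyMeasurable (g n) μ)
    (hF : MemLp F p μ) (hG : MemLp G q μ)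
    (hfF : Tendsto (fun n => eLpNorm (f n - F) p μ) atTop (𝓝 0))
    (hgG : Tendsto (fun n => eLpNorm (g n - G) q μ) atTop (𝓝 0)) (hq : 1 ≤ q) :
    Tendsto (fun n => eLpNorm (f n * g n - F * G) r μ) atTop (𝓝 0) := by
  have hbd : ∀ n, eLpNorm (f n * g n - F * G) r μ
      ≤ eLpNorm (f n - F) p μ * (eLpNorm (g n - G) q μ + eLpNorm G q μ)
        + eLpNorm F p μ * eLpNorm (g n - G) q μ := by
    intro n
    have h1 : f n * g n - F * G = (f n - F) • g n + F • (g n - G) := by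
      simp only [smul_eq_mul]; ring
    rw [h1]
    have hgn : eLpNorm (g n) q μ ≤ eLpNorm (g n - G) q μ + eLpNorm G q μ := by
      have := eLpNorm_add_le ((hg n).sub hG.1) hG.1 hq
      simpa using this
    refine (eLpNorm_add_le (((hf n).sub hF.1).smul (hg n)) (hF.1.smul ((hg n).sub hG.1)) hr).trans ?_
    gcongr
    · exact (eLpNorm_smul_le_mul_eLpNorm (hg n) ((hf n).sub hF.1)).trans (by gcongr)
    · exact eLpNorm_smul_le_mul_eLpNorm ((hg n).sub hG.1) hF.1
  refine tendsto_of_tendsto_of_tendsto_of_le_of_le tendsto_const_nhds ?_ (fun n => zero_le) hbd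
  have h1 : Tendsto (fun n => eLpNorm (f n - F) p μ * (eLpNorm (g n - G) q μ + eLpNorm G q μ))
      atTop (𝓝 (0 * (0 + eLpNorm G q μ))) :=
    ENNReal.Tendsto.mul hfF (Or.inr (by simpa using hG.2.ne))
      (hgG.add tendsto_const_nhds) (Or.inr (by simp))
  have h2 : Tendsto (fun n => eLpNorm F p μ * eLpNorm (g n - G) q μ)
      atTop (𝓝 (eLpNorm F p μ * 0)) :=
    ENNReal.Tendsto.mul tendsto_const_nhds (Or.inr (by simp)) hgG (Or.inr hF.2.ne)
  simpa using h1.add h2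

lemma memLp_of_tendsto {p : ℝ≥0∞} {f : ℕ → α → ℝ} {F : α → ℝ}
    (hf : ∀ n, AEStronglyMeasurable (f n) μ) (hF : MemLp F p μ)
    (h : Tendsto (fun n => eLpNorm (f n - F) p μ) atTop (𝓝 0)) :
    ∀ᶠ n in atTop, MemLp (f n) p μ := by
  filter_upwards [h.eventually_lt_const (zero_lt_one)] with n hn
  have h1 : MemLp (f n - F) p μ := ⟨(hf n).sub hF.1, hn.trans (by simp)⟩
  simpa using h1.add hF

/-- Integrals of products of two `L²`-convergent sequences converge. -/
lemma tendsto_integral_mul {f g : ℕ → α → ℝ} {F G : α → ℝ}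
    (hf : ∀ n, AEStronglyMeasurable (f n) μ) (hg : ∀ n, AEStronglyMeasurable (g n) μ)
    (hF : MemLp F 2 μ) (hG : MemLp G 2 μ)
    (hfF : Tendsto (fun n => eLpNorm (f n - F) 2 μ) atTop (𝓝 0))
    (hgG : Tendsto (fun n => eLpNorm (g n - G) 2 μ) atTop (𝓝 0)) :
    Tendsto (fun n => ∫ x, f n x * g n x ∂μ) atTop (𝓝 (∫ x, F x * G x ∂μ)) := by
  have h := tendsto_eLpNorm_mul_sub (p := 2) (q := 2) (r := 1) le_rfl hf hg hF hG hfF hgG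
    (by norm_num)
  refine tendsto_integral_of_L1' (fun x => F x * G x) (hF.integrable_mul hG).1 ?_ h
  filter_upwards [memLp_of_tendsto hf hF hfF, memLp_of_tendsto hg hG hgG]
    with n h1 h2
  exact h1.integrable_mul h2

end Limits

/-! ### Chain rule for weak gradients and Stampacchia's theorem -/

section Stampacchia

variable {d : ℕ} {S : Set (Sp d)} {ψ : ℕ → Sp d → ℝ} {v : Sp d → ℝ} {g : Fin d → Sp d → ℝ}

lemma H1Approx.hasCompactSupport (h : H1Approx S ψ v g) (hS : IsCompact S) (n : ℕ) :
    HasCompactSupport (ψ n) :=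
  HasCompactSupport.of_support_subset_isCompact hS (h.support n)

lemma H1Approx.aestronglyMeasurable (h : H1Approx S ψ v g) (n : ℕ) :
    AEStronglyMeasurable (ψ n) volume := (h.smooth n).continuous.aestronglyMeasurable

lemma H1Approx.aestronglyMeasurable_grad (h : H1Approx S ψ v g) (i : Fin d) (n : ℕ) :
    AEStronglyMeasurable (dirDeriv i (ψ n)) volume :=
  (continuous_dirDeriv (h.smooth n) i).aestronglyMeasurable

lemma integral_mul_dirDeriv {φ ψ : Sp d → ℝ} (hφ : ContDiff ℝ 1 φ) (hφc : HasCompactSupport φ)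
    (hψ : ContDiff ℝ 1 ψ) (i : Fin d) :
    ∫ x, φ x * dirDeriv i ψ x = - ∫ x, dirDeriv i φ x * ψ x := by
  have hdφ : Continuous (dirDeriv i φ) :=
    (hφ.continuous_fderiv (by simp)).clm_apply continuous_const
  have hdψ : Continuous (dirDeriv i ψ) :=
    (hψ.continuous_fderiv (by simp)).clm_apply continuous_const
  refine integral_mul_fderiv_eq_neg_fderiv_mul_of_integrable ?_ ?_ ?_
    (fun x _ => hφ.differentiable (by simp) x) (fun x _ => hψ.differentiable (by simp) x)
  · exact (hdφ.mul hψ.continuous).integrable_of_hasCompactSupport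
      ((hasCompactSupport_dirDeriv hφc i).mul_right)
  · exact (hφ.continuous.mul hdψ).integrable_of_hasCompactSupport hφc.mul_right
  · exact (hφ.continuous.mul hψ.continuous).integrable_of_hasCompactSupport hφc.mul_right

/-- The chain rule for weak derivatives, tested against `φ`. -/
lemma H1Approx.integral_chain (h : H1Approx S ψ v g) {F F' : ℝ → ℝ} {A B : ℝ≥0}
    (hF : ContDiff ℝ 1 F) (hF' : ∀ t, HasDerivAt F (F' t) t) (hF0 : F 0 = 0)
    (hA : LipschitzWith A F) (hB : LipschitzWith B F')
    {φ : Sp d → ℝ} (hφ : ContDiff ℝ ∞ φ) (hφc : HasCompactSupport φ) (i : Fin d) :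
    ∫ x, φ x * F' (v x) * g i x = - ∫ x, dirDeriv i φ x * F (v x) := by
  obtain ⟨M, hM⟩ := hφc.exists_bound_of_continuous hφ.continuous
  have hM0 : 0 ≤ M := (norm_nonneg _).trans (hM 0)
  have hdφ := continuous_dirDeriv hφ i
  have hdφc := hasCompactSupport_dirDeriv hφc i
  have hF'c : Continuous F' := hB.continuous
  have e : ∀ n, ∫ x, φ x * F' (ψ n x) * dirDeriv i (ψ n) x
      = - ∫ x, dirDeriv i φ x * F (ψ n x) := by
    intro n
    have hd : ∀ x, dirDeriv i (fun x => F (ψ n x)) x = F' (ψ n x) * dirDeriv i (ψ n) x := by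
      intro x
      have h1 : HasFDerivAt (fun x => F (ψ n x)) _ x :=
        (hF' (ψ n x)).comp_hasFDerivAt x ((h.smooth n).differentiable (by simp) x).hasFDerivAt
      rw [dirDeriv, h1.fderiv]
      simp [dirDeriv]
    have h2 := integral_mul_dirDeriv (ψ := fun x => F (ψ n x)) (hφ.of_le (by simp)) hφc
      (hF.comp ((h.smooth n).of_le (by simp))) i
    rw [← h2]
    simp_rw [hd, mul_assoc]
  -- The test function is kept next to `F'`: since `F' 0` may be nonzero, only the product with the
  -- compactly supported `φ` lies in `L²`. The Lipschitz bound on `F'` transfers the convergence of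
  -- `ψ n`.
  have l1 : Tendsto (fun n => ∫ x, φ x * F' (ψ n x) * dirDeriv i (ψ n) x) atTop
      (𝓝 (∫ x, φ x * F' (v x) * g i x)) := by
    have hFv : AEStronglyMeasurable (fun x => F' (v x)) volume :=
      hF'c.comp_aestronglyMeasurable h.memLp.1
    have hFb : ∀ x, ‖φ x * F' (v x)‖ ≤ ‖M * B * |v x| + |F' 0| * |φ x|‖ := by
      intro x
      have h1 : |F' (v x) - F' 0| ≤ B * |v x| := by simpa [Real.dist_eq] using hB.dist_le_mul (v x) 0
      have h2 : |F' (v x)| ≤ B * |v x| + |F' 0| := by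
        have := abs_sub_abs_le_abs_sub (F' (v x)) (F' 0)
        linarith
      rw [Real.norm_of_nonneg (by positivity : 0 ≤ M * B * |v x| + |F' 0| * |φ x|), norm_mul,
        Real.norm_eq_abs, Real.norm_eq_abs]
      have h3 := hM x
      rw [Real.norm_eq_abs] at h3
      calc |φ x| * |F' (v x)| ≤ |φ x| * (B * |v x| + |F' 0|) := by gcongr
        _ = |φ x| * (B * |v x|) + |F' 0| * |φ x| := by ring
        _ ≤ M * (B * |v x|) + |F' 0| * |φ x| := by gcongr
        _ = _ := by ring
    refine tendsto_integral_mul (f := fun n x => φ x * F' (ψ n x)) (F := fun x => φ x * F' (v x))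
      (fun n => ?_) (h.aestronglyMeasurable_grad i) ?_ (h.memLp_grad i) ?_ (h.tendsto_grad i)
    · exact (hφ.continuous.mul (hF'c.comp (h.smooth n).continuous)).aestronglyMeasurable
    · refine MemLp.mono ?_ (hφ.continuous.aestronglyMeasurable.mul hFv) (Eventually.of_forall hFb)
      exact (h.memLp.abs.const_mul _).add
        ((hφ.continuous.memLp_of_hasCompactSupport hφc).abs.const_mul _)
    · have hb : ∀ n, eLpNorm ((fun x => φ x * F' (ψ n x)) - fun x => φ x * F' (v x)) 2 volume
          ≤ ENNReal.ofReal (M * B) * eLpNorm (ψ n - v) 2 volume := by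
        intro n
        refine eLpNorm_le_mul_eLpNorm_of_ae_le_mul (Eventually.of_forall fun x => ?_) _
        have h1 := hB.dist_le_mul (ψ n x) (v x)
        rw [Real.dist_eq, Real.dist_eq] at h1
        simp only [Pi.sub_apply, ← mul_sub, norm_mul, Real.norm_eq_abs]
        have h3 := hM x
        rw [Real.norm_eq_abs] at h3
        calc |φ x| * |F' (ψ n x) - F' (v x)| ≤ M * (B * |ψ n x - v x|) := by gcongr
          _ = _ := by ring
      refine tendsto_of_tendsto_of_tendsto_of_le_of_le tendsto_const_nhds ?_ (fun n => zero_le) hb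
      simpa using ENNReal.Tendsto.const_mul h.tendsto (Or.inr ENNReal.ofReal_ne_top)
  have l2 : Tendsto (fun n => ∫ x, dirDeriv i φ x * F (ψ n x)) atTop
      (𝓝 (∫ x, dirDeriv i φ x * F (v x))) := by
    refine tendsto_integral_mul (f := fun n => dirDeriv i φ) (g := fun n x => F (ψ n x))
      (G := fun x => F (v x)) (fun n => hdφ.aestronglyMeasurable) (fun n => ?_)
      (hdφ.memLp_of_hasCompactSupport hdφc) ?_ (by simp) ?_
    · exact (hF.continuous.comp (h.smooth n).continuous).aestronglyMeasurable
    · exact hA.comp_memLp hF0 h.memLp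
    · have hb : ∀ n, eLpNorm ((fun x => F (ψ n x)) - fun x => F (v x)) 2 volume
          ≤ ENNReal.ofReal A * eLpNorm (ψ n - v) 2 volume := by
        intro n
        refine eLpNorm_le_mul_eLpNorm_of_ae_le_mul (Eventually.of_forall fun x => ?_) _
        simpa [Real.dist_eq] using hA.dist_le_mul (ψ n x) (v x)
      refine tendsto_of_tendsto_of_tendsto_of_le_of_le tendsto_const_nhds ?_ (fun n => zero_le) hb
      simpa using ENNReal.Tendsto.const_mul (a := ENNReal.ofReal A) h.tendsto
        (Or.inr ENNReal.ofReal_ne_top)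
  simp_rw [e] at l1
  exact tendsto_nhds_unique l1 l2.neg

lemma lipschitzWith_arctan : LipschitzWith 1 Real.arctan := by
  refine lipschitzWith_of_nnnorm_deriv_le Real.differentiable_arctan fun x => ?_
  rw [Real.deriv_arctan, ← NNReal.coe_le_coe, coe_nnnorm, Real.norm_of_nonneg (by positivity)]
  rw [NNReal.coe_one, div_le_one (by positivity)]
  nlinarith [sq_nonneg x]

lemma lipschitzWith_one_div_one_add_sq : LipschitzWith 1 fun t : ℝ => 1 / (1 + t ^ 2) := by
  refine LipschitzWith.of_dist_le_mul fun a b => ?_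
  rw [Real.dist_eq, Real.dist_eq, NNReal.coe_one, one_mul]
  have h1 : 1 / (1 + a ^ 2) - 1 / (1 + b ^ 2)
      = (a - b) * (-(a + b) / ((1 + a ^ 2) * (1 + b ^ 2))) := by
    field_simp
    ring
  rw [h1, abs_mul]
  refine mul_le_of_le_one_right (abs_nonneg _) ?_
  rw [abs_div, abs_neg, abs_of_pos (by positivity : 0 < (1 + a ^ 2) * (1 + b ^ 2)),
    div_le_one (by positivity), abs_le]
  constructor <;> nlinarith [sq_nonneg (a - 1), sq_nonneg (b - 1), sq_nonneg (a + 1),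
    sq_nonneg (b + 1), sq_nonneg (a * b)]

/-- The weak gradient vanishes almost everywhere on the zero set. -/
lemma H1Approx.grad_eq_zero (h : H1Approx S ψ v g) (i : Fin d) :
    ∀ᵐ x, v x = 0 → g i x = 0 := by
  classical
  let w : Sp d → ℝ := fun x => if v x = 0 then g i x else 0
  -- `K m` is the derivative of `arctan ((m + 1) t) / (m + 1)`. These primitives tend to zero
  -- uniformly, while `K m` tends pointwise to the indicator of `{0}`. In the limit the chain rule
  -- says that the gradient restricted to `{v = 0}` integrates to zero against every test function.
  let K : ℕ → ℝ → ℝ := fun m t => 1 / (1 + (((m : ℝ) + 1) * t) ^ 2)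
  have hK1 : ∀ m t, |K m t| ≤ 1 := by
    intro m t
    rw [abs_of_nonneg (by positivity), div_le_one (by positivity)]
    nlinarith [sq_nonneg (((m : ℝ) + 1) * t)]
  have hKlim : ∀ x, Tendsto (fun m => K m (v x) * g i x) atTop (𝓝 (w x)) := by
    intro x
    by_cases hx : v x = 0
    · simp [K, w, hx]
    · have h1 : Tendsto (fun m : ℕ => 1 + (((m : ℝ) + 1) * v x) ^ 2) atTop atTop := by
        refine tendsto_atTop_add_const_left _ _ ?_
        simp_rw [mul_pow]
        refine Tendsto.atTop_mul_const (by positivity) ?_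
        exact (tendsto_pow_atTop (by norm_num)).comp
          (tendsto_atTop_add_const_right _ _ tendsto_natCast_atTop_atTop)
      have h2 := (h1.inv_tendsto_atTop.mul_const (g i x))
      simpa [K, w, hx] using h2
  have hKm : ∀ m, AEStronglyMeasurable (fun x => K m (v x) * g i x) volume := by
    intro m
    refine AEStronglyMeasurable.mul (Continuous.comp_aestronglyMeasurable ?_ h.memLp.1)
      (h.memLp_grad i).1
    refine continuous_const.div (by fun_prop) fun t => by positivity
  have hwm : AEStronglyMeasurable w volume :=
    aestronglyMeasurable_of_tendsto_ae atTop hKm (Eventually.of_forall hKlim)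
  have hw2 : MemLp w 2 volume := by
    refine (h.memLp_grad i).mono hwm (Eventually.of_forall fun x => ?_)
    by_cases hx : v x = 0 <;> simp [w, hx]
  have hw : ∀ᵐ x, w x = 0 := by
    refine ae_eq_zero_of_integral_contDiff_smul_eq_zero (hw2.locallyIntegrable (by norm_num)) ?_
    intro φ hφ hφc
    have hdφ := continuous_dirDeriv hφ i
    have hdφc := hasCompactSupport_dirDeriv hφc i
    have e : ∀ m : ℕ, ∫ x, φ x * K m (v x) * g i x
        = - ∫ x, dirDeriv i φ x * (((m : ℝ) + 1)⁻¹ * Real.arctan (((m : ℝ) + 1) * v x)) := by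
      intro m
      have hm : (0 : ℝ) < (m : ℝ) + 1 := by positivity
      refine h.integral_chain (F := fun t => ((m : ℝ) + 1)⁻¹ * Real.arctan (((m : ℝ) + 1) * t))
        (F' := K m) (A := 1) (B := (m : ℝ≥0) + 1) ?_ ?_ (by simp) ?_ ?_ hφ hφc i
      · exact contDiff_const.mul (Real.contDiff_arctan.comp (contDiff_const.mul contDiff_id))
      · intro t
        have h1 : HasDerivAt (fun t : ℝ => ((m : ℝ) + 1) * t) ((m : ℝ) + 1) t := by
          simpa using (hasDerivAt_id t).const_mul ((m : ℝ) + 1)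
        have h2 := (h1.arctan).const_mul (((m : ℝ) + 1)⁻¹)
        refine h2.congr_deriv ?_
        change _ = 1 / (1 + (((m : ℝ) + 1) * t) ^ 2)
        field_simp
      · refine LipschitzWith.of_dist_le_mul fun a b => ?_
        have h1 := lipschitzWith_arctan.dist_le_mul (((m : ℝ) + 1) * a) (((m : ℝ) + 1) * b)
        rw [Real.dist_eq, Real.dist_eq, NNReal.coe_one, one_mul, ← mul_sub, abs_mul,
          abs_of_pos hm] at h1
        rw [Real.dist_eq, Real.dist_eq, ← mul_sub, abs_mul, abs_of_pos (inv_pos.2 hm),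
          NNReal.coe_one, one_mul, inv_mul_le_iff₀ hm]
        exact h1
      · refine LipschitzWith.of_dist_le_mul fun a b => ?_
        have h1 := lipschitzWith_one_div_one_add_sq.dist_le_mul (((m : ℝ) + 1) * a)
          (((m : ℝ) + 1) * b)
        rw [Real.dist_eq (_ * _), NNReal.coe_one, one_mul, ← mul_sub, abs_mul, abs_of_pos hm] at h1
        simpa [Real.dist_eq, K] using h1
    have l1 : Tendsto (fun m : ℕ => ∫ x, φ x * K m (v x) * g i x) atTop
        (𝓝 (∫ x, φ x * w x)) := by
      have hφg : Integrable fun x => φ x * g i x :=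
        (hφ.continuous.memLp_of_hasCompactSupport (p := 2) hφc).integrable_mul (h.memLp_grad i)
      refine tendsto_integral_of_dominated_convergence (fun x => ‖φ x * g i x‖) (fun m => ?_)
        hφg.norm (fun m => Eventually.of_forall fun x => ?_) (Eventually.of_forall fun x => ?_)
      · simpa only [mul_assoc] using! hφ.continuous.aestronglyMeasurable.mul (hKm m)
      · rw [norm_mul, norm_mul, norm_mul, Real.norm_eq_abs (K m (v x))]
        have := hK1 m (v x)
        calc ‖φ x‖ * |K m (v x)| * ‖g i x‖ ≤ ‖φ x‖ * 1 * ‖g i x‖ := by gcongr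
          _ = _ := by rw [mul_one]
      · simpa only [mul_assoc] using (hKlim x).const_mul (φ x)
    have l2 : Tendsto (fun m : ℕ => ∫ x, dirDeriv i φ x *
        (((m : ℝ) + 1)⁻¹ * Real.arctan (((m : ℝ) + 1) * v x))) atTop (𝓝 0) := by
      have hint : Integrable (dirDeriv i φ) := hdφ.integrable_of_hasCompactSupport hdφc
      refine squeeze_zero_norm (a := fun m : ℕ => (∫ x, ‖dirDeriv i φ x‖) * (1 / ((m : ℝ) + 1) * 2))
        (fun m => ?_) ?_
      · have hm : (0 : ℝ) < (m : ℝ) + 1 := by positivity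
        rw [← integral_mul_const]
        refine norm_integral_le_of_norm_le (hint.norm.mul_const _) (Eventually.of_forall fun x => ?_)
        rw [norm_mul]
        gcongr
        rw [norm_mul, Real.norm_of_nonneg (by positivity), inv_eq_one_div]
        gcongr
        rw [Real.norm_eq_abs, abs_le]
        constructor <;> linarith [Real.pi_lt_d2, Real.arctan_lt_pi_div_two (((m : ℝ) + 1) * v x),
          Real.neg_pi_div_two_lt_arctan (((m : ℝ) + 1) * v x)]
      · have := (tendsto_one_div_add_atTop_nhds_zero_nat (𝕜 := ℝ)).mul_const 2
        simpa using this.const_mul (∫ x, ‖dirDeriv i φ x‖)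
    simp_rw [e] at l1
    have := tendsto_nhds_unique l1 l2.neg
    simpa using this
  filter_upwards [hw] with x hx hv
  simpa [w, hv] using hx

end Stampacchia

/-! ### Zero extension of velocity fields -/

section Extension

variable {d : ℕ} {Ω : Set (Sp d)} {lam : ℝ}

lemma mem_extDomain_iff (hlam : 0 < lam) {y : Sp d} :
    y ∈ extDomain Ω lam ↔ ∃ x ∈ Ω, dist x y ≤ lam := by
  constructor
  · rintro (h | h)
    · exact ⟨y, h, by simpa using hlam.le⟩
    · exact h.2
  · intro h
    by_cases hy : y ∈ Ω
    · exact Or.inl hy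
    · exact Or.inr ⟨hy, h⟩

/-- The set is open although the distance condition is closed: moving `y` to a nearby `z` moves the
witness `x` to `x + (z - y)`, still in the open set `Ω` and at unchanged displacement. -/
lemma isOpen_extDomain (hΩ : IsOpen Ω) (hlam : 0 < lam) : IsOpen (extDomain Ω lam) := by
  rw [Metric.isOpen_iff]
  intro y hy
  obtain ⟨x, hx, hxy⟩ := (mem_extDomain_iff hlam).1 hy
  obtain ⟨r, hr, hrx⟩ := Metric.isOpen_iff.1 hΩ x hx
  refine ⟨r, hr, fun z hz => (mem_extDomain_iff hlam).2 ⟨x + (z - y), hrx ?_, ?_⟩⟩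
  · simpa [dist_eq_norm] using hz
  · rw [dist_eq_norm] at hxy ⊢
    have : x + (z - y) - z = x - y := by abel
    rwa [this]

/-- A smooth Urysohn function between the closure of `Ω` and its `lam / 2`-thickening.
Multiplication by it turns test functions on the whole space into test functions on the extended
domain, where the weak derivatives of velocities are defined. -/
lemma exists_cutoff (hΩb : Bornology.IsBounded Ω) (hlam : 0 < lam) :
    ∃ χ : Sp d → ℝ, ContDiff ℝ ∞ χ ∧ HasCompactSupport χ ∧ tsupport χ ⊆ extDomain Ω lam ∧
      (∀ x ∈ Ω, χ x = 1) ∧ ∀ x, |χ x| ≤ 1 := by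
  obtain ⟨χ, h1, h2, h3, h4⟩ := exists_contMDiff_support_eq_eq_one_iff
    (modelWithCornersSelf ℝ (Sp d)) (Metric.isOpen_thickening (δ := lam / 2) (E := Ω))
    isClosed_closure (Metric.closure_subset_thickening (by positivity) Ω)
  have ht : tsupport χ ⊆ Metric.cthickening (lam / 2) Ω := by
    rw [tsupport, h3]
    exact Metric.closure_thickening_subset_cthickening _ _
  refine ⟨χ, h1.contDiff, ?_, ?_, fun x hx => (h4 x).1 (subset_closure hx), fun x => ?_⟩
  · exact (hΩb.cthickening.isCompact_closure).of_isClosed_subset (isClosed_tsupport _)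
      (ht.trans subset_closure)
  · intro y hy
    have hy' : y ∈ Metric.thickening lam Ω :=
      Metric.cthickening_subset_thickening' hlam (by linarith) Ω (ht hy)
    obtain ⟨x, hx, hxy⟩ := Metric.mem_thickening_iff.1 hy'
    exact (mem_extDomain_iff hlam).2 ⟨x, hx, by rw [dist_comm]; exact hxy.le⟩
  · have := h2 ⟨x, rfl⟩
    rw [abs_of_nonneg this.1]
    exact this.2

/-- The extension by zero of the component `j` of a velocity field. -/
noncomputable def extVal (v : H1Vel Ω lam) (j : Fin d) : Sp d → ℝ := Ω.indicator fun x => fn v x j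

/-- The extension by zero of the derivative in direction `i` of the component `j`. -/
noncomputable def extGrad (v : H1Vel Ω lam) (j i : Fin d) : Sp d → ℝ :=
  Ω.indicator fun x => pd i v x j

lemma memLp_fn (v : H1Vel Ω lam) : MemLp (fn v) 2 (volume.restrict (extDomain Ω lam)) :=
  Lp.memLp _

lemma memLp_pd (i : Fin d) (v : H1Vel Ω lam) :
    MemLp (pd i v) 2 (volume.restrict (extDomain Ω lam)) := Lp.memLp _

lemma memLp_coord {μ : Measure (Sp d)} {p : ℝ≥0∞} {w : Sp d → Sp d} (hw : MemLp w p μ)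
    (j : Fin d) : MemLp (fun x => w x j) p μ :=
  (EuclideanSpace.proj j : Sp d →L[ℝ] ℝ).comp_memLp' hw

lemma memLp_extVal (hΩ : IsOpen Ω) (v : H1Vel Ω lam) (j : Fin d) :
    MemLp (extVal v j) 2 volume :=
  (memLp_indicator_iff_restrict hΩ.measurableSet).2 (memLp_coord
    ((memLp_fn v).mono_measure (Measure.restrict_mono (subset_extDomain Ω lam) le_rfl)) j)

lemma memLp_extGrad (hΩ : IsOpen Ω) (v : H1Vel Ω lam) (j i : Fin d) :
    MemLp (extGrad v j i) 2 volume :=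
  (memLp_indicator_iff_restrict hΩ.measurableSet).2 (memLp_coord
    ((memLp_pd i v).mono_measure (Measure.restrict_mono (subset_extDomain Ω lam) le_rfl)) j)

lemma integral_dirDeriv_mul_fn (v : H1Vel Ω lam) {φ : Sp d → ℝ} (hφ : IsTest (extDomain Ω lam) φ)
    (i j : Fin d) :
    ∫ x in extDomain Ω lam, dirDeriv i φ x * fn v x j
      = - ∫ x in extDomain Ω lam, φ x * pd i v x j := by
  have h := v.2 (idx1 i) φ hφ
  have hp : ∀ x, partialDeriv (idx1 i).2 φ x = dirDeriv i φ x := by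
    intro x
    simp only [partialDeriv, idx1, dirDeriv]
    exact iteratedFDeriv_one_apply _
  simp_rw [hp] at h
  have h' : (∫ x in extDomain Ω lam, dirDeriv i φ x • fn v x)
      = - ∫ x in extDomain Ω lam, φ x • pd i v x := by
    have h2 : ((-1 : ℝ) ^ (((idx1 i).1 : Fin 2) : ℕ)) = -1 := by simp [idx1]
    rw [h2, neg_one_smul] at h
    exact h
  have hφ2 : MemLp φ 2 (volume.restrict (extDomain Ω lam)) :=
    hφ.smooth.continuous.memLp_of_hasCompactSupport hφ.compact
  have hdφ2 : MemLp (dirDeriv i φ) 2 (volume.restrict (extDomain Ω lam)) :=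
    (continuous_dirDeriv hφ.smooth i).memLp_of_hasCompactSupport
      (hasCompactSupport_dirDeriv hφ.compact i)
  have i1 : Integrable (fun x => dirDeriv i φ x • fn v x) (volume.restrict (extDomain Ω lam)) :=
    memLp_one_iff_integrable.1 ((memLp_fn v).smul hdφ2)
  have i2 : Integrable (fun x => φ x • pd i v x) (volume.restrict (extDomain Ω lam)) :=
    memLp_one_iff_integrable.1 ((memLp_pd i v).smul hφ2)
  let π : Sp d →L[ℝ] ℝ := EuclideanSpace.proj j
  have h3 := congrArg π h'
  rw [map_neg, ← π.integral_comp_comm i1, ← π.integral_comp_comm i2] at h3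
  simpa [π] using h3

lemma dirDeriv_mul_cutoff {χ ψ : Sp d → ℝ} (hΩ : IsOpen Ω) (hχ1 : ∀ x ∈ Ω, χ x = 1) {x : Sp d}
    (hx : x ∈ Ω) (i : Fin d) : dirDeriv i (fun y => χ y * ψ y) x = dirDeriv i ψ x := by
  have : (fun y => χ y * ψ y) =ᶠ[𝓝 x] ψ := by
    filter_upwards [hΩ.mem_nhds hx] with y hy
    rw [hχ1 y hy, one_mul]
  rw [dirDeriv, this.fderiv_eq, dirDeriv]

/-- The weak derivative on the extended domain is tested with `χ ψ`. On `Ω` the cutoff is one, so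
the derivative is that of `ψ`; off `Ω` the velocity vanishes. The gradient found here could a priori
charge the complement of `Ω`, which `exists_h1Approx` excludes. -/
lemma hasWeakGrad_extVal (hΩ : IsOpen Ω) (hlam : 0 < lam) {v : H1Vel Ω lam}
    (hv : v ∈ velocitySpace Ω lam) {χ : Sp d → ℝ} (hχ : ContDiff ℝ ∞ χ)
    (hχs : tsupport χ ⊆ extDomain Ω lam) (hχ1 : ∀ x ∈ Ω, χ x = 1) (j : Fin d) :
    HasWeakGrad (extVal v j) fun i => (extDomain Ω lam).indicator fun x => χ x * pd i v x j := by
  intro ψ hψ hψc i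
  have hD := (isOpen_extDomain hΩ hlam).measurableSet
  have ht : IsTest (extDomain Ω lam) fun y => χ y * ψ y :=
    ⟨hχ.mul hψ, hψc.mul_left, (tsupport_mul_subset_left).trans hχs⟩
  have h := integral_dirDeriv_mul_fn v ht i j
  have e1 : ∫ x in extDomain Ω lam, dirDeriv i (fun y => χ y * ψ y) x * fn v x j
      = ∫ x, dirDeriv i ψ x * extVal v j x := by
    have : ∀ᵐ x ∂(volume.restrict (extDomain Ω lam)),
        dirDeriv i (fun y => χ y * ψ y) x * fn v x j = dirDeriv i ψ x * extVal v j x := by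
      have hv' : ∀ᵐ x ∂(volume.restrict (extDomain Ω lam)), x ∉ Ω → fn v x = 0 := hv
      filter_upwards [hv'] with x hx
      by_cases hxΩ : x ∈ Ω
      · rw [dirDeriv_mul_cutoff hΩ hχ1 hxΩ, extVal, indicator_of_mem hxΩ]
      · rw [hx hxΩ, extVal, indicator_of_notMem hxΩ]
        simp
    rw [integral_congr_ae this, ← integral_indicator hD]
    congr 1
    funext x
    by_cases hxD : x ∈ extDomain Ω lam
    · rw [indicator_of_mem hxD]
    · have hxΩ : x ∉ Ω := fun h => hxD (subset_extDomain Ω lam h)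
      rw [indicator_of_notMem hxD, extVal, indicator_of_notMem hxΩ, mul_zero]
  rw [← e1, h, ← integral_indicator hD]
  congr 2
  funext x
  by_cases hxD : x ∈ extDomain Ω lam
  · simp only [indicator_of_mem hxD]; ring
  · simp only [indicator_of_notMem hxD, mul_zero]

lemma H1Approx.congr_grad {S : Set (Sp d)} {ψ : ℕ → Sp d → ℝ} {v : Sp d → ℝ}
    {g g' : Fin d → Sp d → ℝ} (h : H1Approx S ψ v g) (hgg' : ∀ i, g i =ᵐ[volume] g' i) :
    H1Approx S ψ v g' where
  smooth := h.smooth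
  support := h.support
  memLp := h.memLp
  memLp_grad i := (memLp_congr_ae (hgg' i)).1 (h.memLp_grad i)
  tendsto := h.tendsto
  tendsto_grad i := by
    refine (h.tendsto_grad i).congr fun n => eLpNorm_congr_ae ?_
    filter_upwards [hgg' i] with x hx
    simp [hx]

/-- Components of velocity fields, extended by zero, are limits of smooth functions with supports
in a fixed compact set. -/
theorem exists_h1Approx (hΩ : IsOpen Ω) (hΩb : Bornology.IsBounded Ω) (hlam : 0 < lam)
    {v : H1Vel Ω lam} (hv : v ∈ velocitySpace Ω lam) (j : Fin d) :
    ∃ ψ, H1Approx (Metric.cthickening 1 Ω) ψ (extVal v j) (extGrad v j) := by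
  obtain ⟨χ, hχ, hχc, hχs, hχ1, hχb⟩ := exists_cutoff hΩb hlam
  have hD := (isOpen_extDomain hΩ hlam).measurableSet
  have hw := hasWeakGrad_extVal hΩ hlam hv hχ hχs hχ1 j
  have hg2 : ∀ i, MemLp ((extDomain Ω lam).indicator fun x => χ x * pd i v x j) 2 volume := by
    intro i
    refine (memLp_indicator_iff_restrict hD).2 ?_
    refine (memLp_coord (memLp_pd i v) j).mono
      (hχ.continuous.aestronglyMeasurable.mul (memLp_coord (memLp_pd i v) j).1)
      (Eventually.of_forall fun x => ?_)
    rw [norm_mul]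
    exact mul_le_of_le_one_left (norm_nonneg _) (hχb x)
  obtain ⟨ψ, h⟩ := hw.exists_approx (memLp_extVal hΩ v j) hg2 (K := Ω)
    Set.support_indicator_subset
  refine ⟨ψ, h.congr_grad fun i => ?_⟩
  -- Outside `Ω` the extension is zero, so by Stampacchia's theorem its weak gradient vanishes there
  -- almost everywhere, even if the boundary of `Ω` has positive measure.
  filter_upwards [h.grad_eq_zero i] with x hx
  by_cases hxΩ : x ∈ Ω
  · rw [indicator_of_mem (subset_extDomain Ω lam hxΩ), extGrad, indicator_of_mem hxΩ, hχ1 x hxΩ,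
      one_mul]
  · rw [hx (by rw [extVal, indicator_of_notMem hxΩ]), extGrad, indicator_of_notMem hxΩ]

end Extension

/-! ### Sobolev embeddings up to the exponent six -/

section Sobolev

variable {d : ℕ}

lemma norm_fderiv_le_sum (ψ : Sp d → ℝ) (x : Sp d) :
    ‖fderiv ℝ ψ x‖ ≤ ∑ i, |dirDeriv i ψ x| := by
  refine ContinuousLinearMap.opNorm_le_bound _ (by positivity) fun z => ?_
  have hz : z = ∑ i, z i • EuclideanSpace.single i (1 : ℝ) := by
    ext j
    simp [Finset.sum_apply, Pi.single_apply]
  have h1 : fderiv ℝ ψ x z = ∑ i, z i * dirDeriv i ψ x := by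
    conv_lhs => rw [hz]
    simp [dirDeriv]
  rw [h1, Finset.sum_mul]
  refine (norm_sum_le _ _).trans (Finset.sum_le_sum fun i _ => ?_)
  rw [norm_mul, mul_comm, Real.norm_eq_abs (dirDeriv i ψ x)]
  gcongr
  exact PiLp.norm_apply_le z i

lemma eLpNorm_fderiv_le {ψ : Sp d → ℝ} (hψ : ContDiff ℝ ∞ ψ) :
    eLpNorm (fderiv ℝ ψ) 2 volume ≤ ∑ i, eLpNorm (dirDeriv i ψ) 2 volume := by
  have h1 : eLpNorm (fderiv ℝ ψ) 2 volume
      ≤ eLpNorm (∑ i, fun x => |dirDeriv i ψ x|) 2 volume := by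
    refine eLpNorm_mono_real fun x => ?_
    simpa [Finset.sum_apply] using norm_fderiv_le_sum ψ x
  refine h1.trans ((eLpNorm_sum_le (fun i _ => ?_) (by norm_num)).trans_eq ?_)
  · exact (continuous_dirDeriv hψ i).abs.aestronglyMeasurable
  · exact Finset.sum_congr rfl fun i _ => eLpNorm_norm (dirDeriv i ψ)

/-- The Sobolev inequality for smooth functions supported in a compact set. -/
lemma exists_sobolev_smooth (hd : d = 2 ∨ d = 3) {S : Set (Sp d)} (hS : IsCompact S)
    {q : ℝ≥0} (hq0 : 0 < q) (hq : q ≤ 6) :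
    ∃ C : ℝ≥0, ∀ ψ : Sp d → ℝ, ContDiff ℝ ∞ ψ → Function.support ψ ⊆ S →
      eLpNorm ψ q volume ≤ C * ∑ i, eLpNorm (dirDeriv i ψ) 2 volume := by
  have hq' : (6 : ℝ)⁻¹ ≤ (q : ℝ)⁻¹ := by
    have : (q : ℝ) ≤ 6 := by exact_mod_cast hq
    gcongr
  have hfr : Module.finrank ℝ (Sp d) = d := by simp
  rcases hd with rfl | rfl
  -- In the plane the exponent two is critical, so the inequality is used for `3 / 2`, whose Sobolev
  -- conjugate is six, followed by Hölder on `S`. In dimension three the conjugate of two is already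
  -- six.
  · have hμ : volume S ≠ ⊤ := hS.measure_lt_top.ne
    let c1 := eLpNormLESNormFDerivOfLeConst ℝ (volume : Measure (Sp 2)) S (3 / 2) q
    let c2 := volume S ^ (1 / (3 / 2 : ℝ) - 1 / 2)
    have hc2 : c2 ≠ ⊤ := ENNReal.rpow_ne_top_of_nonneg (by norm_num) hμ
    refine ⟨c1 * c2.toNNReal, fun ψ hψ hψs => ?_⟩
    have h1 : eLpNorm ψ q volume
        ≤ c1 * eLpNorm (fderiv ℝ ψ) ((3 / 2 : ℝ≥0) : ℝ≥0∞) volume := by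
      refine eLpNorm_le_eLpNorm_fderiv_of_le volume (hψ.of_le (by simp)) hψs ?_ ?_ ?_ hS.isBounded
      · rw [← NNReal.coe_le_coe]; norm_num
      · rw [hfr, ← NNReal.coe_lt_coe]; norm_num
      · rw [hfr]; push_cast; norm_num; norm_num at hq'; linarith
    have hsup : Function.support (fderiv ℝ ψ) ⊆ S :=
      (support_fderiv_subset ℝ).trans (closure_minimal hψs hS.isClosed)
    have hcont : Continuous (fderiv ℝ ψ) := hψ.continuous_fderiv (by simp)
    have h2 : eLpNorm (fderiv ℝ ψ) ((3 / 2 : ℝ≥0) : ℝ≥0∞) volume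
        ≤ eLpNorm (fderiv ℝ ψ) 2 volume * c2 := by
      have hsup' : Function.support (fun x => ‖fderiv ℝ ψ x‖) ⊆ S := fun x hx =>
        hsup fun h0 => hx (by simp [h0])
      have hres : ∀ p : ℝ≥0∞, eLpNorm (fderiv ℝ ψ) p (volume.restrict S)
          = eLpNorm (fderiv ℝ ψ) p volume := fun p => by
        rw [← eLpNorm_norm, ← eLpNorm_norm (fderiv ℝ ψ)]
        exact eLpNorm_restrict_eq_of_support_subset hsup'
      rw [← hres, ← hres 2]
      have h3 := eLpNorm_le_eLpNorm_mul_rpow_measure_univ (μ := volume.restrict S)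
        (p := ((3 / 2 : ℝ≥0) : ℝ≥0∞)) (q := ((2 : ℝ≥0) : ℝ≥0∞)) (f := fderiv ℝ ψ)
        (by rw [ENNReal.coe_le_coe, ← NNReal.coe_le_coe]; norm_num) hcont.aestronglyMeasurable
      simpa [c2] using h3
    calc eLpNorm ψ q volume
        ≤ c1 * (eLpNorm (fderiv ℝ ψ) 2 volume * c2) := h1.trans (by gcongr)
      _ = (c1 * c2) * eLpNorm (fderiv ℝ ψ) 2 volume := by ring
      _ ≤ (c1 * c2) * ∑ i, eLpNorm (dirDeriv i ψ) 2 volume := by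
          gcongr; exact eLpNorm_fderiv_le hψ
      _ = _ := by rw [ENNReal.coe_mul, ENNReal.coe_toNNReal hc2]
  · refine ⟨eLpNormLESNormFDerivOfLeConst ℝ (volume : Measure (Sp 3)) S 2 q,
      fun ψ hψ hψs => ?_⟩
    have h1 : eLpNorm ψ q volume
        ≤ eLpNormLESNormFDerivOfLeConst ℝ (volume : Measure (Sp 3)) S 2 q
          * eLpNorm (fderiv ℝ ψ) ((2 : ℝ≥0) : ℝ≥0∞) volume := by
      refine eLpNorm_le_eLpNorm_fderiv_of_le volume (hψ.of_le (by simp)) hψs ?_ ?_ ?_ hS.isBounded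
      · rw [← NNReal.coe_le_coe]; norm_num
      · rw [hfr, ← NNReal.coe_lt_coe]; norm_num
      · rw [hfr]; push_cast; norm_num; norm_num at hq'; linarith
    exact h1.trans (by gcongr; exact eLpNorm_fderiv_le hψ)

variable {S : Set (Sp d)} {ψ : ℕ → Sp d → ℝ} {v : Sp d → ℝ} {g : Fin d → Sp d → ℝ}

lemma H1Approx.exists_seq_ae (h : H1Approx S ψ v g) :
    ∃ ns : ℕ → ℕ, StrictMono ns ∧ ∀ᵐ x, Tendsto (fun n => ψ (ns n) x) atTop (𝓝 (v x)) :=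
  (tendstoInMeasure_of_tendsto_eLpNorm (by norm_num) (fun n => h.aestronglyMeasurable n)
    h.memLp.1 h.tendsto).exists_seq_tendsto_ae

lemma tendsto_eLpNorm_of_sub {α : Type*} [MeasurableSpace α] {μ : Measure α} {p : ℝ≥0∞}
    (hp : 1 ≤ p) {f : ℕ → α → ℝ} {F : α → ℝ}
    (hf : ∀ n, AEStronglyMeasurable (f n) μ) (hF : MemLp F p μ)
    (h : Tendsto (fun n => eLpNorm (f n - F) p μ) atTop (𝓝 0)) :
    Tendsto (fun n => eLpNorm (f n) p μ) atTop (𝓝 (eLpNorm F p μ)) := by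
  have h1 : Tendsto (fun n => eLpNorm F p μ - eLpNorm (f n - F) p μ) atTop
      (𝓝 (eLpNorm F p μ - 0)) :=
    ENNReal.Tendsto.sub tendsto_const_nhds h (Or.inl hF.2.ne)
  have h2 : Tendsto (fun n => eLpNorm (f n - F) p μ + eLpNorm F p μ) atTop
      (𝓝 (0 + eLpNorm F p μ)) := h.add tendsto_const_nhds
  rw [tsub_zero] at h1
  rw [zero_add] at h2
  refine tendsto_of_tendsto_of_tendsto_of_le_of_le h1 h2 (fun n => ?_) fun n => ?_
  · rw [tsub_le_iff_right]
    have := eLpNorm_sub_le (hf n) ((hf n).sub hF.1) hp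
    simpa using this
  · have := eLpNorm_add_le ((hf n).sub hF.1) hF.1 hp
    simpa using this

/-- The Sobolev inequality for limits of smooth functions. -/
lemma exists_sobolev (hd : d = 2 ∨ d = 3) {S : Set (Sp d)} (hS : IsCompact S)
    {q : ℝ≥0} (hq0 : 0 < q) (hq : q ≤ 6) :
    ∃ C : ℝ≥0, ∀ ψ v g, H1Approx S ψ v g →
      eLpNorm v q volume ≤ C * ∑ i, eLpNorm (g i) 2 volume := by
  obtain ⟨C, hC⟩ := exists_sobolev_smooth hd hS hq0 hq
  refine ⟨C, fun ψ v g h => ?_⟩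
  obtain ⟨ns, hns, hae⟩ := h.exists_seq_ae
  refine (Lp.eLpNorm_lim_le_liminf_eLpNorm (fun n => h.aestronglyMeasurable (ns n)) v hae).trans ?_
  have h1 : Tendsto (fun n => (C : ℝ≥0∞) * ∑ i, eLpNorm (dirDeriv i (ψ (ns n))) 2 volume) atTop
      (𝓝 (C * ∑ i, eLpNorm (g i) 2 volume)) := by
    refine ENNReal.Tendsto.const_mul (tendsto_finsetSum _ fun i _ => ?_) (Or.inr ENNReal.coe_ne_top)
    exact (tendsto_eLpNorm_of_sub (by norm_num) (h.aestronglyMeasurable_grad i) (h.memLp_grad i)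
      (h.tendsto_grad i)).comp hns.tendsto_atTop
  rw [← h1.liminf_eq]
  exact liminf_le_liminf (Eventually.of_forall fun n =>
    hC _ (h.smooth (ns n)) (h.support (ns n)))

lemma H1Approx.memLp_of_le (h : H1Approx S ψ v g) (hd : d = 2 ∨ d = 3) (hS : IsCompact S)
    {q : ℝ≥0} (hq0 : 0 < q) (hq : q ≤ 6) : MemLp v q volume := by
  obtain ⟨C, hC⟩ := exists_sobolev hd hS hq0 hq
  refine ⟨h.memLp.1, (hC ψ v g h).trans_lt (ENNReal.mul_lt_top ENNReal.coe_lt_top ?_)⟩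
  exact ENNReal.sum_lt_top.2 fun i _ => (h.memLp_grad i).2

lemma dirDeriv_sub {φ ψ : Sp d → ℝ} (hφ : ContDiff ℝ ∞ φ) (hψ : ContDiff ℝ ∞ ψ) (i : Fin d) :
    dirDeriv i (φ - ψ) = dirDeriv i φ - dirDeriv i ψ := by
  funext x
  simp only [dirDeriv, Pi.sub_apply]
  rw [fderiv_sub (hφ.differentiable (by simp) x) (hψ.differentiable (by simp) x)]
  simp

/-- Shifting the whole sequence by one of its members lets the Sobolev inequality act on `v - ψ m`,
which turns gradient convergence into `L^q` convergence. -/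
lemma H1Approx.sub_smooth (h : H1Approx S ψ v g) (hS : IsCompact S) (m : ℕ) :
    H1Approx S (fun n => ψ n - ψ m) (v - ψ m) fun i => g i - dirDeriv i (ψ m) where
  smooth n := (h.smooth n).sub (h.smooth m)
  support n := (Function.support_sub _ _).trans (union_subset (h.support n) (h.support m))
  memLp := h.memLp.sub
    ((h.smooth m).continuous.memLp_of_hasCompactSupport (h.hasCompactSupport hS m))
  memLp_grad i := (h.memLp_grad i).sub ((continuous_dirDeriv (h.smooth m) i).memLp_of_hasCompactSupport
    (hasCompactSupport_dirDeriv (h.hasCompactSupport hS m) i))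
  tendsto := by simpa using h.tendsto
  tendsto_grad i := by
    have : ∀ n, dirDeriv i (ψ n - ψ m) - (g i - dirDeriv i (ψ m)) = dirDeriv i (ψ n) - g i := by
      intro n
      rw [dirDeriv_sub (h.smooth n) (h.smooth m)]
      abel
    simpa only [this] using h.tendsto_grad i

/-- Smooth approximations converge in every `L^q` with `q ≤ 6`. -/
lemma H1Approx.tendsto_of_le (h : H1Approx S ψ v g) (hd : d = 2 ∨ d = 3) (hS : IsCompact S)
    {q : ℝ≥0} (hq0 : 0 < q) (hq : q ≤ 6) :
    Tendsto (fun n => eLpNorm (ψ n - v) q volume) atTop (𝓝 0) := by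
  obtain ⟨C, hC⟩ := exists_sobolev hd hS hq0 hq
  have h1 : Tendsto (fun n => (C : ℝ≥0∞) * ∑ i, eLpNorm (dirDeriv i (ψ n) - g i) 2 volume) atTop
      (𝓝 (C * ∑ _i : Fin d, 0)) :=
    ENNReal.Tendsto.const_mul (tendsto_finsetSum _ fun i _ => h.tendsto_grad i)
      (Or.inr ENNReal.coe_ne_top)
  simp only [Finset.sum_const_zero, mul_zero] at h1
  refine tendsto_of_tendsto_of_tendsto_of_le_of_le tendsto_const_nhds h1 (fun n => zero_le) fun n => ?_
  have h2 := hC _ _ _ (h.sub_smooth hS n)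
  rw [eLpNorm_sub_comm]
  refine h2.trans_eq ?_
  congr 1
  exact Finset.sum_congr rfl fun i _ => eLpNorm_sub_comm _ _ _ _

end Sobolev

/-! ### Velocities, gradients and divergences as Hilbert space elements -/

section Maps

variable {d : ℕ} {Ω : Set (Sp d)} {lam : ℝ}

/-- The restriction of square-integrable functions to a smaller set. -/
noncomputable def resL {F : Type} [NormedAddCommGroup F] [NormedSpace ℝ F] {D : Set (Sp d)}
    (h : Ω ⊆ D) : L2 D F →ₗ[ℝ] L2 Ω F where
  toFun f := ((Lp.memLp f).mono_measure (Measure.restrict_mono h le_rfl)).toLp f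
  map_add' f g := by
    rw [← MemLp.toLp_add]
    exact MemLp.toLp_congr _ _ (ae_mono (Measure.restrict_mono h le_rfl) (Lp.coeFn_add f g))
  map_smul' c f := by
    rw [RingHom.id_apply, ← MemLp.toLp_const_smul]
    exact MemLp.toLp_congr _ _ (ae_mono (Measure.restrict_mono h le_rfl) (Lp.coeFn_smul c f))

lemma coeFn_resL {F : Type} [NormedAddCommGroup F] [NormedSpace ℝ F] {D : Set (Sp d)}
    (h : Ω ⊆ D) (f : L2 D F) : resL h f =ᵐ[volume.restrict Ω] f :=
  MemLp.coeFn_toLp ((Lp.memLp f).mono_measure (Measure.restrict_mono h le_rfl))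

/-- The restriction of a velocity field to `Ω`. -/
noncomputable def valMap : H1Vel Ω lam →ₗ[ℝ] L2 Ω (Sp d) where
  toFun v := resL (subset_extDomain Ω lam) (v.1 (idx0 d 1))
  map_add' u v := map_add _ (u.1 (idx0 d 1)) (v.1 (idx0 d 1))
  map_smul' c v := map_smul _ c (v.1 (idx0 d 1))

/-- The Hilbert space of matrix fields on `Ω`. -/
abbrev GradSpace (Ω : Set (Sp d)) : Type := PiLp 2 fun _ : Fin d => L2 Ω (Sp d)

/-- The gradient of a velocity field on `Ω`. -/
noncomputable def gradMap : H1Vel Ω lam →ₗ[ℝ] GradSpace Ω where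
  toFun v := WithLp.toLp 2 fun i => resL (subset_extDomain Ω lam) (v.1 (idx1 i))
  map_add' u v := by
    ext1 i
    exact map_add (resL (subset_extDomain Ω lam)) (u.1 (idx1 i)) (v.1 (idx1 i))
  map_smul' c v := by
    ext1 i
    exact map_smul (resL (subset_extDomain Ω lam)) c (v.1 (idx1 i))

/-- The trace of a matrix field. -/
noncomputable def divMap (Ω : Set (Sp d)) : GradSpace Ω →L[ℝ] L2 Ω ℝ :=
  ∑ i, ((EuclideanSpace.proj i : Sp d →L[ℝ] ℝ).compLpL 2 (volume.restrict Ω)).comp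
    (PiLp.proj 2 (fun _ : Fin d => L2 Ω (Sp d)) i)

lemma coeFn_valMap (v : H1Vel Ω lam) : valMap v =ᵐ[volume.restrict Ω] fn v :=
  coeFn_resL (subset_extDomain Ω lam) _

lemma coeFn_gradMap (v : H1Vel Ω lam) (i : Fin d) :
    gradMap v i =ᵐ[volume.restrict Ω] pd i v :=
  coeFn_resL (subset_extDomain Ω lam) _

lemma coeFn_divMap (v : H1Vel Ω lam) :
    divMap Ω (gradMap v) =ᵐ[volume.restrict Ω] div v := by
  have h1 : divMap Ω (gradMap v) = ∑ i, (EuclideanSpace.proj i : Sp d →L[ℝ] ℝ).compLp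
      (gradMap v i) := by
    simp only [divMap, sum_apply]
    rfl
  rw [h1]
  have h2 : ∀ᵐ x ∂(volume.restrict Ω), ∀ i, (EuclideanSpace.proj i : Sp d →L[ℝ] ℝ).compLp
      (gradMap v i) x = pd i v x i := by
    rw [ae_all_iff]
    intro i
    filter_upwards [coeFn_gradMap v i, (EuclideanSpace.proj i : Sp d →L[ℝ] ℝ).coeFn_compLp
      (gradMap v i)] with x hx hx2
    rw [hx2, hx]
    rfl
  filter_upwards [h2, Lp.coeFn_finsetSum Finset.univ fun i =>
    (EuclideanSpace.proj i : Sp d →L[ℝ] ℝ).compLp (gradMap v i)] with x hx hx2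
  rw [hx2]
  simp only [Finset.sum_apply, div]
  exact Finset.sum_congr rfl fun i _ => hx i

lemma integral_inner_valMap (f : L2 Ω (Sp d)) (v : H1Vel Ω lam) :
    ∫ x in Ω, inner ℝ (f x) (fn v x) = inner ℝ f (valMap v) := by
  rw [L2.inner_def]
  refine integral_congr_ae ?_
  filter_upwards [coeFn_valMap v] with x hx
  rw [hx]

lemma gradForm_eq_inner (u v : H1Vel Ω lam) :
    gradForm u v = inner ℝ (gradMap u) (gradMap v) := by
  rw [gradForm, PiLp.inner_apply]
  simp_rw [L2.inner_def]
  rw [← integral_finsetSum _ fun i _ => L2.integrable_inner _ _]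
  refine integral_congr_ae ?_
  have h1 := ae_all_iff.2 (coeFn_gradMap u)
  have h2 := ae_all_iff.2 (coeFn_gradMap v)
  filter_upwards [h1, h2] with x hx hx2
  exact Finset.sum_congr rfl fun i _ => by rw [hx, hx2]

lemma gradNorm_eq_norm (v : H1Vel Ω lam) : gradNorm v = ‖gradMap v‖ := by
  have h : (∫ x in Ω, ∑ i, ‖pd i v x‖ ^ 2) = gradForm v v := by
    simp only [gradForm, real_inner_self_eq_norm_sq]
  rw [gradNorm, h, gradForm_eq_inner, real_inner_self_eq_norm_sq, Real.sqrt_sq (norm_nonneg _)]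

lemma normL2_eq_norm {F : Type} [NormedAddCommGroup F] [InnerProductSpace ℝ F] (f : L2 Ω F) :
    normL2 Ω f = ‖f‖ := by
  rw [normL2, Real.sqrt_eq_iff_eq_sq (integral_nonneg fun x => by positivity) (norm_nonneg _),
    ← real_inner_self_eq_norm_sq, L2.inner_def]
  simp_rw [real_inner_self_eq_norm_sq]

lemma normL2_fn_eq_norm (v : H1Vel Ω lam) : normL2 Ω (fn v) = ‖valMap v‖ := by
  rw [← normL2_eq_norm, normL2, normL2]
  congr 1
  refine integral_congr_ae ?_
  filter_upwards [coeFn_valMap v] with x hx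
  rw [hx]

lemma integral_mul_div (q : L2 Ω ℝ) (v : H1Vel Ω lam) :
    ∫ x in Ω, q x * div v x = inner ℝ q (divMap Ω (gradMap v)) := by
  rw [L2.inner_def]
  refine integral_congr_ae ?_
  filter_upwards [coeFn_divMap v] with x hx
  rw [hx]
  simp [mul_comm]

end Maps

/-! ### Hölder estimates for triple products and interpolation -/

section Products

instance holderTriple_four_four_two : ENNReal.HolderTriple 4 4 2 where
  inv_add_inv_eq_inv := by
    rw [show (4 : ℝ≥0∞) = 2 * 2 by norm_num,
      ENNReal.mul_inv (Or.inl (by norm_num)) (Or.inl (by norm_num)), ← mul_add,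
      ENNReal.inv_two_add_inv_two, mul_one]

variable {α : Type*} [MeasurableSpace α] {μ : Measure α}

lemma integrable_mul_mul {a b c : α → ℝ} (ha : MemLp a 4 μ) (hb : MemLp b 4 μ)
    (hc : MemLp c 2 μ) : Integrable (fun x => a x * b x * c x) μ := by
  have h1 : MemLp (a * b) 2 μ := hb.mul' ha
  exact h1.integrable_mul hc

lemma abs_integral_mul_mul_le {a b c : α → ℝ} (ha : MemLp a 4 μ) (hb : MemLp b 4 μ)
    (hc : MemLp c 2 μ) : |∫ x, a x * b x * c x ∂μ|
      ≤ (eLpNorm a 4 μ).toReal * (eLpNorm b 4 μ).toReal * (eLpNorm c 2 μ).toReal := by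
  have h1 : MemLp (a * b) 2 μ := hb.mul' ha
  have h4 : eLpNorm (a • b) 2 μ ≤ eLpNorm a 4 μ * eLpNorm b 4 μ :=
    eLpNorm_smul_le_mul_eLpNorm hb.1 ha.1
  have h5 : eLpNorm ((a * b) • c) 1 μ ≤ eLpNorm (a * b) 2 μ * eLpNorm c 2 μ :=
    eLpNorm_smul_le_mul_eLpNorm hc.1 h1.1
  rw [smul_eq_mul] at h4 h5
  have h2 : eLpNorm ((a * b) * c) 1 μ ≤ eLpNorm a 4 μ * eLpNorm b 4 μ * eLpNorm c 2 μ :=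
    h5.trans (mul_le_mul_left h4 _)
  have h3 : |∫ x, a x * b x * c x ∂μ| ≤ (eLpNorm ((a * b) * c) 1 μ).toReal := by
    rw [← Real.norm_eq_abs, eLpNorm_one_eq_lintegral_enorm,
      ← integral_norm_eq_lintegral_enorm (f := a * b * c) (integrable_mul_mul ha hb hc).1]
    exact norm_integral_le_integral_norm (a * b * c)
  refine h3.trans ?_
  rw [← ENNReal.toReal_mul, ← ENNReal.toReal_mul]
  exact ENNReal.toReal_mono (ENNReal.mul_ne_top (ENNReal.mul_ne_top ha.2.ne hb.2.ne) hc.2.ne) h2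

lemma tendsto_integral_mul_mul {a b c : ℕ → α → ℝ} {A B C : α → ℝ}
    (ha : ∀ n, AEStronglyMeasurable (a n) μ) (hb : ∀ n, AEStronglyMeasurable (b n) μ)
    (hc : ∀ n, AEStronglyMeasurable (c n) μ)
    (hA : MemLp A 4 μ) (hB : MemLp B 4 μ) (hC : MemLp C 2 μ)
    (haA : Tendsto (fun n => eLpNorm (a n - A) 4 μ) atTop (𝓝 0))
    (hbB : Tendsto (fun n => eLpNorm (b n - B) 4 μ) atTop (𝓝 0))
    (hcC : Tendsto (fun n => eLpNorm (c n - C) 2 μ) atTop (𝓝 0)) :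
    Tendsto (fun n => ∫ x, a n x * b n x * c n x ∂μ) atTop (𝓝 (∫ x, A x * B x * C x ∂μ)) := by
  have h1 : MemLp (A * B) 2 μ := hB.mul' hA
  exact tendsto_integral_mul (f := fun n => a n * b n) (F := A * B)
    (fun n => (ha n).mul (hb n)) hc h1 hC
    (tendsto_eLpNorm_mul_sub (by norm_num) ha hb hA hB haA hbB (by norm_num)) hcC

/-- Interpolation of the `L⁴` norm between `L²` and `L⁶`. -/
lemma eLpNorm_four_pow_le {a : α → ℝ} (ha : AEStronglyMeasurable a μ) :
    eLpNorm a 4 μ ^ 4 ≤ eLpNorm a 2 μ * eLpNorm a 6 μ ^ 3 := by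
  -- The integrand `|a|⁴` is split as `|a| · |a|³` for Cauchy–Schwarz.
  have h4 : eLpNorm a 4 μ ^ 4 = ∫⁻ x, ‖a x‖ₑ * ‖a x‖ₑ ^ 3 ∂μ := by
    rw [eLpNorm_eq_lintegral_rpow_enorm_toReal (by norm_num) (by norm_num), ← ENNReal.rpow_natCast,
      ← ENNReal.rpow_mul]
    norm_num
    exact lintegral_congr fun x => pow_succ' _ _
  have h6 : eLpNorm a 6 μ ^ 3 = (∫⁻ x, (‖a x‖ₑ ^ 3) ^ (2 : ℝ) ∂μ) ^ (1 / 2 : ℝ) := by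
    rw [eLpNorm_eq_lintegral_rpow_enorm_toReal (by norm_num) (by norm_num), ← ENNReal.rpow_natCast,
      ← ENNReal.rpow_mul]
    have : ∀ x, (‖a x‖ₑ ^ 3) ^ (2 : ℝ) = ‖a x‖ₑ ^ (ENNReal.toReal 6) := by
      intro x
      rw [← ENNReal.rpow_natCast, ← ENNReal.rpow_mul]
      norm_num
    simp_rw [this]
    norm_num
  have h2 : eLpNorm a 2 μ = (∫⁻ x, ‖a x‖ₑ ^ (2 : ℝ) ∂μ) ^ (1 / 2 : ℝ) := by
    rw [eLpNorm_eq_lintegral_rpow_enorm_toReal (by norm_num) (by norm_num)]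
    simp
  rw [h4, h6, h2]
  exact ENNReal.lintegral_mul_le_Lp_mul_Lq μ Real.HolderConjugate.two_two ha.enorm
    (ha.enorm.pow_const 3)

end Products

/-! ### The convection form -/

section Trilinear

variable {d : ℕ} {Ω : Set (Sp d)} {lam : ℝ}

/-- The bounded open sets with a positive interaction radius, in dimension two or three. -/
structure IsSetting (Ω : Set (Sp d)) (lam : ℝ) : Prop where
  dim : d = 2 ∨ d = 3
  isOpen : IsOpen Ω
  isBounded : Bornology.IsBounded Ω
  pos : 0 < lam

lemma IsSetting.isCompact (h : IsSetting Ω lam) : IsCompact (Metric.cthickening 1 Ω) :=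
  Metric.isCompact_of_isClosed_isBounded Metric.isClosed_cthickening h.isBounded.cthickening

lemma IsSetting.exists_approx (h : IsSetting Ω lam) {v : H1Vel Ω lam}
    (hv : v ∈ velocitySpace Ω lam) (j : Fin d) :
    ∃ ψ, H1Approx (Metric.cthickening 1 Ω) ψ (extVal v j) (extGrad v j) :=
  exists_h1Approx h.isOpen h.isBounded h.pos hv j

lemma IsSetting.memLp_extVal_four (h : IsSetting Ω lam) {v : H1Vel Ω lam}
    (hv : v ∈ velocitySpace Ω lam) (j : Fin d) : MemLp (extVal v j) 4 volume := by
  obtain ⟨ψ, hψ⟩ := h.exists_approx hv j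
  exact hψ.memLp_of_le h.dim h.isCompact (q := 4) (by norm_num) (by norm_num)

lemma ae_eq_indicator {f g : Sp d → ℝ} (hΩ : IsOpen Ω) (h : f =ᵐ[volume.restrict Ω] g) :
    Ω.indicator f =ᵐ[volume] Ω.indicator g := by
  filter_upwards [(ae_restrict_iff' hΩ.measurableSet).1 h] with x hx
  by_cases hxΩ : x ∈ Ω
  · rw [indicator_of_mem hxΩ, indicator_of_mem hxΩ, hx hxΩ]
  · rw [indicator_of_notMem hxΩ, indicator_of_notMem hxΩ]


lemma eLpNorm_extVal_le (hΩ : IsOpen Ω) (v : H1Vel Ω lam) (j : Fin d) :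
    (eLpNorm (extVal v j) 2 volume).toReal ≤ ‖valMap v‖ := by
  rw [Lp.norm_def]
  refine ENNReal.toReal_mono (Lp.eLpNorm_ne_top _) ?_
  rw [extVal, eLpNorm_indicator_eq_eLpNorm_restrict hΩ.measurableSet,
    eLpNorm_congr_ae (coeFn_valMap v)]
  exact eLpNorm_mono fun x => PiLp.norm_apply_le (fn v x) j

lemma eLpNorm_extGrad_le (hΩ : IsOpen Ω) (v : H1Vel Ω lam) (j i : Fin d) :
    (eLpNorm (extGrad v j i) 2 volume).toReal ≤ ‖gradMap v‖ := by
  refine le_trans ?_ (PiLp.norm_apply_le (gradMap v) i)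
  rw [Lp.norm_def]
  refine ENNReal.toReal_mono (Lp.eLpNorm_ne_top _) ?_
  rw [extGrad, eLpNorm_indicator_eq_eLpNorm_restrict hΩ.measurableSet,
    eLpNorm_congr_ae (coeFn_gradMap v i)]
  exact eLpNorm_mono fun x => PiLp.norm_apply_le (pd i v x) j

lemma extVal_sub (hΩ : IsOpen Ω) (u v : H1Vel Ω lam) (j : Fin d) :
    extVal (u - v) j =ᵐ[volume] extVal u j - extVal v j := by
  have h : fn (u - v) =ᵐ[volume.restrict (extDomain Ω lam)] fn u - fn v :=
    Lp.coeFn_sub (u.1 (idx0 d 1)) (v.1 (idx0 d 1))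
  have h2 := ae_mono (Measure.restrict_mono (subset_extDomain Ω lam) le_rfl) h
  have h3 : (fun x => fn (u - v) x j) =ᵐ[volume.restrict Ω] fun x => fn u x j - fn v x j := by
    filter_upwards [h2] with x hx
    rw [hx]
    rfl
  refine (ae_eq_indicator hΩ h3).trans (EventuallyEq.of_eq ?_)
  exact indicator_sub Ω _ _

lemma extGrad_sub (hΩ : IsOpen Ω) (u v : H1Vel Ω lam) (j i : Fin d) :
    extGrad (u - v) j i =ᵐ[volume] extGrad u j i - extGrad v j i := by
  have h : pd i (u - v) =ᵐ[volume.restrict (extDomain Ω lam)] pd i u - pd i v :=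
    Lp.coeFn_sub (u.1 (idx1 i)) (v.1 (idx1 i))
  have h2 := ae_mono (Measure.restrict_mono (subset_extDomain Ω lam) le_rfl) h
  have h3 : (fun x => pd i (u - v) x j) =ᵐ[volume.restrict Ω]
      fun x => pd i u x j - pd i v x j := by
    filter_upwards [h2] with x hx
    rw [hx]
    rfl
  refine (ae_eq_indicator hΩ h3).trans (EventuallyEq.of_eq ?_)
  exact indicator_sub Ω _ _

variable {u v w : H1Vel Ω lam}

lemma IsSetting.integrable_triple (h : IsSetting Ω lam) (hu : u ∈ velocitySpace Ω lam)
    (hw : w ∈ velocitySpace Ω lam) (v : H1Vel Ω lam) (j i : Fin d) :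
    Integrable fun x => extVal u i x * extVal w j x * extGrad v j i x :=
  integrable_mul_mul (h.memLp_extVal_four hu i) (h.memLp_extVal_four hw j)
    (memLp_extGrad h.isOpen v j i)

/-- The convection form in coordinates. -/
lemma IsSetting.convForm_eq (h : IsSetting Ω lam) (hu : u ∈ velocitySpace Ω lam)
    (hw : w ∈ velocitySpace Ω lam) (v : H1Vel Ω lam) :
    convForm u v w = ∑ j, ∑ i, ∫ x, extVal u i x * extVal w j x * extGrad v j i x := by
  have h1 : ∀ j, ∑ i, ∫ x, extVal u i x * extVal w j x * extGrad v j i x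
      = ∫ x, ∑ i, extVal u i x * extVal w j x * extGrad v j i x := fun j =>
    (integral_finsetSum _ fun i _ => h.integrable_triple hu hw v j i).symm
  simp_rw [h1]
  rw [← integral_finsetSum _ fun j _ => integrable_finsetSum _ fun i _ =>
    h.integrable_triple hu hw v j i, convForm, ← integral_indicator h.isOpen.measurableSet]
  congr 1
  funext x
  by_cases hx : x ∈ Ω
  · simp only [extVal, extGrad, indicator_of_mem hx]
    rw [PiLp.inner_apply]
    refine Finset.sum_congr rfl fun j _ => ?_
    simp only [WithLp.ofLp_sum, Finset.sum_apply, PiLp.smul_apply, smul_eq_mul]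
    rw [real_inner_comm]
    simp only [RCLike.inner_apply, conj_trivial, Finset.sum_mul]
    exact Finset.sum_congr rfl fun i _ => by ring
  · simp [extVal, extGrad, indicator_of_notMem hx]

lemma IsSetting.convForm_sub_left (h : IsSetting Ω lam) {u' : H1Vel Ω lam}
    (hu : u ∈ velocitySpace Ω lam) (hu' : u' ∈ velocitySpace Ω lam)
    (hw : w ∈ velocitySpace Ω lam) (v : H1Vel Ω lam) :
    convForm (u - u') v w = convForm u v w - convForm u' v w := by
  rw [h.convForm_eq hu hw, h.convForm_eq hu' hw,
    h.convForm_eq (Submodule.sub_mem _ hu hu') hw, ← Finset.sum_sub_distrib]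
  refine Finset.sum_congr rfl fun j _ => ?_
  rw [← Finset.sum_sub_distrib]
  refine Finset.sum_congr rfl fun i _ => ?_
  rw [← integral_sub (h.integrable_triple hu hw v j i) (h.integrable_triple hu' hw v j i)]
  refine integral_congr_ae ?_
  filter_upwards [extVal_sub h.isOpen u u' i] with x hx
  rw [hx, Pi.sub_apply]
  ring

lemma IsSetting.convForm_sub_mid (h : IsSetting Ω lam) (hu : u ∈ velocitySpace Ω lam)
    (hw : w ∈ velocitySpace Ω lam) (v v' : H1Vel Ω lam) :
    convForm u (v - v') w = convForm u v w - convForm u v' w := by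
  rw [h.convForm_eq hu hw, h.convForm_eq hu hw, h.convForm_eq hu hw, ← Finset.sum_sub_distrib]
  refine Finset.sum_congr rfl fun j _ => ?_
  rw [← Finset.sum_sub_distrib]
  refine Finset.sum_congr rfl fun i _ => ?_
  rw [← integral_sub (h.integrable_triple hu hw v j i) (h.integrable_triple hu hw v' j i)]
  refine integral_congr_ae ?_
  filter_upwards [extGrad_sub h.isOpen v v' j i] with x hx
  rw [hx, Pi.sub_apply]
  ring

lemma IsSetting.convForm_sub_right (h : IsSetting Ω lam) {w' : H1Vel Ω lam}
    (hu : u ∈ velocitySpace Ω lam) (hw : w ∈ velocitySpace Ω lam)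
    (hw' : w' ∈ velocitySpace Ω lam) (v : H1Vel Ω lam) :
    convForm u v (w - w') = convForm u v w - convForm u v w' := by
  rw [h.convForm_eq hu hw, h.convForm_eq hu hw',
    h.convForm_eq hu (Submodule.sub_mem _ hw hw'), ← Finset.sum_sub_distrib]
  refine Finset.sum_congr rfl fun j _ => ?_
  rw [← Finset.sum_sub_distrib]
  refine Finset.sum_congr rfl fun i _ => ?_
  rw [← integral_sub (h.integrable_triple hu hw v j i) (h.integrable_triple hu hw' v j i)]
  refine integral_congr_ae ?_
  filter_upwards [extVal_sub h.isOpen w w' j] with x hx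
  rw [hx, Pi.sub_apply]
  ring

/-- The sum of the `L⁴` norms of the components. -/
noncomputable def normL4 (v : H1Vel Ω lam) : ℝ := ∑ j, (eLpNorm (extVal v j) 4 volume).toReal

lemma normL4_nonneg (v : H1Vel Ω lam) : 0 ≤ normL4 v :=
  Finset.sum_nonneg fun _ _ => ENNReal.toReal_nonneg

lemma IsSetting.abs_convForm_le (h : IsSetting Ω lam) (hu : u ∈ velocitySpace Ω lam)
    (hw : w ∈ velocitySpace Ω lam) (v : H1Vel Ω lam) :
    |convForm u v w| ≤ normL4 u * ‖gradMap v‖ * normL4 w := by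
  rw [h.convForm_eq hu hw]
  have h1 : normL4 u * ‖gradMap v‖ * normL4 w
      = ∑ j, ∑ i, (eLpNorm (extVal u i) 4 volume).toReal * (eLpNorm (extVal w j) 4 volume).toReal
        * ‖gradMap v‖ := by
    rw [mul_right_comm, normL4, normL4, Finset.sum_mul_sum, Finset.sum_comm, Finset.sum_mul]
    exact Finset.sum_congr rfl fun j _ => by rw [Finset.sum_mul]
  rw [h1]
  refine (Finset.abs_sum_le_sum_abs _ _).trans (Finset.sum_le_sum fun j _ => ?_)
  refine (Finset.abs_sum_le_sum_abs _ _).trans (Finset.sum_le_sum fun i _ => ?_)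
  refine (abs_integral_mul_mul_le (h.memLp_extVal_four hu i) (h.memLp_extVal_four hw j)
    (memLp_extGrad h.isOpen v j i)).trans ?_
  gcongr
  exact eLpNorm_extGrad_le h.isOpen v j i

/-- Used for three exponents: `2` gives the Poincaré inequality, `4` the boundedness of the
convection form, and `6` the endpoint of the interpolation. -/
lemma IsSetting.exists_extVal_le (h : IsSetting Ω lam) {q : ℝ≥0} (hq0 : 0 < q) (hq : q ≤ 6) :
    ∃ C : ℝ, 0 ≤ C ∧ ∀ v ∈ velocitySpace Ω lam, ∀ j,
      (eLpNorm (extVal v j) q volume).toReal ≤ C * ‖gradMap v‖ := by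
  obtain ⟨C, hC⟩ := exists_sobolev h.dim h.isCompact hq0 hq
  refine ⟨C * d, by positivity, fun v hv j => ?_⟩
  obtain ⟨ψ, hψ⟩ := h.exists_approx hv j
  have hfin : ∀ i, eLpNorm (extGrad v j i) 2 volume ≠ ⊤ := fun i =>
    (memLp_extGrad h.isOpen v j i).2.ne
  have h1 := ENNReal.toReal_mono (ENNReal.mul_ne_top ENNReal.coe_ne_top
    (ENNReal.sum_ne_top.2 fun i _ => hfin i)) (hC _ _ _ hψ)
  rw [ENNReal.toReal_mul, ENNReal.toReal_sum fun i _ => hfin i, ENNReal.coe_toReal] at h1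
  refine h1.trans ?_
  rw [mul_assoc]
  gcongr
  refine (Finset.sum_le_sum fun i _ => eLpNorm_extGrad_le h.isOpen v j i).trans ?_
  simp

lemma IsSetting.exists_normL4_le (h : IsSetting Ω lam) :
    ∃ C : ℝ, 0 ≤ C ∧ ∀ v ∈ velocitySpace Ω lam, normL4 v ≤ C * ‖gradMap v‖ := by
  obtain ⟨C, hC0, hC⟩ := h.exists_extVal_le (q := 4) (by norm_num) (by norm_num)
  refine ⟨d * C, by positivity, fun v hv => ?_⟩
  refine (Finset.sum_le_sum fun j _ => hC v hv j).trans_eq ?_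
  simp [mul_assoc]

/-- The Poincaré inequality. -/
lemma IsSetting.exists_poincare (h : IsSetting Ω lam) :
    ∃ C : ℝ, 0 ≤ C ∧ ∀ v ∈ velocitySpace Ω lam, ‖valMap v‖ ≤ C * ‖gradMap v‖ := by
  obtain ⟨C, hC0, hC⟩ := h.exists_extVal_le (q := 2) (by norm_num) (by norm_num)
  refine ⟨d * C, by positivity, fun v hv => ?_⟩
  have h1 : ‖valMap v‖ ≤ ∑ j, (eLpNorm (extVal v j) 2 volume).toReal := by
    have hfin : ∀ j, eLpNorm (extVal v j) 2 volume ≠ ⊤ := fun j =>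
      (memLp_extVal h.isOpen v j).2.ne
    rw [Lp.norm_def, ← ENNReal.toReal_sum fun j _ => hfin j]
    refine ENNReal.toReal_mono (ENNReal.sum_ne_top.2 fun j _ => hfin j) ?_
    rw [eLpNorm_congr_ae (coeFn_valMap v)]
    simp_rw [extVal, eLpNorm_indicator_eq_eLpNorm_restrict h.isOpen.measurableSet]
    have h2 : eLpNorm (fn v) 2 (volume.restrict Ω)
        ≤ eLpNorm (∑ j, fun x => |fn v x j|) 2 (volume.restrict Ω) := by
      refine eLpNorm_mono_real fun x => ?_
      rw [Finset.sum_apply, EuclideanSpace.norm_eq]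
      refine Real.sqrt_le_iff.2 ⟨by positivity, ?_⟩
      exact Finset.sum_sq_le_sq_sum_of_nonneg fun i _ => abs_nonneg _
    refine h2.trans ((eLpNorm_sum_le (fun j _ => ?_) (by norm_num)).trans_eq ?_)
    · exact ((memLp_coord ((memLp_fn v).mono_measure
        (Measure.restrict_mono (subset_extDomain Ω lam) le_rfl)) j).abs).1
    · exact Finset.sum_congr rfl fun j _ => eLpNorm_norm fun x => fn v x j
  refine h1.trans ((Finset.sum_le_sum fun j _ => hC v hv j).trans_eq ?_)
  simp [mul_assoc]

/-- The `L⁴` norm is controlled by a small multiple of the gradient norm. -/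
lemma IsSetting.exists_normL4_le_add (h : IsSetting Ω lam) {δ : ℝ} (hδ : 0 < δ) :
    ∃ K : ℝ, 0 ≤ K ∧ ∀ v ∈ velocitySpace Ω lam, normL4 v ≤ δ * ‖gradMap v‖ + K * ‖valMap v‖ := by
  obtain ⟨C, hC0, hC⟩ := h.exists_extVal_le (q := 6) (by norm_num) le_rfl
  have hd : (0 : ℝ) < d := by
    rcases h.dim with hd | hd <;> simp [hd]
  -- Each of the `d` components summed in `normL4` receives the share `δ / d`.
  obtain ⟨ε, hε, hεδ⟩ : ∃ ε > 0, d * ε = δ := ⟨δ / d, by positivity, by field_simp⟩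
  refine ⟨d * (C ^ 3 / (4 * ε ^ 3)), by positivity, fun v hv => ?_⟩
  have key : ∀ j, (eLpNorm (extVal v j) 4 volume).toReal
      ≤ ε * ‖gradMap v‖ + C ^ 3 / (4 * ε ^ 3) * ‖valMap v‖ := by
    intro j
    have h6 : eLpNorm (extVal v j) 6 volume ≠ ⊤ := by
      obtain ⟨ψ, hψ⟩ := h.exists_approx hv j
      exact (hψ.memLp_of_le h.dim h.isCompact (q := 6) (by norm_num) le_rfl).2.ne
    have h1 := ENNReal.toReal_mono (ENNReal.mul_ne_top (memLp_extVal h.isOpen v j).2.ne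
      (ENNReal.pow_ne_top h6)) (eLpNorm_four_pow_le (memLp_extVal h.isOpen v j).1)
    rw [ENNReal.toReal_mul, ENNReal.toReal_pow, ENNReal.toReal_pow] at h1
    have h2 := eLpNorm_extVal_le h.isOpen v j
    have h3 : (eLpNorm (extVal v j) 6 volume).toReal ≤ C * ‖gradMap v‖ := hC v hv j
    have h4 : (eLpNorm (extVal v j) 4 volume).toReal ^ 4 ≤ ‖valMap v‖ * (C * ‖gradMap v‖) ^ 3 :=
      h1.trans (by gcongr)
    set G := ‖gradMap v‖
    set y := ‖valMap v‖
    have hG : 0 ≤ G := norm_nonneg _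
    have hy : 0 ≤ y := norm_nonneg _
    refine le_of_pow_le_pow_left₀ (n := 4) (by norm_num) (by positivity) (h4.trans ?_)
    have h5 : 0 ≤ C ^ 3 / (4 * ε ^ 3) := by positivity
    -- Young's inequality in the form `4 a³ b ≤ (a + b)⁴`: the constant `C ^ 3 / (4 * ε ^ 3)` is
    -- chosen so that the interpolation bound is exactly `4 a³ b` with `a = ε G`.
    have h6 : y * (C * G) ^ 3 = 4 * (ε * G) ^ 3 * (C ^ 3 / (4 * ε ^ 3) * y) := by
      field_simp
    rw [h6]
    have ha : 0 ≤ ε * G := by positivity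
    have hb : 0 ≤ C ^ 3 / (4 * ε ^ 3) * y := by positivity
    generalize ε * G = a at *
    generalize C ^ 3 / (4 * ε ^ 3) * y = b at *
    have : (a + b) ^ 4 - 4 * a ^ 3 * b = a ^ 4 + 6 * a ^ 2 * b ^ 2 + 4 * a * b ^ 3 + b ^ 4 := by ring
    have h7 : 0 ≤ a ^ 4 + 6 * a ^ 2 * b ^ 2 + 4 * a * b ^ 3 + b ^ 4 := by positivity
    linarith
  refine (Finset.sum_le_sum fun j _ => key j).trans_eq ?_
  rw [Finset.sum_const, Finset.card_univ, Fintype.card_fin, nsmul_eq_mul, ← hεδ]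
  ring

/-- The three terms are the Leibniz expansion of a derivative of `a b c`, which has integral zero.
-/
lemma integral_product_rule {a b c : Sp d → ℝ} (ha : ContDiff ℝ ∞ a) (hb : ContDiff ℝ ∞ b)
    (hc : ContDiff ℝ ∞ c) (hac : HasCompactSupport a) (hbc : HasCompactSupport b) (i : Fin d) :
    (∫ x, a x * c x * dirDeriv i b x) + (∫ x, a x * b x * dirDeriv i c x)
      + ∫ x, b x * c x * dirDeriv i a x = 0 := by
  have h1 := integral_mul_dirDeriv (φ := fun x => a x * b x) ((ha.mul hb).of_le (by simp))
    hac.mul_right (hc.of_le (by simp)) i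
  have h2 : ∀ x, dirDeriv i (fun x => a x * b x) x * c x
      = a x * c x * dirDeriv i b x + b x * c x * dirDeriv i a x := by
    intro x
    have hf := (((ha.differentiable (by simp) x).hasFDerivAt).mul
      ((hb.differentiable (by simp) x).hasFDerivAt)).fderiv
    have hf' : dirDeriv i (fun x => a x * b x) x = a x * dirDeriv i b x + b x * dirDeriv i a x := by
      have : (fun x => a x * b x) = a * b := rfl
      simp only [dirDeriv, this, hf]
      simp
    rw [hf']
    ring
  simp_rw [h2] at h1
  rw [integral_add] at h1
  · linarith
  · exact ((ha.continuous.mul hc.continuous).mul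
      (continuous_dirDeriv hb i)).integrable_of_hasCompactSupport hac.mul_right.mul_right
  · exact ((hb.continuous.mul hc.continuous).mul
      (continuous_dirDeriv ha i)).integrable_of_hasCompactSupport hbc.mul_right.mul_right

/-- By density from the smooth case: the two undifferentiated factors converge in `L⁴` and the
gradients in `L²`, so each triple integral converges. -/
lemma IsSetting.integral_product_rule (h : IsSetting Ω lam) (hu : u ∈ velocitySpace Ω lam)
    (hv : v ∈ velocitySpace Ω lam) (hw : w ∈ velocitySpace Ω lam) (i j k l : Fin d) :
    (∫ x, extVal u j x * extVal w l x * extGrad v k i x)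
      + (∫ x, extVal u j x * extVal v k x * extGrad w l i x)
      + ∫ x, extVal v k x * extVal w l x * extGrad u j i x = 0 := by
  obtain ⟨ψu, hψu⟩ := h.exists_approx hu j
  obtain ⟨ψv, hψv⟩ := h.exists_approx hv k
  obtain ⟨ψw, hψw⟩ := h.exists_approx hw l
  have hS := h.isCompact
  have t : ∀ {ψ v g}, H1Approx (Metric.cthickening 1 Ω) ψ v g →
      Tendsto (fun n => eLpNorm (ψ n - v) 4 volume) atTop (𝓝 0) := fun H =>
    H.tendsto_of_le h.dim hS (q := 4) (by norm_num) (by norm_num)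
  have l1 := tendsto_integral_mul_mul hψu.aestronglyMeasurable hψw.aestronglyMeasurable
    (hψv.aestronglyMeasurable_grad i) (h.memLp_extVal_four hu j) (h.memLp_extVal_four hw l)
    (hψv.memLp_grad i) (t hψu) (t hψw) (hψv.tendsto_grad i)
  have l2 := tendsto_integral_mul_mul hψu.aestronglyMeasurable hψv.aestronglyMeasurable
    (hψw.aestronglyMeasurable_grad i) (h.memLp_extVal_four hu j) (h.memLp_extVal_four hv k)
    (hψw.memLp_grad i) (t hψu) (t hψv) (hψw.tendsto_grad i)
  have l3 := tendsto_integral_mul_mul hψv.aestronglyMeasurable hψw.aestronglyMeasurable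
    (hψu.aestronglyMeasurable_grad i) (h.memLp_extVal_four hv k) (h.memLp_extVal_four hw l)
    (hψu.memLp_grad i) (t hψv) (t hψw) (hψu.tendsto_grad i)
  refine tendsto_nhds_unique ((l1.add l2).add l3) (tendsto_const_nhds.congr fun n => ?_)
  exact (FracNSE.integral_product_rule (hψu.smooth n) (hψv.smooth n) (hψw.smooth n)
    (hψu.hasCompactSupport hS n) (hψv.hasCompactSupport hS n) i).symm

/-- The convection form is skew-symmetric for divergence-free transport fields. -/
lemma IsSetting.convForm_skew (h : IsSetting Ω lam) (hu : u ∈ velocitySpace Ω lam)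
    (hv : v ∈ velocitySpace Ω lam) (hw : w ∈ velocitySpace Ω lam)
    (hdiv : div u =ᵐ[volume.restrict Ω] 0) : convForm u v w = - convForm u w v := by
  have hdiv' : ∀ᵐ x, ∑ i, extGrad u i i x = 0 := by
    filter_upwards [(ae_restrict_iff' h.isOpen.measurableSet).1 hdiv] with x hx
    by_cases hxΩ : x ∈ Ω
    · simpa [extGrad, indicator_of_mem hxΩ, div] using hx hxΩ
    · simp [extGrad, indicator_of_notMem hxΩ]
  -- The terms in which the transport field is differentiated add up to the integral of `v j * w j`
  -- times the divergence of `u`.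
  have h3 : ∀ j, ∑ i, ∫ x, extVal v j x * extVal w j x * extGrad u i i x = 0 := by
    intro j
    rw [← integral_finsetSum _ fun i _ => integrable_mul_mul (h.memLp_extVal_four hv j)
      (h.memLp_extVal_four hw j) (memLp_extGrad h.isOpen u i i)]
    refine integral_eq_zero_of_ae ?_
    filter_upwards [hdiv'] with x hx
    rw [← Finset.mul_sum, hx, mul_zero]
    rfl
  have h4 : ∑ j, ∑ i, ((∫ x, extVal u i x * extVal w j x * extGrad v j i x)
      + (∫ x, extVal u i x * extVal v j x * extGrad w j i x)
      + ∫ x, extVal v j x * extVal w j x * extGrad u i i x) = 0 :=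
    Finset.sum_eq_zero fun j _ => Finset.sum_eq_zero fun i _ =>
      h.integral_product_rule hu hv hw i i j j
  simp_rw [Finset.sum_add_distrib, h3] at h4
  rw [h.convForm_eq hu hw, h.convForm_eq hu hv]
  simp only [Finset.sum_const_zero, add_zero] at h4
  linarith

end Trilinear

/-! ### The translation estimate -/

section Translation

variable {d : ℕ}

/-- Translates of a smooth function differ in `L²` by at most the length of the translation times
the norm of the gradient. -/
lemma eLpNorm_sub_translate_le_smooth {ψ : Sp d → ℝ} (hψ : ContDiff ℝ ∞ ψ) (z : Sp d) :
    eLpNorm (fun x => ψ x - ψ (x - z)) 2 volume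
      ≤ ‖z‖ₑ * ∑ i, eLpNorm (dirDeriv i ψ) 2 volume := by
  have hdψ : Continuous (fderiv ℝ ψ) := hψ.continuous_fderiv (by simp)
  let I : Measure ℝ := volume.restrict (Ioc 0 1)
  have hI : IsProbabilityMeasure I := ⟨by simp [I]⟩
  have hmeas : Continuous fun p : Sp d × ℝ => ‖fderiv ℝ ψ (p.1 - z + p.2 • z)‖ₑ := by
    fun_prop
  -- The fundamental theorem of calculus on the segment from `x - z` to `x`, followed by
  -- Cauchy–Schwarz on the unit interval. Integrating in `x` first then removes the shift.
  have key : ∀ x, ‖ψ x - ψ (x - z)‖ₑ ^ (2 : ℝ)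
      ≤ ‖z‖ₑ ^ (2 : ℝ) * ∫⁻ t, ‖fderiv ℝ ψ (x - z + t • z)‖ₑ ^ (2 : ℝ) ∂I := by
    intro x
    have hder : ∀ t : ℝ, HasDerivAt (fun t : ℝ => ψ (x - z + t • z))
        (fderiv ℝ ψ (x - z + t • z) z) t := by
      intro t
      have h1 : HasDerivAt (fun t : ℝ => x - z + t • z) z t := by
        simpa using ((hasDerivAt_id t).smul_const z).const_add (x - z)
      exact (hψ.differentiable (by simp) _).hasFDerivAt.comp_hasDerivAt t h1
    have hcont : Continuous fun t : ℝ => fderiv ℝ ψ (x - z + t • z) z := by fun_prop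
    have hftc : ψ x - ψ (x - z) = ∫ t, fderiv ℝ ψ (x - z + t • z) z ∂I := by
      have := intervalIntegral.integral_eq_sub_of_hasDerivAt (a := 0) (b := 1)
        (fun t _ => hder t) (hcont.intervalIntegrable 0 1)
      rw [intervalIntegral.integral_of_le zero_le_one] at this
      rw [this]
      simp
    have h1 : ‖ψ x - ψ (x - z)‖ₑ ≤ ‖z‖ₑ * eLpNorm (fun t => fderiv ℝ ψ (x - z + t • z)) 1 I := by
      rw [hftc, eLpNorm_one_eq_lintegral_enorm, ← lintegral_const_mul _ (by fun_prop)]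
      refine (enorm_integral_le_lintegral_enorm _).trans (lintegral_mono fun t => ?_)
      rw [mul_comm]
      exact ContinuousLinearMap.le_opENorm _ _
    have h2 : eLpNorm (fun t => fderiv ℝ ψ (x - z + t • z)) 1 I
        ≤ eLpNorm (fun t => fderiv ℝ ψ (x - z + t • z)) 2 I :=
      eLpNorm_le_eLpNorm_of_exponent_le (by norm_num) (by fun_prop)
    have h3 : eLpNorm (fun t => fderiv ℝ ψ (x - z + t • z)) 2 I ^ (2 : ℝ)
        = ∫⁻ t, ‖fderiv ℝ ψ (x - z + t • z)‖ₑ ^ (2 : ℝ) ∂I := by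
      rw [eLpNorm_eq_lintegral_rpow_enorm_toReal (by norm_num) (by norm_num), ← ENNReal.rpow_mul]
      simp
    rw [← h3, ← ENNReal.mul_rpow_of_nonneg _ _ (by norm_num)]
    exact ENNReal.rpow_le_rpow (h1.trans (by gcongr)) (by norm_num)
  have h2 : eLpNorm (fun x => ψ x - ψ (x - z)) 2 volume ≤ ‖z‖ₑ * eLpNorm (fderiv ℝ ψ) 2 volume := by
    rw [eLpNorm_eq_lintegral_rpow_enorm_toReal (by norm_num) (by norm_num),
      eLpNorm_eq_lintegral_rpow_enorm_toReal (by norm_num) (by norm_num)]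
    simp only [ENNReal.toReal_ofNat]
    have h3 : ‖z‖ₑ = (‖z‖ₑ ^ (2 : ℝ)) ^ (1 / (2 : ℝ)) := by
      rw [← ENNReal.rpow_mul]; norm_num
    rw [h3, ← ENNReal.mul_rpow_of_nonneg _ _ (by norm_num)]
    refine ENNReal.rpow_le_rpow ?_ (by norm_num)
    calc ∫⁻ x, ‖ψ x - ψ (x - z)‖ₑ ^ (2 : ℝ)
        ≤ ∫⁻ x, ‖z‖ₑ ^ (2 : ℝ) * ∫⁻ t, ‖fderiv ℝ ψ (x - z + t • z)‖ₑ ^ (2 : ℝ) ∂I :=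
          lintegral_mono key
      _ = ‖z‖ₑ ^ (2 : ℝ) * ∫⁻ x, ∫⁻ t, ‖fderiv ℝ ψ (x - z + t • z)‖ₑ ^ (2 : ℝ) ∂I := by
          refine lintegral_const_mul' _ _ ?_
          exact ENNReal.rpow_ne_top_of_nonneg (by norm_num) enorm_ne_top
      _ = ‖z‖ₑ ^ (2 : ℝ) * ∫⁻ t, (∫⁻ x, ‖fderiv ℝ ψ (x - z + t • z)‖ₑ ^ (2 : ℝ)) ∂I := by
          congr 1
          refine lintegral_lintegral_swap ?_
          exact (hmeas.measurable.pow_const _).aemeasurable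
      _ = ‖z‖ₑ ^ (2 : ℝ) * ∫⁻ _t : ℝ, (∫⁻ x, ‖fderiv ℝ ψ x‖ₑ ^ (2 : ℝ)) ∂I := by
          congr 1
          refine lintegral_congr fun t => ?_
          simp_rw [sub_add]
          exact lintegral_sub_right_eq_self (fun x : Sp d => ‖fderiv ℝ ψ x‖ₑ ^ (2 : ℝ)) (z - t • z)
      _ = _ := by simp
  refine h2.trans ?_
  gcongr
  exact eLpNorm_fderiv_le hψ

variable {S : Set (Sp d)} {ψ : ℕ → Sp d → ℝ} {v : Sp d → ℝ} {g : Fin d → Sp d → ℝ}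

lemma H1Approx.eLpNorm_sub_translate_le (h : H1Approx S ψ v g) (z : Sp d) :
    eLpNorm (fun x => v x - v (x - z)) 2 volume ≤ ‖z‖ₑ * ∑ i, eLpNorm (g i) 2 volume := by
  obtain ⟨ns, hns, hae⟩ := h.exists_seq_ae
  have hae2 : ∀ᵐ x, Tendsto (fun n => ψ (ns n) (x - z)) atTop (𝓝 (v (x - z))) :=
    (measurePreserving_sub_right volume z).quasiMeasurePreserving.ae hae
  have hcont : ∀ n, Continuous fun x => ψ (ns n) x - ψ (ns n) (x - z) := fun n => by
    have := (h.smooth (ns n)).continuous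
    fun_prop
  refine (Lp.eLpNorm_lim_le_liminf_eLpNorm (f := fun n x => ψ (ns n) x - ψ (ns n) (x - z))
    (fun n => (hcont n).aestronglyMeasurable) _ ?_).trans ?_
  · filter_upwards [hae, hae2] with x h1 h2
    exact h1.sub h2
  have h1 : Tendsto (fun n => ‖z‖ₑ * ∑ i, eLpNorm (dirDeriv i (ψ (ns n))) 2 volume) atTop
      (𝓝 (‖z‖ₑ * ∑ i, eLpNorm (g i) 2 volume)) := by
    refine ENNReal.Tendsto.const_mul (tendsto_finsetSum _ fun i _ => ?_) (Or.inr enorm_ne_top)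
    exact (tendsto_eLpNorm_of_sub (by norm_num) (h.aestronglyMeasurable_grad i) (h.memLp_grad i)
      (h.tendsto_grad i)).comp hns.tendsto_atTop
  rw [← h1.liminf_eq]
  exact liminf_le_liminf (Eventually.of_forall fun n =>
    eLpNorm_sub_translate_le_smooth (h.smooth (ns n)) z)

end Translation

/-! ### The truncated kernel and the fractional seminorm -/

section Kernel

variable {d : ℕ}

/-- The truncated kernel of the fractional Laplacian. -/
noncomputable def kern (lam α : ℝ) (z : Sp d) : ℝ :=
  (Metric.closedBall (0 : Sp d) lam).indicator (fun z => 1 / ‖z‖ ^ ((d : ℝ) + 2 * α)) z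

lemma kern_nonneg (lam α : ℝ) (z : Sp d) : 0 ≤ kern lam α z :=
  indicator_nonneg (fun _ _ => by positivity) z

lemma measurable_kern (lam α : ℝ) : Measurable (kern lam α : Sp d → ℝ) :=
  Measurable.indicator (by fun_prop) Metric.isClosed_closedBall.measurableSet

/-- In polar coordinates the radial density is `r^(d-1) · r² · r^(-d-2α) = r^(1-2α)`, integrable at
zero because `α < 1`; truncation handles infinity. -/
lemma integrable_sq_mul_kern (hd : 0 < d) {lam α : ℝ} (hlam : 0 < lam) (hα : α < 1) :
    Integrable (fun z : Sp d => ‖z‖ ^ 2 * kern lam α z) volume := by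
  have : Nonempty (Fin d) := ⟨⟨0, hd⟩⟩
  have : Nontrivial (Sp d) := inferInstance
  let f : ℝ → ℝ := (Iic lam).indicator fun r => r ^ 2 * (1 / r ^ ((d : ℝ) + 2 * α))
  have h1 : (fun z : Sp d => ‖z‖ ^ 2 * kern lam α z) = fun z => f ‖z‖ := by
    funext z
    by_cases hz : ‖z‖ ≤ lam
    · have hz' : z ∈ Metric.closedBall (0 : Sp d) lam := by simpa using hz
      simp only [kern, f]
      rw [indicator_of_mem hz', indicator_of_mem (show ‖z‖ ∈ Iic lam from hz)]
    · have hz' : z ∉ Metric.closedBall (0 : Sp d) lam := by simpa using hz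
      simp only [kern, f]
      rw [indicator_of_notMem hz', indicator_of_notMem (show ‖z‖ ∉ Iic lam from hz), mul_zero]
  rw [h1, integrable_fun_norm_addHaar]
  have h2 : IntegrableOn (fun r : ℝ => r ^ (1 - 2 * α)) (Ioc 0 lam) volume := by
    have := intervalIntegral.intervalIntegrable_rpow' (a := 0) (b := lam) (r := 1 - 2 * α)
      (by linarith)
    rwa [intervalIntegrable_iff_integrableOn_Ioc_of_le hlam.le] at this
  have h3 : IntegrableOn (indicator (Ioc 0 lam) fun r : ℝ => r ^ (1 - 2 * α)) (Ioi 0) volume :=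
    (h2.integrable_indicator measurableSet_Ioc).integrableOn
  refine h3.congr_fun (fun r hr => ?_) measurableSet_Ioi
  have hr0 : (0 : ℝ) < r := hr
  have hfr : Module.finrank ℝ (Sp d) = d := by simp
  rw [hfr]
  by_cases hrl : r ≤ lam
  · simp only [f]
    rw [indicator_of_mem (show r ∈ Ioc 0 lam from ⟨hr0, hrl⟩),
      indicator_of_mem (show r ∈ Iic lam from hrl), smul_eq_mul, ← Real.rpow_natCast,
      ← Real.rpow_natCast, one_div, ← Real.rpow_neg hr0.le, ← Real.rpow_add hr0,
      ← Real.rpow_add hr0]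
    congr 1
    have : ((d - 1 : ℕ) : ℝ) = (d : ℝ) - 1 := by
      rw [Nat.cast_sub hd]; simp
    rw [this]
    push_cast
    ring
  · simp only [f]
    rw [indicator_of_notMem (fun h => hrl h.2), indicator_of_notMem (show r ∉ Iic lam from hrl),
      smul_zero]

/-- The weighted difference quotient, as a function on the product space. -/
noncomputable def diffQuot (lam α : ℝ) (v : Sp d → ℝ) (p : Sp d × Sp d) : ℝ :=
  (v p.1 - v p.2) * √(kern lam α (p.1 - p.2))

lemma aestronglyMeasurable_diffQuot (lam α : ℝ) {v : Sp d → ℝ}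
    (hv : AEStronglyMeasurable v volume) :
    AEStronglyMeasurable (diffQuot lam α v) (volume.prod volume) := by
  refine (hv.comp_fst.sub hv.comp_snd).mul ?_
  have h : Measurable fun p : Sp d × Sp d => √(kern lam α (p.1 - p.2)) :=
    Real.continuous_sqrt.measurable.comp
      ((measurable_kern lam α).comp (measurable_fst.sub measurable_snd))
  exact h.aestronglyMeasurable

variable {S : Set (Sp d)} {ψ : ℕ → Sp d → ℝ} {v : Sp d → ℝ} {g : Fin d → Sp d → ℝ}

/-- The fractional seminorm is controlled by the norm of the gradient. -/
lemma H1Approx.lintegral_diffQuot_le (h : H1Approx S ψ v g) (lam α : ℝ) :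
    ∫⁻ p, ‖diffQuot lam α v p‖ₑ ^ (2 : ℝ) ∂(volume.prod volume)
      ≤ (∫⁻ z : Sp d, ENNReal.ofReal (‖z‖ ^ 2 * kern lam α z))
        * (∑ i, eLpNorm (g i) 2 volume) ^ (2 : ℝ) := by
  have hm := aestronglyMeasurable_diffQuot lam α h.memLp.1
  have hk : ∀ p : Sp d × Sp d, ‖diffQuot lam α v p‖ₑ ^ (2 : ℝ)
      = ‖v p.1 - v p.2‖ₑ ^ (2 : ℝ) * ENNReal.ofReal (kern lam α (p.1 - p.2)) := by
    intro p
    rw [diffQuot, enorm_mul, ENNReal.mul_rpow_of_nonneg _ _ (by norm_num)]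
    congr 1
    rw [Real.enorm_of_nonneg (Real.sqrt_nonneg _), ENNReal.ofReal_rpow_of_nonneg
      (Real.sqrt_nonneg _) (by norm_num), Real.rpow_two, Real.sq_sqrt (kern_nonneg _ _ _)]
  have hvm : AEMeasurable (fun q : Sp d × Sp d => ‖v q.1 - v (q.1 - q.2)‖ₑ ^ (2 : ℝ)
      * ENNReal.ofReal (kern lam α q.2)) (volume.prod volume) := by
    refine AEMeasurable.mul (AEMeasurable.pow_const ?_ _) ?_
    · exact (h.memLp.1.comp_fst.sub (h.memLp.1.comp_quasiMeasurePreserving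
        (quasiMeasurePreserving_sub_of_right_invariant volume volume))).enorm
    · exact (((measurable_kern lam α).comp measurable_snd).ennreal_ofReal).aemeasurable
  -- After the substitution `z = x - y` and an exchange of integrals, the inner integral is the
  -- squared norm of a translation difference, bounded by `‖z‖²` times a gradient norm.
  calc ∫⁻ p, ‖diffQuot lam α v p‖ₑ ^ (2 : ℝ) ∂(volume.prod volume)
      = ∫⁻ x, ∫⁻ y, ‖v x - v y‖ₑ ^ (2 : ℝ) * ENNReal.ofReal (kern lam α (x - y)) := by
        rw [lintegral_prod _ (hm.enorm.pow_const _)]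
        simp_rw [hk]
    _ = ∫⁻ x, ∫⁻ z, ‖v x - v (x - z)‖ₑ ^ (2 : ℝ) * ENNReal.ofReal (kern lam α z) := by
        refine lintegral_congr fun x => ?_
        rw [← lintegral_sub_left_eq_self _ x]
        simp
    _ = ∫⁻ z, ∫⁻ x, ‖v x - v (x - z)‖ₑ ^ (2 : ℝ) * ENNReal.ofReal (kern lam α z) :=
        lintegral_lintegral_swap hvm
    _ = ∫⁻ z, ENNReal.ofReal (kern lam α z) * eLpNorm (fun x => v x - v (x - z)) 2 volume ^ (2 : ℝ) := by
        refine lintegral_congr fun z => ?_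
        rw [lintegral_mul_const' _ _ ENNReal.ofReal_ne_top, mul_comm]
        congr 1
        rw [eLpNorm_eq_lintegral_rpow_enorm_toReal (by norm_num) (by norm_num), ← ENNReal.rpow_mul]
        simp
    _ ≤ ∫⁻ z, ENNReal.ofReal (‖z‖ ^ 2 * kern lam α z)
          * (∑ i, eLpNorm (g i) 2 volume) ^ (2 : ℝ) := by
        refine lintegral_mono fun z => ?_
        have h1 := ENNReal.rpow_le_rpow (h.eLpNorm_sub_translate_le z) (z := 2) (by norm_num)
        rw [ENNReal.mul_rpow_of_nonneg _ _ (by norm_num)] at h1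
        have h2 : ‖z‖ₑ ^ (2 : ℝ) = ENNReal.ofReal (‖z‖ ^ 2) := by
          rw [← ofReal_norm, ENNReal.ofReal_rpow_of_nonneg (norm_nonneg _) (by norm_num)]
          norm_num
        rw [ENNReal.ofReal_mul (by positivity), ← h2]
        calc ENNReal.ofReal (kern lam α z) * eLpNorm (fun x => v x - v (x - z)) 2 volume ^ (2 : ℝ)
            ≤ ENNReal.ofReal (kern lam α z)
              * (‖z‖ₑ ^ (2 : ℝ) * (∑ i, eLpNorm (g i) 2 volume) ^ (2 : ℝ)) := by gcongr
          _ = _ := by ring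
    _ = _ := by
        have hmk : Measurable fun z : Sp d => ‖z‖ ^ 2 * kern lam α z :=
          (by fun_prop : Measurable fun z : Sp d => ‖z‖ ^ 2).mul (measurable_kern lam α)
        exact lintegral_mul_const _ hmk.ennreal_ofReal

end Kernel

/-! ### The nonlocal form: symmetry, positivity and boundedness -/

section Nonlocal

variable {d : ℕ} {Ω : Set (Sp d)} {lam : ℝ} {u v w : H1Vel Ω lam}

lemma IsSetting.dim_pos (h : IsSetting Ω lam) : 0 < d := by
  rcases h.dim with hd | hd <;> omega

/-- The product of the extended domain with itself. -/
noncomputable def pairMeasure (Ω : Set (Sp d)) (lam : ℝ) : Measure (Sp d × Sp d) :=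
  (volume.restrict (extDomain Ω lam)).prod (volume.restrict (extDomain Ω lam))

lemma pairMeasure_le (Ω : Set (Sp d)) (lam : ℝ) :
    pairMeasure Ω lam ≤ volume.prod volume := by
  rw [pairMeasure, Measure.prod_restrict]
  exact Measure.restrict_le_self

/-- The square of the constant in the comparison of the fractional seminorm with the gradient. -/
noncomputable def kernMass (d : ℕ) (lam α : ℝ) : ℝ := ∫ z : Sp d, ‖z‖ ^ 2 * kern lam α z

lemma kernMass_nonneg (d : ℕ) (lam α : ℝ) : 0 ≤ kernMass d lam α :=
  integral_nonneg fun z => mul_nonneg (by positivity) (kern_nonneg _ _ _)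

lemma IsSetting.lintegral_diffQuot_le (h : IsSetting Ω lam) {α : ℝ} (hα : α < 1)
    (hv : v ∈ velocitySpace Ω lam) (j : Fin d) :
    ∫⁻ p, ‖diffQuot lam α (extVal v j) p‖ₑ ^ (2 : ℝ) ∂(volume.prod volume)
      ≤ ENNReal.ofReal (kernMass d lam α * (d * ‖gradMap v‖) ^ 2) := by
  obtain ⟨ψ, hψ⟩ := h.exists_approx hv j
  refine (hψ.lintegral_diffQuot_le lam α).trans ?_
  rw [ENNReal.ofReal_mul (kernMass_nonneg _ _ _), kernMass, ofReal_integral_eq_lintegral_ofReal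
    (integrable_sq_mul_kern h.dim_pos h.pos hα)
    (Eventually.of_forall fun z => mul_nonneg (by positivity) (kern_nonneg _ _ _))]
  gcongr
  rw [← Real.rpow_two, ← ENNReal.ofReal_rpow_of_nonneg (by positivity) (by norm_num)]
  refine ENNReal.rpow_le_rpow ?_ (by norm_num)
  have hfin : ∀ i, eLpNorm (extGrad v j i) 2 volume ≠ ⊤ := fun i =>
    (memLp_extGrad h.isOpen v j i).2.ne
  rw [← ENNReal.ofReal_toReal (ENNReal.sum_ne_top.2 fun i _ => hfin i),
    ENNReal.toReal_sum fun i _ => hfin i]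
  refine ENNReal.ofReal_le_ofReal
    ((Finset.sum_le_sum fun i _ => eLpNorm_extGrad_le h.isOpen v j i).trans ?_)
  simp

lemma IsSetting.memLp_diffQuot (h : IsSetting Ω lam) {α : ℝ} (hα : α < 1)
    (hv : v ∈ velocitySpace Ω lam) (j : Fin d) :
    MemLp (diffQuot lam α (extVal v j)) 2 (pairMeasure Ω lam) := by
  have h1 : MemLp (diffQuot lam α (extVal v j)) 2 (volume.prod volume) := by
    refine ⟨aestronglyMeasurable_diffQuot lam α (memLp_extVal h.isOpen v j).1, ?_⟩
    rw [eLpNorm_lt_top_iff_lintegral_rpow_enorm_lt_top (by norm_num) (by norm_num)]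
    exact (h.lintegral_diffQuot_le hα hv j).trans_lt ENNReal.ofReal_lt_top
  exact h1.mono_measure (pairMeasure_le Ω lam)

lemma IsSetting.integrable_diffQuot_mul (h : IsSetting Ω lam) {α : ℝ} (hα : α < 1)
    (hu : u ∈ velocitySpace Ω lam) (hv : v ∈ velocitySpace Ω lam) (j : Fin d) :
    Integrable (fun p => diffQuot lam α (extVal u j) p * diffQuot lam α (extVal v j) p)
      (pairMeasure Ω lam) :=
  (h.memLp_diffQuot hα hu j).integrable_mul (h.memLp_diffQuot hα hv j)

lemma fn_ae_eq_extVal (hv : v ∈ velocitySpace Ω lam) :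
    ∀ᵐ x ∂(volume.restrict (extDomain Ω lam)), ∀ j, fn v x j = extVal v j x := by
  have hv' : ∀ᵐ x ∂(volume.restrict (extDomain Ω lam)), x ∉ Ω → fn v x = 0 := hv
  filter_upwards [hv'] with x hx j
  by_cases hxΩ : x ∈ Ω
  · rw [extVal, indicator_of_mem hxΩ]
  · rw [extVal, indicator_of_notMem hxΩ, hx hxΩ]
    rfl

/-- The nonlocal form in coordinates. -/
lemma IsSetting.nonlocalForm_eq (h : IsSetting Ω lam) {α : ℝ} (hα : α < 1)
    (hu : u ∈ velocitySpace Ω lam) (hv : v ∈ velocitySpace Ω lam) :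
    nonlocalForm α u v = fracConst d α / 2 * ∑ j, ∫ p,
      diffQuot lam α (extVal u j) p * diffQuot lam α (extVal v j) p ∂(pairMeasure Ω lam) := by
  rw [nonlocalForm, ← integral_finsetSum _ fun j _ => h.integrable_diffQuot_mul hα hu hv j,
    pairMeasure, integral_prod _ (integrable_finsetSum _ fun j _ =>
      h.integrable_diffQuot_mul hα hu hv j)]
  congr 1
  refine integral_congr_ae ?_
  filter_upwards [fn_ae_eq_extVal hu, fn_ae_eq_extVal hv] with x hux hvx
  rw [← setIntegral_indicator Metric.isClosed_closedBall.measurableSet]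
  refine integral_congr_ae ?_
  filter_upwards [fn_ae_eq_extVal hu, fn_ae_eq_extVal hv] with y huy hvy
  have hsum : inner ℝ (fn u x - fn u y) (fn v x - fn v y)
      = ∑ j, (extVal u j x - extVal u j y) * (extVal v j x - extVal v j y) := by
    rw [PiLp.inner_apply]
    refine Finset.sum_congr rfl fun j _ => ?_
    rw [PiLp.sub_apply, PiLp.sub_apply, hux, hvx, huy, hvy]
    simp [mul_comm]
  -- Each difference quotient carries the square root of the kernel, so the product of two recovers
  -- the kernel and the form becomes an `L²` pairing on the product space.
  have hk : ∑ j, diffQuot lam α (extVal u j) (x, y) * diffQuot lam α (extVal v j) (x, y)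
      = (∑ j, (extVal u j x - extVal u j y) * (extVal v j x - extVal v j y))
        * kern lam α (x - y) := by
    rw [Finset.sum_mul]
    refine Finset.sum_congr rfl fun j _ => ?_
    simp only [diffQuot]
    rw [mul_mul_mul_comm, Real.mul_self_sqrt (kern_nonneg lam α (x - y))]
  rw [hk]
  by_cases hxy : y ∈ Metric.closedBall x lam
  · have hxy' : x - y ∈ Metric.closedBall (0 : Sp d) lam := by
      rw [mem_closedBall_zero_iff, ← dist_eq_norm, dist_comm]
      exact hxy
    rw [indicator_of_mem hxy, kern, indicator_of_mem hxy', hsum, mul_one_div]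
  · have hxy' : x - y ∉ Metric.closedBall (0 : Sp d) lam := by
      rw [mem_closedBall_zero_iff, ← dist_eq_norm, dist_comm]
      exact hxy
    rw [indicator_of_notMem hxy, kern, indicator_of_notMem hxy', mul_zero]

lemma diffQuot_sub (hΩ : IsOpen Ω) (α : ℝ) (u v : H1Vel Ω lam) (j : Fin d) :
    diffQuot lam α (extVal (u - v) j) =ᵐ[pairMeasure Ω lam]
      fun p => diffQuot lam α (extVal u j) p - diffQuot lam α (extVal v j) p := by
  have h := ae_mono (Measure.restrict_le_self (s := extDomain Ω lam)) (extVal_sub hΩ u v j)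
  have h1 : ∀ᵐ p ∂(pairMeasure Ω lam),
      extVal (u - v) j p.1 = (extVal u j - extVal v j) p.1 :=
    Measure.quasiMeasurePreserving_fst.ae h
  have h2 : ∀ᵐ p ∂(pairMeasure Ω lam),
      extVal (u - v) j p.2 = (extVal u j - extVal v j) p.2 :=
    Measure.quasiMeasurePreserving_snd.ae h
  filter_upwards [h1, h2] with p hp1 hp2
  simp only [diffQuot, hp1, hp2, Pi.sub_apply]
  ring

lemma IsSetting.nonlocalForm_comm (h : IsSetting Ω lam) {α : ℝ} (hα : α < 1)
    (hu : u ∈ velocitySpace Ω lam) (hv : v ∈ velocitySpace Ω lam) :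
    nonlocalForm α u v = nonlocalForm α v u := by
  rw [h.nonlocalForm_eq hα hu hv, h.nonlocalForm_eq hα hv hu]
  simp_rw [mul_comm (diffQuot _ _ (extVal u _) _)]

lemma IsSetting.nonlocalForm_sub_left (h : IsSetting Ω lam) {α : ℝ} (hα : α < 1)
    (hu : u ∈ velocitySpace Ω lam) (hw : w ∈ velocitySpace Ω lam) (hv : v ∈ velocitySpace Ω lam) :
    nonlocalForm α (u - w) v = nonlocalForm α u v - nonlocalForm α w v := by
  rw [h.nonlocalForm_eq hα hu hv, h.nonlocalForm_eq hα hw hv,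
    h.nonlocalForm_eq hα (Submodule.sub_mem _ hu hw) hv, ← mul_sub, ← Finset.sum_sub_distrib]
  congr 1
  refine Finset.sum_congr rfl fun j _ => ?_
  rw [← integral_sub (h.integrable_diffQuot_mul hα hu hv j) (h.integrable_diffQuot_mul hα hw hv j)]
  refine integral_congr_ae ?_
  filter_upwards [diffQuot_sub h.isOpen α u w j] with p hp
  rw [hp]
  ring

lemma fracConst_nonneg (d : ℕ) {α : ℝ} (hα : α ∈ Ioo (0 : ℝ) 1) : 0 ≤ fracConst d α := by
  have h1 := Real.Gamma_nonneg_of_nonneg (s := ((d : ℝ) + 2) / 2) (by positivity)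
  have h2 := Real.Gamma_nonneg_of_nonneg (s := 1 / 2) (by positivity)
  have h3 := Real.Gamma_nonneg_of_nonneg (s := 1 - α) (by linarith [hα.2])
  have h4 := hα.1
  unfold fracConst
  positivity

lemma IsSetting.nonlocalForm_nonneg (h : IsSetting Ω lam) {α : ℝ} (hα : α ∈ Ioo (0 : ℝ) 1)
    (hv : v ∈ velocitySpace Ω lam) : 0 ≤ nonlocalForm α v v := by
  rw [h.nonlocalForm_eq hα.2 hv hv]
  have := fracConst_nonneg d hα
  refine mul_nonneg (by positivity) (Finset.sum_nonneg fun j _ => integral_nonneg fun p => ?_)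
  exact mul_self_nonneg _

/-- The gradient dominates the fractional energy because `α < 1`. This makes the nonlocal
contribution of the projection error no worse than its viscous size. -/
lemma IsSetting.exists_nonlocalForm_le (h : IsSetting Ω lam) {α : ℝ} (hα : α ∈ Ioo (0 : ℝ) 1) :
    ∃ C : ℝ, 0 ≤ C ∧ ∀ v ∈ velocitySpace Ω lam, nonlocalForm α v v ≤ C * ‖gradMap v‖ ^ 2 := by
  have hc := fracConst_nonneg d hα
  have hk := kernMass_nonneg d lam α
  refine ⟨fracConst d α / 2 * (d * (kernMass d lam α * d ^ 2)), by positivity, fun v hv => ?_⟩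
  rw [h.nonlocalForm_eq hα.2 hv hv, mul_assoc]
  gcongr
  have key : ∀ j, ∫ p, diffQuot lam α (extVal v j) p * diffQuot lam α (extVal v j) p
      ∂(pairMeasure Ω lam) ≤ kernMass d lam α * (d * ‖gradMap v‖) ^ 2 := by
    intro j
    have h1 := h.integrable_diffQuot_mul hα.2 hv hv j
    rw [integral_eq_lintegral_of_nonneg_ae (Eventually.of_forall fun p => mul_self_nonneg _) h1.1]
    refine ENNReal.toReal_le_of_le_ofReal (by positivity) ?_
    refine le_trans ?_ (h.lintegral_diffQuot_le hα.2 hv j)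
    refine (lintegral_mono' (pairMeasure_le Ω lam) le_rfl).trans (lintegral_mono fun p => ?_)
    rw [← sq, ← sq_abs, ENNReal.ofReal_pow (abs_nonneg _), ← Real.norm_eq_abs, ofReal_norm]
    exact (ENNReal.rpow_natCast _ 2).symm.le
  refine (Finset.sum_le_sum fun j _ => key j).trans_eq ?_
  rw [Finset.sum_const, Finset.card_univ, Fintype.card_fin, nsmul_eq_mul]
  ring

end Nonlocal

/-! ### The inf-sup condition and projection onto the discrete kernel -/

section InfSup

variable {H L : Type*} [NormedAddCommGroup H] [InnerProductSpace ℝ H] [NormedAddCommGroup L]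
  [InnerProductSpace ℝ L]

/-- The elements of `K` whose image under `B` is orthogonal to `Q`. -/
def discreteKernel (B : H →L[ℝ] L) (K : Submodule ℝ H) (Q : Submodule ℝ L) : Submodule ℝ H where
  carrier := {v | v ∈ K ∧ ∀ q ∈ Q, inner ℝ q (B v) = 0}
  zero_mem' := ⟨K.zero_mem, fun q _ => by simp⟩
  add_mem' := fun {u v} hu hv => ⟨K.add_mem hu.1 hv.1, fun q hq => by
    rw [map_add, inner_add_right, hu.2 q hq, hv.2 q hq, add_zero]⟩
  smul_mem' := fun c v hv => ⟨K.smul_mem c hv.1, fun q hq => by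
    rw [map_smul, inner_smul_right, hv.2 q hq, mul_zero]⟩

lemma discreteKernel_le (B : H →L[ℝ] L) (K : Submodule ℝ H) (Q : Submodule ℝ L) :
    discreteKernel B K Q ≤ K := fun _ hv => hv.1

instance discreteKernel_finiteDimensional (B : H →L[ℝ] L) (K : Submodule ℝ H)
    (Q : Submodule ℝ L) [FiniteDimensional ℝ K] : FiniteDimensional ℝ (discreteKernel B K Q) :=
  Submodule.finiteDimensional_of_le (discreteKernel_le B K Q)

/-- Functionals on `K` that vanish on the discrete kernel are represented by elements of `Q`. -/
lemma exists_multiplier (B : H →L[ℝ] L) (K : Submodule ℝ H) (Q : Submodule ℝ L)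
    [FiniteDimensional ℝ K] {z : H} (hz : ∀ v ∈ discreteKernel B K Q, inner ℝ z v = 0) :
    ∃ y ∈ Q, ∀ v ∈ K, inner ℝ z v = inner ℝ y (B v) := by
  let T : L →ₗ[ℝ] Module.Dual ℝ K :=
    { toFun := fun q => ((innerSL ℝ q).comp (B.comp K.subtypeL)).toLinearMap
      map_add' := fun p q => by ext v; simp
      map_smul' := fun c q => by ext v; simp }
  let W : Submodule ℝ (Module.Dual ℝ K) := Q.map T
  let ℓ : Module.Dual ℝ K := ((innerSL ℝ z).comp K.subtypeL).toLinearMap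
  -- In the finite-dimensional dual of `K`, a subspace is the annihilator of its common kernel. That
  -- common kernel is the discrete kernel, on which `ℓ` vanishes by assumption.
  have hmem : ℓ ∈ W.dualCoannihilator.dualAnnihilator := by
    rw [Submodule.mem_dualAnnihilator]
    intro v hv
    rw [Submodule.mem_dualCoannihilator] at hv
    refine hz v ⟨v.2, fun q hq => ?_⟩
    exact hv (T q) (Submodule.mem_map_of_mem hq)
  rw [Subspace.dualCoannihilator_dualAnnihilator_eq] at hmem
  obtain ⟨y, hy, hyℓ⟩ := hmem
  refine ⟨y, hy, fun v hv => ?_⟩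
  have := LinearMap.congr_fun hyℓ ⟨v, hv⟩
  simpa [T, ℓ] using this.symm

/-- Under the inf-sup condition, the distance to the discrete kernel is comparable with the
distance to the whole space. -/
theorem norm_sub_projection_le (B : H →L[ℝ] L) (K : Submodule ℝ H) (Q : Submodule ℝ L)
    [FiniteDimensional ℝ K] {β : ℝ} (hβ : 0 < β)
    (hinf : ∀ q ∈ Q, ∀ M : ℝ, 0 ≤ M → (∀ v ∈ K, inner ℝ q (B v) ≤ M * ‖v‖) → β * ‖q‖ ≤ M)
    {g : H} (hg : ∀ q ∈ Q, inner ℝ q (B g) = 0) {v : H} (hv : v ∈ K) :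
    ‖g - (discreteKernel B K Q).starProjection g‖ ≤ (1 + ‖B‖ / β) * ‖g - v‖ := by
  set V := discreteKernel B K Q with hV
  -- `z` lies in `K` and is orthogonal to `V`, so it is represented by a multiplier `y` in `Q`. The
  -- inf-sup condition bounds `y` by `z`.
  set z := K.starProjection g - V.starProjection g with hz
  have hzK : z ∈ K := K.sub_mem (Submodule.starProjection_apply_mem _ _)
    (discreteKernel_le B K Q (Submodule.starProjection_apply_mem V _))
  have hzV : ∀ w ∈ V, inner ℝ z w = 0 := by
    intro w hw
    have h1 : inner ℝ (g - K.starProjection g) w = 0 :=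
      Submodule.starProjection_inner_eq_zero g w (discreteKernel_le B K Q hw)
    have h2 : inner ℝ (g - V.starProjection g) w = 0 :=
      Submodule.starProjection_inner_eq_zero g w hw
    rw [inner_sub_left] at h1 h2
    rw [hz, inner_sub_left]
    linarith
  obtain ⟨y, hy, hyz⟩ := exists_multiplier B K Q hzV
  have hyn : β * ‖y‖ ≤ ‖z‖ := hinf y hy _ (norm_nonneg _) fun w hw => by
    rw [← hyz w hw]
    exact real_inner_le_norm z w
  have hPK : ‖g - K.starProjection g‖ ≤ ‖g - v‖ := by
    rw [Submodule.starProjection_minimal]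
    exact ciInf_le ⟨0, by rintro _ ⟨w, rfl⟩; positivity⟩ (⟨v, hv⟩ : K)
  -- Testing the representation with `z` itself: `y` annihilates both `B g` and `B` of the
  -- projection onto `V`, so only the approximation error in `K` remains.
  have h3 : ‖z‖ ^ 2 ≤ ‖y‖ * (‖B‖ * ‖g - K.starProjection g‖) := by
    have h4 : ‖z‖ ^ 2 = - inner ℝ y (B (g - K.starProjection g)) := by
      rw [← real_inner_self_eq_norm_sq, hyz z hzK, hz, map_sub, inner_sub_right, map_sub,
        inner_sub_right, hg y hy, (Submodule.starProjection_apply_mem V g).2 y hy]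
      ring
    rw [h4]
    refine (neg_le_abs _).trans ((abs_real_inner_le_norm _ _).trans ?_)
    gcongr
    exact B.le_opNorm _
  have h5 : ‖z‖ ≤ ‖B‖ / β * ‖g - K.starProjection g‖ := by
    rcases (norm_nonneg z).eq_or_lt with h0 | h0
    · rw [← h0]; positivity
    · have h6 : β * (‖z‖ * ‖z‖) ≤ ‖z‖ * (‖B‖ * ‖g - K.starProjection g‖) := by
        calc β * (‖z‖ * ‖z‖) = β * ‖z‖ ^ 2 := by ring
          _ ≤ β * (‖y‖ * (‖B‖ * ‖g - K.starProjection g‖)) := by gcongr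
          _ = (β * ‖y‖) * (‖B‖ * ‖g - K.starProjection g‖) := by ring
          _ ≤ _ := by gcongr
      have h7 : β * ‖z‖ ≤ ‖B‖ * ‖g - K.starProjection g‖ := by
        refine le_of_mul_le_mul_left ?_ h0
        linarith
      rw [div_mul_eq_mul_div, le_div_iff₀ hβ]
      linarith
  have h8 : g - V.starProjection g = (g - K.starProjection g) + z := by rw [hz]; abel
  rw [h8]
  refine (norm_add_le _ _).trans ?_
  have h9 : 0 ≤ ‖B‖ / β := by positivity
  nlinarith

end InfSup

/-! ### Functions of time on a uniform grid -/

section Time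

variable {B : Type} [NormedAddCommGroup B] {T : ℝ}

lemma MemLTime.intervalIntegrable (hT : 0 < T) {u : ℝ → B} (hu : MemLTime 2 T u) {a b : ℝ}
    (ha : 0 ≤ a) (hab : a ≤ b) (hb : b ≤ T) : IntervalIntegrable u volume a b := by
  have h1 : IntervalIntegrable u volume 0 T := by
    rw [intervalIntegrable_iff_integrableOn_Ioo_of_le hT.le]
    exact hu.integrable (by norm_num)
  refine h1.mono_set ?_
  rw [uIcc_of_le hab, uIcc_of_le hT.le]
  exact Icc_subset_Icc ha hb

lemma MemLTime.intervalIntegrable_sq (hT : 0 < T) {u : ℝ → B} (hu : MemLTime 2 T u) {a b : ℝ}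
    (ha : 0 ≤ a) (hab : a ≤ b) (hb : b ≤ T) :
    IntervalIntegrable (fun r => ‖u r‖ ^ 2) volume a b := by
  have h1 : IntervalIntegrable (fun r => ‖u r‖ ^ 2) volume 0 T := by
    rw [intervalIntegrable_iff_integrableOn_Ioo_of_le hT.le]
    exact (memLp_two_iff_integrable_sq_norm hu.1).1 hu
  refine h1.mono_set ?_
  rw [uIcc_of_le hab, uIcc_of_le hT.le]
  exact Icc_subset_Icc ha hb

/-- Cauchy–Schwarz, read off from the nonnegative integral of the squared deviation of `(b - a) ‖u‖`
from `m`. -/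
lemma MemLTime.sq_integral_le (hT : 0 < T) {u : ℝ → B} (hu : MemLTime 2 T u) {a b : ℝ}
    (ha : 0 ≤ a) (hab : a ≤ b) (hb : b ≤ T) :
    (∫ r in a..b, ‖u r‖) ^ 2 ≤ (b - a) * ∫ r in a..b, ‖u r‖ ^ 2 := by
  have i1 := (hu.intervalIntegrable hT ha hab hb).norm
  have i2 := hu.intervalIntegrable_sq hT ha hab hb
  set m := ∫ r in a..b, ‖u r‖
  have h1 : 0 ≤ ∫ r in a..b, ((b - a) * ‖u r‖ - m) ^ 2 :=
    intervalIntegral.integral_nonneg hab fun r _ => sq_nonneg _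
  have h2 : ∫ r in a..b, ((b - a) * ‖u r‖ - m) ^ 2
      = (b - a) ^ 2 * (∫ r in a..b, ‖u r‖ ^ 2) - 2 * (b - a) * m * m + m ^ 2 * (b - a) := by
    have h3 : ∀ r, ((b - a) * ‖u r‖ - m) ^ 2
        = (b - a) ^ 2 * ‖u r‖ ^ 2 - 2 * (b - a) * m * ‖u r‖ + m ^ 2 := fun r => by ring
    simp_rw [h3]
    rw [intervalIntegral.integral_add ((i2.const_mul _).sub (i1.const_mul _))
      intervalIntegrable_const, intervalIntegral.integral_sub (i2.const_mul _) (i1.const_mul _),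
      intervalIntegral.integral_const_mul, intervalIntegral.integral_const_mul,
      intervalIntegral.integral_const, smul_eq_mul]
    ring
  rw [h2] at h1
  rcases hab.eq_or_lt with rfl | hlt
  · simp [m]
  · have h4 : 0 ≤ (b - a) * ((b - a) * (∫ r in a..b, ‖u r‖ ^ 2) - m ^ 2) := by linarith
    have := nonneg_of_mul_nonneg_right h4 (by linarith)
    linarith

/-- The nodes of a uniform grid. -/
lemma grid_mem {NT : ℕ} {Δt : ℝ} (hT : 0 < T) (hN : 1 ≤ NT) (hΔ : Δt = T / NT) {n : ℕ} (hn : n ≤ NT) :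
    (n : ℝ) * Δt ∈ Icc 0 T := by
  have h1 : (0 : ℝ) < NT := by exact_mod_cast hN
  refine ⟨by rw [hΔ]; positivity, ?_⟩
  rw [hΔ, mul_div_assoc', div_le_iff₀ h1, mul_comm]
  have : (n : ℝ) ≤ NT := by exact_mod_cast hn
  gcongr

lemma MemLTime.sum_integral_sq_le (hT : 0 < T) {u' : ℝ → B} (hu' : MemLTime 2 T u') {NT N : ℕ} {Δt : ℝ}
    (hNT : 1 ≤ NT) (hΔ : Δt = T / NT) (hN : N ≤ NT) :
    ∑ n ∈ Finset.range N, ∫ r in ((n : ℝ) * Δt)..(((n + 1 : ℕ) : ℝ) * Δt), ‖u' r‖ ^ 2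
      ≤ ∫ r in (0 : ℝ)..T, ‖u' r‖ ^ 2 := by
  have hΔ0 : 0 ≤ Δt := by rw [hΔ]; positivity
  have h1 := intervalIntegral.sum_integral_adjacent_intervals (μ := volume)
    (f := fun r => ‖u' r‖ ^ 2) (a := fun n : ℕ => (n : ℝ) * Δt) (n := N) fun k hk =>
      hu'.intervalIntegrable_sq hT (grid_mem hT hNT hΔ (by omega)).1
        (by gcongr; omega) (grid_mem hT hNT hΔ (by omega)).2
  rw [h1]
  simp only [Nat.cast_zero, zero_mul]
  have hm := grid_mem hT hNT hΔ hN
  exact intervalIntegral.integral_mono_interval le_rfl hm.1 hm.2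
      (Eventually.of_forall fun r => sq_nonneg _) (hu'.intervalIntegrable_sq hT le_rfl hT.le le_rfl)

variable [NormedSpace ℝ B] {u u' : ℝ → B}

lemma IsTimeDeriv.sub_eq (hT : 0 < T) (h : IsTimeDeriv T u u') (hu' : MemLTime 2 T u') {a b : ℝ}
    (ha : 0 ≤ a) (hab : a ≤ b) (hb : b ≤ T) : u b - u a = ∫ r in a..b, u' r := by
  rw [h b ⟨ha.trans hab, hb⟩, h a ⟨ha, hab.trans hb⟩, add_sub_add_left_eq_sub,
    intervalIntegral.integral_interval_sub_left
      (hu'.intervalIntegrable hT le_rfl (ha.trans hab) hb)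
      (hu'.intervalIntegrable hT le_rfl ha (hab.trans hb))]

lemma IsTimeDeriv.norm_sub_le (hT : 0 < T) (h : IsTimeDeriv T u u') (hu' : MemLTime 2 T u')
    {a b : ℝ} (ha : 0 ≤ a) (hab : a ≤ b) (hb : b ≤ T) : ‖u b - u a‖ ≤ ∫ r in a..b, ‖u' r‖ := by
  rw [h.sub_eq hT hu' ha hab hb]
  exact intervalIntegral.norm_integral_le_integral_norm hab

lemma IsTimeDeriv.exists_bound (hT : 0 < T) (h : IsTimeDeriv T u u') (hu' : MemLTime 2 T u') :
    ∃ M, 0 ≤ M ∧ ∀ t ∈ Icc 0 T, ‖u t‖ ≤ M := by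
  have h0 : 0 ≤ ∫ r in (0 : ℝ)..T, ‖u' r‖ :=
    intervalIntegral.integral_nonneg hT.le fun r _ => norm_nonneg _
  refine ⟨‖u 0‖ + ∫ r in (0 : ℝ)..T, ‖u' r‖, by positivity, fun t ht => ?_⟩
  have h1 := h.norm_sub_le hT hu' le_rfl ht.1 ht.2
  have h2 : ∫ r in (0 : ℝ)..t, ‖u' r‖ ≤ ∫ r in (0 : ℝ)..T, ‖u' r‖ :=
    intervalIntegral.integral_mono_interval le_rfl ht.1 ht.2
      (Eventually.of_forall fun r => norm_nonneg _) (hu'.intervalIntegrable hT le_rfl hT.le le_rfl).norm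
  have h3 := norm_le_norm_add_norm_sub' (u t) (u 0)
  linarith

lemma IsTimeDeriv.continuousOn (hT : 0 < T) (h : IsTimeDeriv T u u') (hu' : MemLTime 2 T u') :
    ContinuousOn u (Icc 0 T) := by
  have h1 : ContinuousOn (fun t => u 0 + ∫ r in (0 : ℝ)..t, u' r) (Icc 0 T) := by
    refine continuousOn_const.add ?_
    have h2 := hu'.intervalIntegrable hT le_rfl hT.le le_rfl
    have := intervalIntegral.continuousOn_primitive_interval (a := 0) (b := T) (f := u')
      (μ := volume) (by rw [uIcc_of_le hT.le]; exact (intervalIntegrable_iff_integrableOn_Icc_of_le hT.le).1 h2)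
    rwa [uIcc_of_le hT.le] at this
  exact h1.congr h

/-- Squared increments over a uniform grid. -/
lemma IsTimeDeriv.sum_sq_le (hT : 0 < T) (h : IsTimeDeriv T u u') (hu' : MemLTime 2 T u')
    {NT N : ℕ} {Δt : ℝ} (hNT : 1 ≤ NT) (hΔ : Δt = T / NT) (hN : N ≤ NT) :
    ∑ n ∈ Finset.range N, ‖u (((n + 1 : ℕ) : ℝ) * Δt) - u ((n : ℝ) * Δt)‖ ^ 2
      ≤ Δt * ∫ r in (0 : ℝ)..T, ‖u' r‖ ^ 2 := by
  have hΔ0 : 0 ≤ Δt := by rw [hΔ]; positivity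
  refine le_trans ?_ (mul_le_mul_of_nonneg_left (hu'.sum_integral_sq_le hT hNT hΔ hN) hΔ0)
  rw [Finset.mul_sum]
  refine Finset.sum_le_sum fun n hn => ?_
  have hn' := Finset.mem_range.1 hn
  have ha := (grid_mem hT hNT hΔ (show n ≤ NT by omega)).1
  have hb := (grid_mem hT hNT hΔ (show n + 1 ≤ NT by omega)).2
  have hab : (n : ℝ) * Δt ≤ ((n + 1 : ℕ) : ℝ) * Δt := by gcongr; omega
  have h1 := h.norm_sub_le hT hu' ha hab hb
  have h2 := hu'.sq_integral_le hT ha hab hb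
  have h3 : ((n + 1 : ℕ) : ℝ) * Δt - n * Δt = Δt := by push_cast; ring
  rw [h3] at h2
  refine le_trans ?_ h2
  gcongr

/-- The consistency error of the backward difference quotient. -/
lemma exists_truncation_bound [CompleteSpace B] (hT : 0 < T) {y : ℝ → B} (hy : MemH2Time T y) :
    ∃ I : ℝ, 0 ≤ I ∧ ∀ yt : ℝ → B, (∀ t ∈ Ioc 0 T, HasDerivWithinAt y (yt t) (Icc 0 T) t) →
      ∀ (NT N : ℕ) (Δt : ℝ), 1 ≤ NT → Δt = T / NT → N ≤ NT →
        ∑ n ∈ Finset.range N, ‖Δt⁻¹ • (y (((n + 1 : ℕ) : ℝ) * Δt) - y ((n : ℝ) * Δt))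
          - yt (((n + 1 : ℕ) : ℝ) * Δt)‖ ^ 2 ≤ Δt * I := by
  obtain ⟨hy2, y', hd, hy'2, y'', hy''2, hd'⟩ := hy
  refine ⟨∫ r in (0 : ℝ)..T, ‖y'' r‖ ^ 2,
    intervalIntegral.integral_nonneg hT.le fun r _ => sq_nonneg _, ?_⟩
  intro yt hyt NT N Δt hNT hΔ hN
  have hcont := hd'.continuousOn hT hy''2
  -- The pointwise derivative in the equation must be the continuous representative `y'`, which
  -- gives meaning to its value at a grid point.
  have hyt' : ∀ t ∈ Ioc 0 T, yt t = y' t := by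
    intro t ht
    have htI : t ∈ Icc 0 T := ⟨ht.1.le, ht.2⟩
    have : Fact (t ∈ Icc 0 T) := ⟨htI⟩
    have h1 : HasDerivWithinAt (fun s => ∫ r in (0 : ℝ)..s, y' r) (y' t) (Icc 0 T) t := by
      refine intervalIntegral.integral_hasDerivWithinAt_right
        (hy'2.intervalIntegrable hT le_rfl ht.1.le ht.2) ?_ (hcont t htI)
      exact (hcont.stronglyMeasurableAtFilter_nhdsWithin measurableSet_Icc t)
    have h2 : HasDerivWithinAt y (y' t) (Icc 0 T) t :=
      (h1.const_add (y 0)).congr hd (hd t htI)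
    exact (uniqueDiffOn_Icc hT t htI).eq_deriv _ (hyt t ht) h2
  have hNT0 : (0 : ℝ) < NT := by exact_mod_cast hNT
  have hΔ0 : 0 < Δt := by rw [hΔ]; positivity
  refine le_trans ?_ (mul_le_mul_of_nonneg_left (hy''2.sum_integral_sq_le hT hNT hΔ hN) hΔ0.le)
  rw [Finset.mul_sum]
  refine Finset.sum_le_sum fun n hn => ?_
  have hn' := Finset.mem_range.1 hn
  have ha := (grid_mem hT hNT hΔ (show n ≤ NT by omega)).1
  have hb := (grid_mem hT hNT hΔ (show n + 1 ≤ NT by omega)).2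
  have hab : (n : ℝ) * Δt ≤ ((n + 1 : ℕ) : ℝ) * Δt := by gcongr; omega
  have h3 : ((n + 1 : ℕ) : ℝ) * Δt - n * Δt = Δt := by push_cast; ring
  have hb0 : 0 < ((n + 1 : ℕ) : ℝ) * Δt := by positivity
  rw [hyt' _ ⟨hb0, hb⟩, hd.sub_eq hT hy'2 ha hab hb]
  have h2 := hy''2.sq_integral_le hT ha hab hb
  rw [h3] at h2
  refine le_trans ?_ h2
  generalize hbe : ((n + 1 : ℕ) : ℝ) * Δt = b at *
  generalize hae : (n : ℝ) * Δt = a at *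
  have i1 := hy'2.intervalIntegrable hT ha hab hb
  -- The consistency error is the mean of `y' r - y' b` over the step, and each of these differences
  -- is at most the integral of `‖y''‖` over that step.
  have h4 : Δt⁻¹ • (∫ r in a..b, y' r) - y' b = Δt⁻¹ • ∫ r in a..b, (y' r - y' b) := by
    rw [intervalIntegral.integral_sub i1 intervalIntegrable_const, intervalIntegral.integral_const,
      h3, smul_sub, inv_smul_smul₀ hΔ0.ne']
  rw [h4]
  have h5 : ‖∫ r in a..b, (y' r - y' b)‖ ≤ (∫ r in a..b, ‖y'' r‖) * |b - a| := by
    refine intervalIntegral.norm_integral_le_of_norm_le_const fun r hr => ?_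
    rw [uIoc_of_le hab] at hr
    rw [norm_sub_rev]
    refine (hd'.norm_sub_le hT hy''2 (ha.trans hr.1.le) hr.2 hb).trans ?_
    exact intervalIntegral.integral_mono_interval hr.1.le hr.2 le_rfl
      (Eventually.of_forall fun r => norm_nonneg _) (hy''2.intervalIntegrable hT ha hab hb).norm
  rw [h3, abs_of_pos hΔ0] at h5
  have h6 : ‖Δt⁻¹ • ∫ r in a..b, (y' r - y' b)‖ ≤ ∫ r in a..b, ‖y'' r‖ := by
    rw [norm_smul, Real.norm_of_nonneg (by positivity), inv_mul_le_iff₀ hΔ0, mul_comm Δt]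
    exact h5
  gcongr

end Time

/-! ### Absorption and discrete Gronwall inequality -/

section Gronwall

/-- Absorption of the gradient terms in one step of the energy estimate. -/
lemma energy_absorb {ν Δt y y0 x x0 Z δM KM g : ℝ} (hν : 0 < ν) (hΔ : 0 < Δt)
    (hδ0 : 0 ≤ δM) (hδ : 8 * δM ≤ ν)
    (h : Δt⁻¹ * ((y ^ 2 - y0 ^ 2) / 2) + ν * x ^ 2 ≤ Z * x + g / 2 + δM * (x0 * x) + KM * (y0 * x)) :
    y ^ 2 - y0 ^ 2 + 2 * Δt * (ν * x ^ 2) ≤ Δt * (ν / 2 * x ^ 2 + ν / 2 * x0 ^ 2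
      + 8 / ν * KM ^ 2 * y0 ^ 2 + (8 / ν * Z ^ 2 + g)) := by
  -- After doubling, the `Z` and `KM` terms cost `ν / 8` of `x ^ 2` each, and the `δM` term costs `ν
  -- / 8` of `x ^ 2` and of `x0 ^ 2`; the allowance is `ν / 2` of each.
  have young : ∀ a b : ℝ, 2 * (a * b) ≤ ν / 8 * b ^ 2 + 8 / ν * a ^ 2 := by
    intro a b
    have h1 : ν / 8 * b ^ 2 + 8 / ν * a ^ 2 - 2 * (a * b) = (ν * b - 8 * a) ^ 2 / (8 * ν) := by
      field_simp
      ring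
    have h2 : 0 ≤ (ν * b - 8 * a) ^ 2 / (8 * ν) := by positivity
    linarith
  have h1 := young Z x
  have h2 := young (KM * y0) x
  have h3 : 2 * (δM * (x0 * x)) ≤ ν / 8 * (x0 ^ 2 + x ^ 2) := by
    have : 2 * (x0 * x) ≤ x0 ^ 2 + x ^ 2 := by nlinarith [sq_nonneg (x0 - x)]
    have h4 : 0 ≤ x0 ^ 2 + x ^ 2 := by positivity
    nlinarith
  have h5 : (y ^ 2 - y0 ^ 2) + 2 * Δt * (ν * x ^ 2)
      = 2 * Δt * (Δt⁻¹ * ((y ^ 2 - y0 ^ 2) / 2) + ν * x ^ 2) := by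
    field_simp
  rw [h5]
  have h6 : 2 * (Z * x + g / 2 + δM * (x0 * x) + KM * (y0 * x))
      ≤ ν / 2 * x ^ 2 + ν / 2 * x0 ^ 2 + 8 / ν * KM ^ 2 * y0 ^ 2 + (8 / ν * Z ^ 2 + g) := by
    have e1 : (KM * y0) ^ 2 = KM ^ 2 * y0 ^ 2 := by ring
    have e2 : KM * y0 * x = KM * (y0 * x) := by ring
    rw [e1, e2] at h2
    have e3 : 0 ≤ ν * x ^ 2 := by positivity
    have e4 : 0 ≤ ν * x0 ^ 2 := by positivity
    linarith
  calc 2 * Δt * (Δt⁻¹ * ((y ^ 2 - y0 ^ 2) / 2) + ν * x ^ 2)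
      ≤ 2 * Δt * (Z * x + g / 2 + δM * (x0 * x) + KM * (y0 * x)) := by gcongr
    _ = Δt * (2 * (Z * x + g / 2 + δM * (x0 * x) + KM * (y0 * x))) := by ring
    _ ≤ _ := by gcongr

/-- A discrete Gronwall inequality for energies with a lagged gradient term. -/
lemma discrete_gronwall {ν Δt K T : ℝ} {NT : ℕ} {y x F : ℕ → ℝ} (hν : 0 < ν) (hΔ : 0 < Δt)
    (hK : 0 ≤ K) (hT : NT * Δt ≤ T) (hF : ∀ n, 0 ≤ F n)
    (h : ∀ n < NT, y (n + 1) ^ 2 - y n ^ 2 + 2 * Δt * (ν * x (n + 1) ^ 2)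
      ≤ Δt * (ν / 2 * x (n + 1) ^ 2 + ν / 2 * x n ^ 2 + K * y n ^ 2 + F n)) :
    ∀ N ≤ NT, y N ^ 2 + Δt * ∑ n ∈ Finset.range N, ν * x (n + 1) ^ 2
      ≤ Real.exp (K * T) * (y 0 ^ 2 + Δt / 2 * ν * x 0 ^ 2 + Δt * ∑ n ∈ Finset.range N, F n) := by
  -- The left side stores `Δt / 2 * ν * x N ^ 2` to pay for the gradient lagged to the next step. Of
  -- the available `3 / 2 * Δt * ν * x (N + 1) ^ 2`, one part is summed and the remaining half is
  -- stored. Since `K` multiplies only the old value, each step costs the factor `1 + K * Δt`,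
  -- however large `Δt` is.
  have key : ∀ N ≤ NT, y N ^ 2 + Δt / 2 * ν * x N ^ 2 + Δt * ∑ n ∈ Finset.range N, ν * x (n + 1) ^ 2
      ≤ (1 + K * Δt) ^ N * (y 0 ^ 2 + Δt / 2 * ν * x 0 ^ 2 + Δt * ∑ n ∈ Finset.range N, F n) := by
    intro N
    induction N with
    | zero => intro _; simp
    | succ N ih =>
      intro hN
      have h1 := ih (by omega)
      have h2 := h N (by omega)
      rw [Finset.sum_range_succ, Finset.sum_range_succ, pow_succ]
      set A := ∑ n ∈ Finset.range N, ν * x (n + 1) ^ 2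
      set S := ∑ n ∈ Finset.range N, F n
      have hA : 0 ≤ A := Finset.sum_nonneg fun n _ => by positivity
      have hp : 1 ≤ (1 + K * Δt) ^ N := one_le_pow₀ (by nlinarith)
      set P := (1 + K * Δt) ^ N
      have hKΔ : 0 ≤ K * Δt := by positivity
      have h3 : y (N + 1) ^ 2 + Δt / 2 * ν * x (N + 1) ^ 2 + Δt * (A + ν * x (N + 1) ^ 2)
          ≤ (1 + K * Δt) * (y N ^ 2 + Δt / 2 * ν * x N ^ 2 + Δt * A) + Δt * F N := by
        have e1 : 0 ≤ K * Δt * (Δt / 2 * ν * x N ^ 2 + Δt * A) := by positivity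
        nlinarith
      have hPF : Δt * F N ≤ P * (1 + K * Δt) * (Δt * F N) := by
        refine le_mul_of_one_le_left (mul_nonneg hΔ.le (hF N)) ?_
        nlinarith
      calc _ ≤ _ := h3
        _ ≤ (1 + K * Δt) * (P * (y 0 ^ 2 + Δt / 2 * ν * x 0 ^ 2 + Δt * S))
            + P * (1 + K * Δt) * (Δt * F N) := by gcongr
        _ = _ := by ring
  intro N hN
  have h1 := key N hN
  have hS : 0 ≤ ∑ n ∈ Finset.range N, F n := Finset.sum_nonneg fun n _ => hF n
  have h2 : (1 + K * Δt) ^ N ≤ Real.exp (K * T) := by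
    calc (1 + K * Δt) ^ N ≤ Real.exp (K * Δt) ^ N := by
          gcongr
          rw [add_comm]
          exact Real.add_one_le_exp _
      _ = Real.exp (N * (K * Δt)) := (Real.exp_nat_mul _ _).symm
      _ ≤ Real.exp (K * T) := by
          refine Real.exp_le_exp.2 ?_
          have : (N : ℝ) ≤ NT := by exact_mod_cast hN
          calc (N : ℝ) * (K * Δt) = K * (N * Δt) := by ring
            _ ≤ K * (NT * Δt) := by gcongr
            _ ≤ K * T := by gcongr
  have h3 : 0 ≤ Δt / 2 * ν * x N ^ 2 := by positivity
  have h4 : 0 ≤ y 0 ^ 2 + Δt / 2 * ν * x 0 ^ 2 + Δt * ∑ n ∈ Finset.range N, F n := by positivity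
  calc _ ≤ _ := by linarith
    _ ≤ _ := h1
    _ ≤ _ := by gcongr

end Gronwall

/-! ### Bounds for the skew form and the error equation -/

section Identity

variable {d : ℕ} {Ω : Set (Sp d)} {lam : ℝ} {u v w : H1Vel Ω lam}

lemma skewForm_self (u v : H1Vel Ω lam) : skewForm u v v = 0 := by
  rw [skewForm]; ring

lemma IsSetting.skewForm_sub_left (h : IsSetting Ω lam) {u' : H1Vel Ω lam}
    (hu : u ∈ velocitySpace Ω lam) (hu' : u' ∈ velocitySpace Ω lam)
    (hv : v ∈ velocitySpace Ω lam) (hw : w ∈ velocitySpace Ω lam) :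
    skewForm (u - u') v w = skewForm u v w - skewForm u' v w := by
  rw [skewForm, skewForm, skewForm, h.convForm_sub_left hu hu' hw, h.convForm_sub_left hu hu' hv]
  ring

lemma IsSetting.skewForm_sub_mid (h : IsSetting Ω lam) {v' : H1Vel Ω lam}
    (hu : u ∈ velocitySpace Ω lam) (hv : v ∈ velocitySpace Ω lam)
    (hv' : v' ∈ velocitySpace Ω lam) (hw : w ∈ velocitySpace Ω lam) :
    skewForm u (v - v') w = skewForm u v w - skewForm u v' w := by
  rw [skewForm, skewForm, skewForm, h.convForm_sub_mid hu hw, h.convForm_sub_right hu hv hv']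
  ring

lemma IsSetting.convForm_eq_skewForm (h : IsSetting Ω lam) (hu : u ∈ velocitySpace Ω lam)
    (hv : v ∈ velocitySpace Ω lam) (hw : w ∈ velocitySpace Ω lam)
    (hdiv : div u =ᵐ[volume.restrict Ω] 0) : convForm u v w = skewForm u v w := by
  rw [skewForm, h.convForm_skew hu hw hv hdiv]
  ring

/-- Bounds for the skew-symmetric form. -/
lemma IsSetting.exists_skewForm_le_add (h : IsSetting Ω lam) {δ : ℝ} (hδ : 0 < δ) :
    ∃ K : ℝ, 0 ≤ K ∧ ∀ u ∈ velocitySpace Ω lam, ∀ v ∈ velocitySpace Ω lam,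
      ∀ w ∈ velocitySpace Ω lam, |skewForm u v w|
        ≤ (δ * ‖gradMap u‖ + K * ‖valMap u‖) * ‖gradMap v‖ * ‖gradMap w‖ := by
  obtain ⟨C, hC0, hC⟩ := h.exists_normL4_le
  -- The second `L⁴` factor contributes `C`, so `δ` is divided beforehand; `C + 1` avoids division
  -- by zero.
  obtain ⟨K, hK0, hK⟩ := h.exists_normL4_le_add (δ := δ / (C + 1)) (by positivity)
  refine ⟨K * C, by positivity, fun u hu v hv w hw => ?_⟩
  have h1 := h.abs_convForm_le hu hw v
  have h2 := h.abs_convForm_le hu hv w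
  have h3 : |skewForm u v w| ≤ 1 / 2 * |convForm u v w| + 1 / 2 * |convForm u w v| := by
    rw [skewForm]
    refine (abs_sub _ _).trans_eq ?_
    rw [abs_mul, abs_mul]
    norm_num
  have h4 := hC v hv
  have h5 := hC w hw
  have h6 := hK u hu
  have hu0 := normL4_nonneg u
  have h7 : normL4 u * C ≤ δ * ‖gradMap u‖ + K * C * ‖valMap u‖ := by
    calc normL4 u * C ≤ (δ / (C + 1) * ‖gradMap u‖ + K * ‖valMap u‖) * C := by gcongr
      _ = δ * ‖gradMap u‖ * (C / (C + 1)) + K * C * ‖valMap u‖ := by field_simp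
      _ ≤ δ * ‖gradMap u‖ * 1 + K * C * ‖valMap u‖ := by
          gcongr
          rw [div_le_one (by positivity)]
          linarith
      _ = _ := by ring
  calc |skewForm u v w| ≤ 1 / 2 * (normL4 u * ‖gradMap v‖ * normL4 w)
        + 1 / 2 * (normL4 u * ‖gradMap w‖ * normL4 v) := by linarith
    _ ≤ 1 / 2 * (normL4 u * ‖gradMap v‖ * (C * ‖gradMap w‖))
        + 1 / 2 * (normL4 u * ‖gradMap w‖ * (C * ‖gradMap v‖)) := by gcongr
    _ = (normL4 u * C) * ‖gradMap v‖ * ‖gradMap w‖ := by ring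
    _ ≤ _ := by gcongr

lemma IsSetting.exists_skewForm_le (h : IsSetting Ω lam) :
    ∃ K : ℝ, 0 ≤ K ∧ ∀ u ∈ velocitySpace Ω lam, ∀ v ∈ velocitySpace Ω lam,
      ∀ w ∈ velocitySpace Ω lam, |skewForm u v w|
        ≤ K * ‖gradMap u‖ * ‖gradMap v‖ * ‖gradMap w‖ := by
  obtain ⟨K, hK0, hK⟩ := h.exists_skewForm_le_add one_pos
  obtain ⟨C, hC0, hC⟩ := h.exists_poincare
  refine ⟨1 + K * C, by positivity, fun u hu v hv w hw => (hK u hu v hv w hw).trans ?_⟩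
  have := hC u hu
  calc (1 * ‖gradMap u‖ + K * ‖valMap u‖) * ‖gradMap v‖ * ‖gradMap w‖
      ≤ (1 * ‖gradMap u‖ + K * (C * ‖gradMap u‖)) * ‖gradMap v‖ * ‖gradMap w‖ := by gcongr
    _ = _ := by ring

lemma integral_inner_diffQuotient (Δt : ℝ) (u u0 v : H1Vel Ω lam) :
    ∫ x in Ω, inner ℝ (Δt⁻¹ • (fn u x - fn u0 x)) (fn v x)
      = Δt⁻¹ * inner ℝ (valMap u - valMap u0) (valMap v) := by
  rw [← real_inner_smul_left, L2.inner_def]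
  refine integral_congr_ae ?_
  filter_upwards [coeFn_valMap u, coeFn_valMap u0, coeFn_valMap v,
    Lp.coeFn_smul Δt⁻¹ (valMap u - valMap u0), Lp.coeFn_sub (valMap u) (valMap u0)]
    with x h1 h2 h3 h4 h5
  rw [h4, Pi.smul_apply, h5, Pi.sub_apply, h1, h2, h3]

/-- The error equation of one time step, tested with the discrete error. -/
lemma IsSetting.error_identity (h : IsSetting Ω lam) {ν γ α Δt : ℝ} (hα : α < 1)
    {U U0 uh uh0 W W0 : H1Vel Ω lam} (hU : U ∈ velocitySpace Ω lam) (hU0 : U0 ∈ velocitySpace Ω lam)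
    (huh : uh ∈ velocitySpace Ω lam) (huh0 : uh0 ∈ velocitySpace Ω lam)
    (hW : W ∈ velocitySpace Ω lam) (hW0 : W0 ∈ velocitySpace Ω lam)
    (hdiv : div U =ᵐ[volume.restrict Ω] 0) {ut f : L2 Ω (Sp d)} {p ph : L2 Ω ℝ}
    (hex : (∫ x in Ω, inner ℝ (ut x) (fn (uh - W) x)) + convForm U U (uh - W)
        + ν * gradForm U (uh - W) - (∫ x in Ω, p x * div (uh - W) x)
        + γ * nonlocalForm α U (uh - W) = ∫ x in Ω, inner ℝ (f x) (fn (uh - W) x))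
    (hdis : (∫ x in Ω, inner ℝ (Δt⁻¹ • (fn uh x - fn uh0 x)) (fn (uh - W) x))
        + skewForm uh0 uh (uh - W) + ν * gradForm uh (uh - W)
        + γ * nonlocalForm α uh (uh - W) - (∫ x in Ω, ph x * div (uh - W) x)
      = ∫ x in Ω, inner ℝ (f x) (fn (uh - W) x))
    (hph : inner ℝ ph (divMap Ω (gradMap (uh - W))) = 0)
    (horth : inner ℝ (gradMap (U - W)) (gradMap (uh - W)) = 0) :
    Δt⁻¹ * inner ℝ (valMap (uh - W) - valMap (uh0 - W0)) (valMap (uh - W))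
      + ν * ‖gradMap (uh - W)‖ ^ 2 + γ * nonlocalForm α (uh - W) (uh - W)
    = Δt⁻¹ * inner ℝ (valMap ((U - W) - (U0 - W0))) (valMap (uh - W))
      - inner ℝ (Δt⁻¹ • (valMap U - valMap U0) - ut) (valMap (uh - W))
      + γ * nonlocalForm α (U - W) (uh - W)
      - inner ℝ p (divMap Ω (gradMap (uh - W)))
      + (skewForm (U - U0) U (uh - W) + skewForm U0 (U - W) (uh - W)
        + skewForm (U0 - W0) W (uh - W) - skewForm (uh0 - W0) W (uh - W)) := by
  have hφ : uh - W ∈ velocitySpace Ω lam := Submodule.sub_mem _ huh hW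
  rw [integral_inner_valMap, h.convForm_eq_skewForm hU hU hφ hdiv, gradForm_eq_inner,
    integral_mul_div, integral_inner_valMap] at hex
  rw [integral_inner_diffQuotient, gradForm_eq_inner, integral_mul_div, integral_inner_valMap,
    hph] at hdis
  rw [h.skewForm_sub_left hU hU0 hU hφ, h.skewForm_sub_mid hU0 hU hW hφ,
    h.skewForm_sub_left hU0 hW0 hW hφ, h.skewForm_sub_left huh0 hW0 hW hφ,
    h.nonlocalForm_sub_left hα hU hW hφ, h.nonlocalForm_sub_left hα huh hW hφ,
    ← real_inner_self_eq_norm_sq]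
  -- Advection of `uh - W` by the old discrete velocity does no work, so `uh` may be replaced by
  -- `W`. The four remaining skew terms telescope from `skewForm U U` to `skewForm uh0 W`.
  have hs : skewForm uh0 uh (uh - W) - skewForm uh0 W (uh - W) = 0 := by
    rw [← h.skewForm_sub_mid huh0 huh hW hφ, skewForm_self]
  have hg1 : inner ℝ (gradMap (uh - W)) (gradMap (uh - W))
      = inner ℝ (gradMap uh) (gradMap (uh - W)) - inner ℝ (gradMap W) (gradMap (uh - W)) := by
    rw [← inner_sub_left, ← map_sub]
  have hg2 : inner ℝ (gradMap U) (gradMap (uh - W)) - inner ℝ (gradMap W) (gradMap (uh - W)) = 0 := by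
    rw [← inner_sub_left, ← map_sub, horth]
  have hv1 : inner ℝ (valMap (uh - W) - valMap (uh0 - W0)) (valMap (uh - W))
      = inner ℝ (valMap uh - valMap uh0) (valMap (uh - W))
        - (inner ℝ (valMap W) (valMap (uh - W)) - inner ℝ (valMap W0) (valMap (uh - W))) := by
    rw [← inner_sub_left, ← inner_sub_left]
    congr 1
    rw [map_sub, map_sub]
    abel
  have hv2 : inner ℝ (valMap ((U - W) - (U0 - W0))) (valMap (uh - W))
      = inner ℝ (valMap U - valMap U0) (valMap (uh - W))
        - (inner ℝ (valMap W) (valMap (uh - W)) - inner ℝ (valMap W0) (valMap (uh - W))) := by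
    rw [← inner_sub_left, ← inner_sub_left]
    congr 1
    rw [map_sub, map_sub, map_sub]
    abel
  have hτ : inner ℝ (Δt⁻¹ • (valMap U - valMap U0) - ut) (valMap (uh - W))
      = Δt⁻¹ * inner ℝ (valMap U - valMap U0) (valMap (uh - W)) - inner ℝ ut (valMap (uh - W)) := by
    rw [inner_sub_left, real_inner_smul_left]
  rw [hg1, hv1, hv2, hτ]
  linear_combination hdis - hex - hs + ν * hg2

end Identity

/-! ### Representatives on `Ω` and divergence-free fields -/

section Representation

variable {d : ℕ} {Ω : Set (Sp d)} {lam : ℝ}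

/-- The index of the first-order derivative in direction `i`, among those of order up to `k + 1`. -/
def idxOne {d : ℕ} (k : ℕ) (i : Fin d) : DerivIdx d (k + 1) := ⟨⟨1, by omega⟩, fun _ => i⟩

lemma weakPartial_one {D : Set (Sp d)} {i : Fin d} {v w : Sp d → Sp d}
    (h : IsWeakPartial D (fun _ : Fin 1 => i) v w) {φ : Sp d → ℝ} (hφ : IsTest D φ) :
    ∫ x in D, dirDeriv i φ x • v x = - ∫ x in D, φ x • w x := by
  have h1 := h φ hφ
  have hp : ∀ x, partialDeriv (fun _ : Fin 1 => i) φ x = dirDeriv i φ x := by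
    intro x
    simp only [partialDeriv, dirDeriv]
    exact iteratedFDeriv_one_apply _
  simp_rw [hp] at h1
  rw [h1, pow_one, neg_one_smul]

/-- Weak derivatives on a subdomain are the restrictions of weak derivatives. -/
lemma pd_ae_eq_of_represents (hΩ : IsOpen Ω) (hlam : 0 < lam) {k : ℕ} (v : H1Vel Ω lam)
    (V : SobolevSpace (k + 1) Ω (Sp d)) (hV : Represents V (fn v)) (i : Fin d) :
    V.1 (idxOne k i) =ᵐ[volume.restrict Ω] pd i v := by
  have hsub := subset_extDomain Ω lam
  have hmv : MemLp (pd i v) 2 (volume.restrict Ω) :=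
    (memLp_pd i v).mono_measure (Measure.restrict_mono hsub le_rfl)
  have hmV : MemLp (V.1 (idxOne k i)) 2 (volume.restrict Ω) := Lp.memLp _
  have hmd : MemLp (fun x => V.1 (idxOne k i) x - pd i v x) 2 (volume.restrict Ω) := hmV.sub hmv
  have key := hΩ.ae_eq_zero_of_integral_contDiff_smul_eq_zero (μ := volume.restrict Ω)
    ((hmd.locallyIntegrable (by norm_num)).locallyIntegrableOn Ω) (fun φ hφ hφc hφs => by
      have e1 := weakPartial_one (V.2 (idxOne k i)) (φ := φ) ⟨hφ, hφc, hφs⟩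
      have e2 := weakPartial_one (v.2 (idx1 i)) (φ := φ) ⟨hφ, hφc, hφs.trans hsub⟩
      have hφ0 : ∀ x ∉ Ω, φ x = 0 := fun x hx => image_eq_zero_of_notMem_tsupport fun h => hx (hφs h)
      have hdφ0 : ∀ x ∉ Ω, dirDeriv i φ x = 0 := fun x hx => by
        by_contra h0
        exact hx (hφs (support_dirDeriv_subset φ i h0))
      have hD := (isOpen_extDomain hΩ hlam).measurableSet
      have e3 : ∫ x in extDomain Ω lam, dirDeriv i φ x • fn v x
          = ∫ x in Ω, dirDeriv i φ x • fn v x :=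
        setIntegral_eq_of_subset_of_forall_sdiff_eq_zero hD hsub fun x hx => by
          rw [hdφ0 x hx.2, zero_smul]
      have e4 : ∫ x in extDomain Ω lam, φ x • pd i v x = ∫ x in Ω, φ x • pd i v x :=
        setIntegral_eq_of_subset_of_forall_sdiff_eq_zero hD hsub fun x hx => by
          rw [hφ0 x hx.2, zero_smul]
      have e5 : ∫ x in Ω, dirDeriv i φ x • fn V x = ∫ x in Ω, dirDeriv i φ x • fn v x := by
        refine integral_congr_ae ?_
        filter_upwards [hV] with x hx
        rw [hx]
      have hφ2 : MemLp φ 2 (volume.restrict Ω) := hφ.continuous.memLp_of_hasCompactSupport hφc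
      have i1 : Integrable (fun x => φ x • V.1 (idxOne k i) x) (volume.restrict Ω) :=
        memLp_one_iff_integrable.1 (hmV.smul hφ2)
      have i2 : Integrable (fun x => φ x • pd i v x) (volume.restrict Ω) :=
        memLp_one_iff_integrable.1 (hmv.smul hφ2)
      simp_rw [smul_sub]
      rw [integral_sub i1 i2, ← e4, sub_eq_zero, ← neg_inj]
      exact e1.symm.trans (e5.trans (e3.symm.trans e2)))
  filter_upwards [key, ae_restrict_mem hΩ.measurableSet] with x hx hxΩ
  exact sub_eq_zero.1 (hx hxΩ)

/-- `V` knows only the values on `Ω`, but these determine the weak gradient there. The first-order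
entries are one block of the sum of squares defining `‖V‖`. -/
lemma norm_gradMap_le (hΩ : IsOpen Ω) (hlam : 0 < lam) {k : ℕ} (v : H1Vel Ω lam)
    (V : SobolevSpace (k + 1) Ω (Sp d)) (hV : Represents V (fn v)) : ‖gradMap v‖ ≤ ‖V‖ := by
  classical
  have h1 : ∀ i, gradMap v i = V.1 (idxOne k i) := fun i =>
    Lp.ext ((coeFn_gradMap v i).trans (pd_ae_eq_of_represents hΩ hlam v V hV i).symm)
  refine le_of_sq_le_sq ?_ (norm_nonneg _)
  have hVn : ‖V‖ = ‖V.1‖ := rfl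
  rw [PiLp.norm_sq_eq_of_L2, hVn, PiLp.norm_sq_eq_of_L2]
  simp_rw [h1]
  have hinj : Function.Injective (idxOne (d := d) k) := by
    intro i j hij
    have := (Sigma.mk.inj_iff.1 hij).2
    exact congrFun (eq_of_heq this) ⟨0, by simp⟩
  calc ∑ i, ‖V.1 (idxOne k i)‖ ^ 2
      = ∑ I ∈ Finset.univ.image (idxOne (d := d) k), ‖V.1 I‖ ^ 2 :=
        (Finset.sum_image (f := fun I => ‖V.1 I‖ ^ 2) fun i _ j _ h => hinj h).symm
    _ ≤ ∑ I, ‖V.1 I‖ ^ 2 :=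
        Finset.sum_le_sum_of_subset_of_nonneg (Finset.subset_univ _) fun _ _ _ => by positivity

lemma Represents.sub {k : ℕ} {u v : H1Vel Ω lam} {U V : SobolevSpace (k + 1) Ω (Sp d)}
    (hU : Represents U (fn u)) (hV : Represents V (fn v)) : Represents (U - V) (fn (u - v)) := by
  have h1 : fn (U - V) =ᵐ[volume.restrict Ω] fn U - fn V :=
    Lp.coeFn_sub (U.1 (idx0 d (k + 1))) (V.1 (idx0 d (k + 1)))
  have h2 : fn (u - v) =ᵐ[volume.restrict Ω] fn u - fn v :=
    ae_mono (Measure.restrict_mono (subset_extDomain Ω lam) le_rfl)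
      (Lp.coeFn_sub (u.1 (idx0 d 1)) (v.1 (idx0 d 1)))
  have hU' : fn U =ᵐ[volume.restrict Ω] fn u := hU
  have hV' : fn V =ᵐ[volume.restrict Ω] fn v := hV
  change fn (U - V) =ᵐ[volume.restrict Ω] fn (u - v)
  filter_upwards [h1, h2, hU', hV'] with x e1 e2 e3 e4
  rw [e1, e2, Pi.sub_apply, Pi.sub_apply, e3, e4]

/-- The chain rule with the identity, tested against a cutoff equal to one on `Ω`: the derivative of
the cutoff vanishes where the velocity does not. -/
lemma IsSetting.integral_extGrad (h : IsSetting Ω lam) {v : H1Vel Ω lam}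
    (hv : v ∈ velocitySpace Ω lam) (j i : Fin d) : ∫ x, extGrad v j i x = 0 := by
  obtain ⟨ψ, hψ⟩ := h.exists_approx hv j
  obtain ⟨χ, hχ, hχc, -, hχ1, -⟩ := exists_cutoff h.isBounded h.pos
  have h1 := hψ.integral_chain (F := id) (F' := fun _ => 1) (A := 1) (B := 0) contDiff_id
    (fun t => hasDerivAt_id t) rfl LipschitzWith.id (LipschitzWith.const _) hχ hχc i
  have e1 : ∀ x, χ x * 1 * extGrad v j i x = extGrad v j i x := by
    intro x
    by_cases hx : x ∈ Ω
    · rw [hχ1 x hx]; ring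
    · rw [extGrad, indicator_of_notMem hx, mul_zero]
  have e2 : ∀ x, dirDeriv i χ x * id (extVal v j x) = 0 := by
    intro x
    by_cases hx : x ∈ Ω
    · have : χ =ᶠ[𝓝 x] fun _ => 1 := by
        filter_upwards [h.isOpen.mem_nhds hx] with y hy
        exact hχ1 y hy
      rw [dirDeriv, this.fderiv_eq]
      simp
    · rw [extVal, indicator_of_notMem hx, id, mul_zero]
  simp_rw [e1, e2] at h1
  simpa using h1

/-- Zero mean makes the divergence itself an admissible pressure test function; `divMap_eq_zero`
then tests incompressibility with the divergence. -/
lemma IsSetting.integral_div (h : IsSetting Ω lam) {v : H1Vel Ω lam}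
    (hv : v ∈ velocitySpace Ω lam) : ∫ x in Ω, div v x = 0 := by
  have hint : ∀ i, Integrable (fun x => pd i v x i) (volume.restrict Ω) := by
    intro i
    have : IsFiniteMeasure (volume.restrict Ω) :=
      ⟨by rw [Measure.restrict_apply_univ]; exact h.isBounded.measure_lt_top⟩
    exact (memLp_coord ((memLp_pd i v).mono_measure
      (Measure.restrict_mono (subset_extDomain Ω lam) le_rfl)) i).integrable (by norm_num)
  simp only [div]
  rw [integral_finsetSum _ fun i _ => hint i]
  refine Finset.sum_eq_zero fun i _ => ?_
  rw [← integral_indicator h.isOpen.measurableSet]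
  exact h.integral_extGrad hv i i

/-- Velocity fields that are weakly divergence-free have vanishing divergence. -/
lemma IsSetting.divMap_eq_zero (h : IsSetting Ω lam) {v : H1Vel Ω lam}
    (hv : v ∈ velocitySpace Ω lam)
    (hdiv : ∀ q : L2 Ω ℝ, IsPressure Ω q → ∫ x in Ω, div v x * q x = 0) :
    divMap Ω (gradMap v) = 0 := by
  have h1 : IsPressure Ω (divMap Ω (gradMap v)) := by
    rw [IsPressure, integral_congr_ae (coeFn_divMap v)]
    exact h.integral_div hv
  have h2 : ∫ x in Ω, divMap Ω (gradMap v) x * div v x = 0 := by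
    rw [← hdiv _ h1]
    exact integral_congr_ae (Eventually.of_forall fun x => mul_comm _ _)
  rw [integral_mul_div] at h2
  exact inner_self_eq_zero.1 h2

end Representation

/-! ### Consequences of the finite element hypotheses -/

section FiniteElements

variable {d : ℕ} {Ω : Set (Sp d)} {lam : ℝ} {k s : ℕ} {β C₀ h : ℝ}
  {Xh : Submodule ℝ (H1Vel Ω lam)} {Qh : Submodule ℝ (L2 Ω ℝ)}

/-- The gradients of discretely divergence-free velocity fields. -/
noncomputable def discreteGradients (Xh : Submodule ℝ (H1Vel Ω lam)) (Qh : Submodule ℝ (L2 Ω ℝ)) :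
    Submodule ℝ (GradSpace Ω) := discreteKernel (divMap Ω) (Xh.map gradMap) Qh

lemma IsFEPair.finite_map (hFE : IsFEPair k s β C₀ h Xh Qh) :
    FiniteDimensional ℝ (Xh.map (gradMap : H1Vel Ω lam →ₗ[ℝ] GradSpace Ω)) :=
  have := hFE.finite_velocity
  inferInstance

lemma IsFEPair.finite_discreteGradients (hFE : IsFEPair k s β C₀ h Xh Qh) :
    FiniteDimensional ℝ (discreteGradients Xh Qh) :=
  have := hFE.finite_map
  discreteKernel_finiteDimensional _ _ _

/-- This is the form of the inf-sup condition used abstractly. Fields of zero gradient give the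
quotient zero by convention, which `0 ≤ M` accommodates. -/
lemma IsFEPair.inf_sup_bound (hFE : IsFEPair k s β C₀ h Xh Qh) {q : L2 Ω ℝ} (hq : q ∈ Qh) {M : ℝ}
    (hM : 0 ≤ M) (hbd : ∀ v ∈ Xh.map gradMap, inner ℝ q (divMap Ω v) ≤ M * ‖v‖) :
    β * ‖q‖ ≤ M := by
  rw [← normL2_eq_norm]
  refine (hFE.inf_sup q hq).trans (Real.iSup_le (fun v => ?_) hM)
  rw [integral_mul_div, gradNorm_eq_norm]
  exact div_le_of_le_mul₀ (norm_nonneg _) hM (hbd _ (Submodule.mem_map_of_mem v.2))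

/-- The approximation error of the projection onto discretely divergence-free velocity fields. -/
lemma IsFEPair.norm_sub_projection_le (hFE : IsFEPair k s β C₀ h Xh Qh) (hβ : 0 < β)
    [FiniteDimensional ℝ (discreteGradients Xh Qh)]
    {v : H1Vel Ω lam} (hv : v ∈ velocitySpace Ω lam) (hdiv : divMap Ω (gradMap v) = 0)
    {V : SobolevSpace (k + 1) Ω (Sp d)} (hV : Represents V (fn v)) :
    ‖gradMap v - (discreteGradients Xh Qh).starProjection (gradMap v)‖
      ≤ (1 + ‖divMap Ω‖ / β) * C₀ * h ^ k * ‖V‖ := by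
  have := hFE.finite_map
  have hA : 0 ≤ 1 + ‖divMap Ω‖ / β := by positivity
  have h1 : ∀ vh : Xh, ‖gradMap v - (discreteGradients Xh Qh).starProjection (gradMap v)‖
      ≤ (1 + ‖divMap Ω‖ / β) * gradNorm (v - (vh : H1Vel Ω lam)) := by
    intro vh
    rw [gradNorm_eq_norm, map_sub]
    exact FracNSE.norm_sub_projection_le (divMap Ω) (Xh.map gradMap) Qh hβ
      (fun q hq M hM hbd => hFE.inf_sup_bound hq hM hbd) (fun q _ => by rw [hdiv, inner_zero_right])
      (Submodule.mem_map_of_mem vh.2)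
  have h2 := hFE.approx_gradient v hv V hV
  calc _ ≤ ⨅ vh : Xh, (1 + ‖divMap Ω‖ / β) * gradNorm (v - (vh : H1Vel Ω lam)) := le_ciInf h1
    _ = (1 + ‖divMap Ω‖ / β) * ⨅ vh : Xh, gradNorm (v - (vh : H1Vel Ω lam)) :=
        (Real.mul_iInf_of_nonneg hA _).symm
    _ ≤ (1 + ‖divMap Ω‖ / β) * (C₀ * h ^ k * ‖V‖) := by gcongr
    _ = _ := by ring

/-- Since `g` is discretely divergence-free, any element of `Qh` can be subtracted from `p` for
free, and the infimum gives the approximation order. -/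
lemma IsFEPair.abs_pressure_le (hFE : IsFEPair k s β C₀ h Xh Qh) {p : L2 Ω ℝ}
    (hp : IsPressure Ω p) {P : SobolevSpace (s + 1) Ω ℝ} (hP : Represents P p) {g : GradSpace Ω}
    (hg : g ∈ discreteGradients Xh Qh) :
    |inner ℝ p (divMap Ω g)| ≤ C₀ * h ^ (s + 1) * ‖P‖ * (‖divMap Ω‖ * ‖g‖) := by
  have hA : 0 ≤ ‖divMap Ω‖ * ‖g‖ := by positivity
  have h1 : ∀ qh : Qh, |inner ℝ p (divMap Ω g)|
      ≤ (‖divMap Ω‖ * ‖g‖) * normL2 Ω (p - (qh : L2 Ω ℝ) : L2 Ω ℝ) := by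
    intro qh
    have h2 : inner ℝ p (divMap Ω g) = inner ℝ (p - (qh : L2 Ω ℝ)) (divMap Ω g) := by
      rw [inner_sub_left, hg.2 _ qh.2, sub_zero]
    rw [h2, normL2_eq_norm, mul_comm]
    refine (abs_real_inner_le_norm _ _).trans ?_
    gcongr
    exact (divMap Ω).le_opNorm g
  calc _ ≤ ⨅ qh : Qh, (‖divMap Ω‖ * ‖g‖) * normL2 Ω (p - (qh : L2 Ω ℝ) : L2 Ω ℝ) := le_ciInf h1
    _ = (‖divMap Ω‖ * ‖g‖) * ⨅ qh : Qh, normL2 Ω (p - (qh : L2 Ω ℝ) : L2 Ω ℝ) :=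
        (Real.mul_iInf_of_nonneg hA _).symm
    _ ≤ (‖divMap Ω‖ * ‖g‖) * (C₀ * h ^ (s + 1) * ‖P‖) := by
        gcongr
        exact hFE.approx_pressure p hp P hP
    _ = _ := by ring

/-- The choice of `W` need not be linear in `g`: later bounds see `W` through its gradient, and `L²`
norms come from the Poincaré inequality. -/
lemma exists_gradMap_eq_projection [FiniteDimensional ℝ (discreteGradients Xh Qh)]
    (g : GradSpace Ω) : ∃ W ∈ Xh, gradMap W = (discreteGradients Xh Qh).starProjection g := by
  have h1 := discreteKernel_le _ _ _
    (Submodule.starProjection_apply_mem (discreteGradients Xh Qh) g)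
  exact h1

end FiniteElements

/-! ### The energy inequality of one time step -/

section Step

variable {d : ℕ} {Ω : Set (Sp d)} {lam : ℝ}

/-- Expansion of the nonnegative form at `u - v`. The nonlocal energy on the left of the error
equation can thus absorb the cross term. -/
lemma IsSetting.two_mul_nonlocalForm_le (h : IsSetting Ω lam) {α : ℝ} (hα : α ∈ Ioo (0 : ℝ) 1)
    {u v : H1Vel Ω lam} (hu : u ∈ velocitySpace Ω lam) (hv : v ∈ velocitySpace Ω lam) :
    2 * nonlocalForm α u v ≤ nonlocalForm α u u + nonlocalForm α v v := by
  have huv := Submodule.sub_mem _ hu hv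
  have h1 := h.nonlocalForm_nonneg hα huv
  rw [h.nonlocalForm_sub_left hα.2 hu hv huv, h.nonlocalForm_comm hα.2 hu huv,
    h.nonlocalForm_comm hα.2 hv huv, h.nonlocalForm_sub_left hα.2 hu hv hu,
    h.nonlocalForm_sub_left hα.2 hu hv hv, h.nonlocalForm_comm hα.2 hv hu] at h1
  linarith

set_option maxHeartbeats 1000000 in
/-- The energy inequality of one time step. -/
lemma IsSetting.energy_step (h : IsSetting Ω lam) {ν γ α Δt : ℝ} (hγ : 0 ≤ γ)
    (hα : α ∈ Ioo (0 : ℝ) 1) (hΔ : 0 < Δt)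
    {CP Kc δ K Ca MU ε εd dU π : ℝ} (hCP0 : 0 ≤ CP) (hKc0 : 0 ≤ Kc) (hδ0 : 0 ≤ δ) (hK0 : 0 ≤ K)
    (hCa0 : 0 ≤ Ca) (hε0 : 0 ≤ ε)
    (hCP : ∀ v ∈ velocitySpace Ω lam, ‖valMap v‖ ≤ CP * ‖gradMap v‖)
    (hKc : ∀ u ∈ velocitySpace Ω lam, ∀ v ∈ velocitySpace Ω lam, ∀ w ∈ velocitySpace Ω lam,
      |skewForm u v w| ≤ Kc * ‖gradMap u‖ * ‖gradMap v‖ * ‖gradMap w‖)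
    (hK : ∀ u ∈ velocitySpace Ω lam, ∀ v ∈ velocitySpace Ω lam, ∀ w ∈ velocitySpace Ω lam,
      |skewForm u v w| ≤ (δ * ‖gradMap u‖ + K * ‖valMap u‖) * ‖gradMap v‖ * ‖gradMap w‖)
    (hCa : ∀ v ∈ velocitySpace Ω lam, nonlocalForm α v v ≤ Ca * ‖gradMap v‖ ^ 2)
    {U U0 uh uh0 W W0 : H1Vel Ω lam} (hU : U ∈ velocitySpace Ω lam) (hU0 : U0 ∈ velocitySpace Ω lam)
    (huh : uh ∈ velocitySpace Ω lam) (huh0 : uh0 ∈ velocitySpace Ω lam)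
    (hW : W ∈ velocitySpace Ω lam) (hW0 : W0 ∈ velocitySpace Ω lam)
    (hdiv : div U =ᵐ[volume.restrict Ω] 0) {ut f : L2 Ω (Sp d)} {p ph : L2 Ω ℝ}
    (hex : (∫ x in Ω, inner ℝ (ut x) (fn (uh - W) x)) + convForm U U (uh - W)
        + ν * gradForm U (uh - W) - (∫ x in Ω, p x * div (uh - W) x)
        + γ * nonlocalForm α U (uh - W) = ∫ x in Ω, inner ℝ (f x) (fn (uh - W) x))
    (hdis : (∫ x in Ω, inner ℝ (Δt⁻¹ • (fn uh x - fn uh0 x)) (fn (uh - W) x))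
        + skewForm uh0 uh (uh - W) + ν * gradForm uh (uh - W)
        + γ * nonlocalForm α uh (uh - W) - (∫ x in Ω, ph x * div (uh - W) x)
      = ∫ x in Ω, inner ℝ (f x) (fn (uh - W) x))
    (hph : inner ℝ ph (divMap Ω (gradMap (uh - W))) = 0)
    (horth : inner ℝ (gradMap (U - W)) (gradMap (uh - W)) = 0)
    (bU : ‖gradMap U‖ ≤ MU) (bU0 : ‖gradMap U0‖ ≤ MU) (bW : ‖gradMap W‖ ≤ MU)
    (bη : ‖gradMap (U - W)‖ ≤ ε) (bη0 : ‖gradMap (U0 - W0)‖ ≤ ε)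
    (bd : ‖gradMap ((U - W) - (U0 - W0))‖ ≤ εd) (bdU : ‖gradMap (U - U0)‖ ≤ dU)
    (bp : |inner ℝ p (divMap Ω (gradMap (uh - W)))| ≤ π * ‖gradMap (uh - W)‖) :
    Δt⁻¹ * ((‖valMap (uh - W)‖ ^ 2 - ‖valMap (uh0 - W0)‖ ^ 2) / 2) + ν * ‖gradMap (uh - W)‖ ^ 2
      ≤ (CP * (Δt⁻¹ * (CP * εd)) + CP * ‖Δt⁻¹ • (valMap U - valMap U0) - ut‖ + π
          + Kc * MU * (dU + 2 * ε)) * ‖gradMap (uh - W)‖ + γ * Ca * ε ^ 2 / 2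
        + δ * MU * (‖gradMap (uh0 - W0)‖ * ‖gradMap (uh - W)‖)
        + K * MU * (‖valMap (uh0 - W0)‖ * ‖gradMap (uh - W)‖) := by
  have hid := h.error_identity hα.2 hU hU0 huh huh0 hW hW0 hdiv hex hdis hph horth
  have mφ : uh - W ∈ velocitySpace Ω lam := Submodule.sub_mem _ huh hW
  have mφ0 : uh0 - W0 ∈ velocitySpace Ω lam := Submodule.sub_mem _ huh0 hW0
  have mη : U - W ∈ velocitySpace Ω lam := Submodule.sub_mem _ hU hW
  have mη0 : U0 - W0 ∈ velocitySpace Ω lam := Submodule.sub_mem _ hU0 hW0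
  have hMU0 : 0 ≤ MU := (norm_nonneg _).trans bU
  have hy := hCP _ mφ
  set φ := uh - W
  set φ0 := uh0 - W0
  set η := U - W
  set η0 := U0 - W0
  have t0 : (‖valMap φ‖ ^ 2 - ‖valMap φ0‖ ^ 2) / 2 ≤ inner ℝ (valMap φ - valMap φ0) (valMap φ) := by
    rw [inner_sub_left, real_inner_self_eq_norm_sq]
    have h1 := real_inner_le_norm (valMap φ0) (valMap φ)
    nlinarith [sq_nonneg (‖valMap φ0‖ - ‖valMap φ‖)]
  have t0' := mul_le_mul_of_nonneg_left t0 (inv_nonneg.2 hΔ.le)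
  have t1 : inner ℝ (valMap (η - η0)) (valMap φ) ≤ (CP * εd) * (CP * ‖gradMap φ‖) := by
    refine (real_inner_le_norm _ _).trans ?_
    have h1 := hCP _ (Submodule.sub_mem _ mη mη0)
    have h2 : CP * ‖gradMap (η - η0)‖ ≤ CP * εd := by gcongr
    exact mul_le_mul (h1.trans h2) hy (norm_nonneg _) ((norm_nonneg _).trans (h1.trans h2))
  have t1' := mul_le_mul_of_nonneg_left t1 (inv_nonneg.2 hΔ.le)
  have t2 : -inner ℝ (Δt⁻¹ • (valMap U - valMap U0) - ut) (valMap φ)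
      ≤ ‖Δt⁻¹ • (valMap U - valMap U0) - ut‖ * (CP * ‖gradMap φ‖) := by
    refine (neg_le_abs _).trans ((abs_real_inner_le_norm _ _).trans ?_)
    gcongr
  -- Half of the energy of `φ` absorbs the cross term and the other half, being nonnegative, is
  -- dropped.
  have t3 : γ * nonlocalForm α η φ - γ * nonlocalForm α φ φ ≤ γ * Ca * ε ^ 2 / 2 := by
    have h1 := h.two_mul_nonlocalForm_le hα mη mφ
    have h2 := hCa _ mη
    have h3 := h.nonlocalForm_nonneg hα mφ
    have h4 : Ca * ‖gradMap η‖ ^ 2 ≤ Ca * ε ^ 2 := by gcongr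
    have h5 : nonlocalForm α η φ - nonlocalForm α φ φ ≤ Ca * ε ^ 2 / 2 := by linarith
    linear_combination γ * h5
  have t4 := (neg_le_abs _).trans bp
  have hx := norm_nonneg (gradMap φ)
  have s1 : skewForm (U - U0) U φ ≤ Kc * dU * MU * ‖gradMap φ‖ := by
    refine (le_abs_self _).trans ((hKc _ (Submodule.sub_mem _ hU hU0) _ hU _ mφ).trans ?_)
    have := (norm_nonneg _).trans bdU
    gcongr
  have s2 : skewForm U0 η φ ≤ Kc * MU * ε * ‖gradMap φ‖ := by
    refine (le_abs_self _).trans ((hKc _ hU0 _ mη _ mφ).trans ?_)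
    gcongr
  have s3 : skewForm η0 W φ ≤ Kc * ε * MU * ‖gradMap φ‖ := by
    refine (le_abs_self _).trans ((hKc _ mη0 _ hW _ mφ).trans ?_)
    gcongr
  -- The only convection term with unknowns in two slots; the split bound is needed here so that the
  -- lagged gradient carries the small factor `δ`.
  have s4 : -skewForm φ0 W φ ≤ (δ * ‖gradMap φ0‖ + K * ‖valMap φ0‖) * MU * ‖gradMap φ‖ := by
    refine (neg_le_abs _).trans ((hK _ mφ0 _ hW _ mφ).trans ?_)
    gcongr
  linear_combination hid + t0' + t1' + t2 + t3 + t4 + s1 + s2 + s3 + s4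

end Step

/-! ### Summation of the consistency errors and the final constant -/

section Sums

lemma sq_sum_five_le (a b c d e : ℝ) :
    (a + b + c + d + e) ^ 2 ≤ 5 * (a ^ 2 + b ^ 2 + c ^ 2 + d ^ 2 + e ^ 2) := by
  nlinarith [sq_nonneg (a - b), sq_nonneg (a - c), sq_nonneg (a - d), sq_nonneg (a - e),
    sq_nonneg (b - c), sq_nonneg (b - d), sq_nonneg (b - e), sq_nonneg (c - d),
    sq_nonneg (c - e), sq_nonneg (d - e)]

/-- Summation of the consistency errors. -/
lemma sum_consistency_le {Δt T I₁ I₂ M a b c e H S m : ℝ} {N : ℕ} {D τ P : ℕ → ℝ} (hΔ : 0 < Δt)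
    (hN : N * Δt ≤ T) (hD : ∑ n ∈ Finset.range N, D n ^ 2 ≤ Δt * I₁)
    (hτ : ∑ n ∈ Finset.range N, τ n ^ 2 ≤ Δt * I₂)
    (hP : Δt * ∑ n ∈ Finset.range N, P n ^ 2 ≤ M) :
    Δt * ∑ n ∈ Finset.range N,
        (a * H * Δt⁻¹ * D n + b * τ n + c * S * P n + e * D n + m * H) ^ 2
      ≤ 5 * (a ^ 2 * I₁ * H ^ 2 + b ^ 2 * I₂ * Δt ^ 2 + c ^ 2 * M * S ^ 2 + e ^ 2 * I₁ * Δt ^ 2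
        + m ^ 2 * T * H ^ 2) := by
  set sD := ∑ n ∈ Finset.range N, D n ^ 2 with hsD
  set st := ∑ n ∈ Finset.range N, τ n ^ 2 with hst
  set sP := ∑ n ∈ Finset.range N, P n ^ 2 with hsP
  have h1 : ∑ n ∈ Finset.range N, (a * H * Δt⁻¹ * D n + b * τ n + c * S * P n + e * D n + m * H) ^ 2
      ≤ 5 * ((a * H * Δt⁻¹) ^ 2 * sD + b ^ 2 * st + (c * S) ^ 2 * sP + e ^ 2 * sD
        + N * (m * H) ^ 2) := by
    rw [hsD, hst, hsP, Finset.mul_sum, Finset.mul_sum, Finset.mul_sum, Finset.mul_sum,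
      ← nsmul_eq_mul, ← Finset.card_range N, ← Finset.sum_const, Finset.card_range,
      ← Finset.sum_add_distrib, ← Finset.sum_add_distrib, ← Finset.sum_add_distrib,
      ← Finset.sum_add_distrib, Finset.mul_sum]
    refine Finset.sum_le_sum fun n _ => (sq_sum_five_le _ _ _ _ _).trans_eq ?_
    ring
  calc _ ≤ Δt * (5 * ((a * H * Δt⁻¹) ^ 2 * sD + b ^ 2 * st + (c * S) ^ 2 * sP + e ^ 2 * sD
        + N * (m * H) ^ 2)) := by gcongr
    -- The square of `Δt⁻¹` in the first term is compensated by the outer `Δt` and by the bound `Δt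
    -- * I₁` on the squared increments.
    _ = 5 * ((a * H) ^ 2 * Δt⁻¹ * sD + b ^ 2 * Δt * st + (c * S) ^ 2 * (Δt * sP)
        + e ^ 2 * Δt * sD + N * Δt * (m * H) ^ 2) := by field_simp
    _ ≤ 5 * ((a * H) ^ 2 * Δt⁻¹ * (Δt * I₁) + b ^ 2 * Δt * (Δt * I₂) + (c * S) ^ 2 * M
        + e ^ 2 * Δt * (Δt * I₁) + T * (m * H) ^ 2) := by gcongr
    _ = _ := by field_simp

end Sums

/-- The error bound that follows from the energy inequalities of the single time steps. -/
lemma exists_error_bound {ν T δM KM a b c e m G E E' I₁ I₂ M : ℝ} (hν : 0 < ν) (hT : 0 < T)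
    (hδ0 : 0 ≤ δM) (hδ : 8 * δM ≤ ν) (hG : 0 ≤ G) (hI₁ : 0 ≤ I₁) (hI₂ : 0 ≤ I₂) (hM : 0 ≤ M) :
    ∃ C : ℝ, 0 < C ∧ ∀ (Δt H S : ℝ) (NT N : ℕ) (y x D τ P ev eg : ℕ → ℝ), 0 < Δt →
      NT * Δt = T → 1 ≤ NT → N ≤ NT → 0 ≤ y 0 → 0 ≤ x 0 →
      (∀ n, 0 ≤ ev n) → (∀ n, 0 ≤ eg n) →
      (∀ n < NT, Δt⁻¹ * ((y (n + 1) ^ 2 - y n ^ 2) / 2) + ν * x (n + 1) ^ 2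
        ≤ (a * H * Δt⁻¹ * D n + b * τ n + c * S * P n + e * D n + m * H) * x (n + 1)
          + G * H ^ 2 / 2 + δM * (x n * x (n + 1)) + KM * (y n * x (n + 1))) →
      ∑ n ∈ Finset.range N, D n ^ 2 ≤ Δt * I₁ →
      ∑ n ∈ Finset.range N, τ n ^ 2 ≤ Δt * I₂ →
      Δt * ∑ n ∈ Finset.range N, P n ^ 2 ≤ M →
      y 0 ≤ ev 0 + E' * H → x 0 ≤ eg 0 + E * H →
      ev N ≤ E' * H + y N → (∀ n < NT, eg (n + 1) ≤ E * H + x (n + 1)) →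
      1 / 2 * ev N ^ 2 + 1 / 2 * Δt * ∑ n ∈ Finset.range N, ν * eg (n + 1) ^ 2
        ≤ C * (eg 0 ^ 2 + ev 0 ^ 2 + H ^ 2 + S ^ 2 + Δt ^ 2) := by
  -- `H` and `S` stand for `h ^ k` and `h ^ (s + 1)`; `y`, `x` are the value and gradient norms of
  -- the discrete part, and `ev`, `eg` those of the full error. `D`, `τ`, `P` are the velocity
  -- increments, the truncation errors and the pressure norms.
  set K := 8 / ν * KM ^ 2 with hK
  have hK0 : 0 ≤ K := by positivity
  set X := Real.exp (K * T) with hX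
  have hX0 : 0 < X := Real.exp_pos _
  set L := 40 / ν * (a ^ 2 * I₁ + b ^ 2 * I₂ + c ^ 2 * M + e ^ 2 * I₁ + m ^ 2 * T) with hL
  have hL0 : 0 ≤ L := by positivity
  -- The first two terms come from the projection error in the final triangle inequality. The factor
  -- of `X` collects the initial error, with `Δt` bounded by `T`, and the summed consistency errors.
  -- The last `1` only ensures positivity.
  refine ⟨E' ^ 2 + T * ν * E ^ 2
    + X * (2 + 2 * E' ^ 2 + T * ν + T * ν * E ^ 2 + L + T * G) + 1, by positivity, ?_⟩
  intro Δt H S NT N y x D τ P ev eg hΔ hNT h1NT hN hy0 hx0 hev heg hstep hD hτ hP by0 bx0 bev beg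
  have hΔT : Δt ≤ T := by
    rw [← hNT]
    exact le_mul_of_one_le_left hΔ.le (by exact_mod_cast h1NT)
  have hNΔ : N * Δt ≤ T := by
    rw [← hNT]
    gcongr
  set Z : ℕ → ℝ := fun n => a * H * Δt⁻¹ * D n + b * τ n + c * S * P n + e * D n + m * H with hZ
  have g1 := discrete_gronwall (y := y) (x := x) (F := fun n => 8 / ν * Z n ^ 2 + G * H ^ 2) hν hΔ
    hK0 hNT.le (fun n => by positivity)
    (fun n hn => energy_absorb hν hΔ hδ0 hδ (hstep n hn)) N hN
  have g2 := sum_consistency_le (a := a) (b := b) (c := c) (e := e) (H := H) (S := S) (m := m)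
    hΔ hNΔ hD hτ hP
  have g3 : Δt * ∑ n ∈ Finset.range N, (8 / ν * Z n ^ 2 + G * H ^ 2)
      ≤ 8 / ν * (5 * (a ^ 2 * I₁ * H ^ 2 + b ^ 2 * I₂ * Δt ^ 2 + c ^ 2 * M * S ^ 2
        + e ^ 2 * I₁ * Δt ^ 2 + m ^ 2 * T * H ^ 2)) + T * (G * H ^ 2) := by
    rw [Finset.sum_add_distrib, ← Finset.mul_sum, Finset.sum_const, Finset.card_range, nsmul_eq_mul]
    calc _ = 8 / ν * (Δt * ∑ n ∈ Finset.range N, Z n ^ 2) + N * Δt * (G * H ^ 2) := by ring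
      _ ≤ _ := by gcongr
  have sq2 : ∀ r s : ℝ, (r + s) ^ 2 ≤ 2 * (r ^ 2 + s ^ 2) := fun r s => add_sq_le
  have q1 : y 0 ^ 2 ≤ 2 * (ev 0 ^ 2 + (E' * H) ^ 2) := (pow_le_pow_left₀ hy0 by0 2).trans (sq2 _ _)
  have q2 : x 0 ^ 2 ≤ 2 * (eg 0 ^ 2 + (E * H) ^ 2) := (pow_le_pow_left₀ hx0 bx0 2).trans (sq2 _ _)
  have q3 : ev N ^ 2 ≤ 2 * ((E' * H) ^ 2 + y N ^ 2) :=
    (pow_le_pow_left₀ (hev N) bev 2).trans (sq2 _ _)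
  have q4 : Δt * ∑ n ∈ Finset.range N, ν * eg (n + 1) ^ 2
      ≤ 2 * (T * (ν * (E * H) ^ 2) + Δt * ∑ n ∈ Finset.range N, ν * x (n + 1) ^ 2) := by
    have : ∑ n ∈ Finset.range N, ν * eg (n + 1) ^ 2
        ≤ ∑ n ∈ Finset.range N, 2 * (ν * (E * H) ^ 2 + ν * x (n + 1) ^ 2) := by
      refine Finset.sum_le_sum fun n hn => ?_
      have h1 := (pow_le_pow_left₀ (heg _) (beg n ((Finset.mem_range.1 hn).trans_le hN)) 2).trans
        (sq2 _ _)
      calc ν * eg (n + 1) ^ 2 ≤ ν * (2 * ((E * H) ^ 2 + x (n + 1) ^ 2)) := by gcongr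
        _ = _ := by ring
    have hsum : ∑ n ∈ Finset.range N, 2 * (ν * (E * H) ^ 2 + ν * x (n + 1) ^ 2)
        = 2 * (N * (ν * (E * H) ^ 2) + ∑ n ∈ Finset.range N, ν * x (n + 1) ^ 2) := by
      rw [← Finset.mul_sum, Finset.sum_add_distrib, Finset.sum_const, Finset.card_range,
        nsmul_eq_mul]
    rw [hsum] at this
    calc _ ≤ Δt * (2 * (N * (ν * (E * H) ^ 2) + ∑ n ∈ Finset.range N, ν * x (n + 1) ^ 2)) := by gcongr
      _ = 2 * (N * Δt * (ν * (E * H) ^ 2) + Δt * ∑ n ∈ Finset.range N, ν * x (n + 1) ^ 2) := by ring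
      _ ≤ _ := by gcongr
  set R := eg 0 ^ 2 + ev 0 ^ 2 + H ^ 2 + S ^ 2 + Δt ^ 2 with hR
  have r1 : eg 0 ^ 2 ≤ R := by rw [hR]; linarith [sq_nonneg (ev 0), sq_nonneg H, sq_nonneg S, sq_nonneg Δt]
  have r2 : ev 0 ^ 2 ≤ R := by rw [hR]; linarith [sq_nonneg (eg 0), sq_nonneg H, sq_nonneg S, sq_nonneg Δt]
  have r3 : H ^ 2 ≤ R := by
    rw [hR]; linarith [sq_nonneg (eg 0), sq_nonneg (ev 0), sq_nonneg S, sq_nonneg Δt]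
  have r4 : S ^ 2 ≤ R := by
    rw [hR]; linarith [sq_nonneg (eg 0), sq_nonneg (ev 0), sq_nonneg H, sq_nonneg Δt]
  have r5 : Δt ^ 2 ≤ R := by
    rw [hR]; linarith [sq_nonneg (eg 0), sq_nonneg (ev 0), sq_nonneg H, sq_nonneg S]
  have hR0 : 0 ≤ R := (sq_nonneg _).trans r1
  have g4 : 8 / ν * (5 * (a ^ 2 * I₁ * H ^ 2 + b ^ 2 * I₂ * Δt ^ 2 + c ^ 2 * M * S ^ 2
        + e ^ 2 * I₁ * Δt ^ 2 + m ^ 2 * T * H ^ 2)) + T * (G * H ^ 2) ≤ (L + T * G) * R := by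
    calc _ ≤ 8 / ν * (5 * (a ^ 2 * I₁ * R + b ^ 2 * I₂ * R + c ^ 2 * M * R
        + e ^ 2 * I₁ * R + m ^ 2 * T * R)) + T * (G * R) := by gcongr
      _ = _ := by rw [hL]; ring
  have g5 : y 0 ^ 2 + Δt / 2 * ν * x 0 ^ 2 ≤ (2 + 2 * E' ^ 2 + T * ν + T * ν * E ^ 2) * R := by
    calc y 0 ^ 2 + Δt / 2 * ν * x 0 ^ 2
        ≤ 2 * (ev 0 ^ 2 + (E' * H) ^ 2) + T / 2 * ν * (2 * (eg 0 ^ 2 + (E * H) ^ 2)) := by gcongr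
      _ = 2 * ev 0 ^ 2 + 2 * E' ^ 2 * H ^ 2 + T * ν * eg 0 ^ 2 + T * ν * E ^ 2 * H ^ 2 := by ring
      _ ≤ 2 * R + 2 * E' ^ 2 * R + T * ν * R + T * ν * E ^ 2 * R := by gcongr
      _ = _ := by ring
  have g6 : y N ^ 2 + Δt * ∑ n ∈ Finset.range N, ν * x (n + 1) ^ 2
      ≤ X * ((2 + 2 * E' ^ 2 + T * ν + T * ν * E ^ 2 + L + T * G) * R) := by
    refine g1.trans (mul_le_mul_of_nonneg_left ?_ hX0.le)
    linarith
  have g7 : E' ^ 2 * H ^ 2 + T * ν * E ^ 2 * H ^ 2 ≤ E' ^ 2 * R + T * ν * E ^ 2 * R := by gcongr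
  linear_combination q3 / 2 + q4 / 2 + g6 + g7 + hR0

/-! ### Incompressibility of the exact solution up to the initial time -/

section Solution

variable {d : ℕ} {Ω : Set (Sp d)} {lam : ℝ}

/-- The exact velocity is divergence-free up to the initial time. -/
lemma IsSetting.divMap_solution_eq_zero (h : IsSetting Ω lam) {k : ℕ} {ν γ α T : ℝ} (hT : 0 < T)
    {f : ℝ → L2 Ω (Sp d)} {u : ℝ → H1Vel Ω lam} {p : ℝ → L2 Ω ℝ}
    (hsol : IsTruncatedSolution ν γ α T f u p) {U : ℝ → SobolevSpace (k + 1) Ω (Sp d)}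
    (hU : ∀ t ∈ Icc 0 T, Represents (U t) (fn (u t))) (hc : ContinuousOn U (Icc 0 T)) :
    ∀ t ∈ Icc 0 T, divMap Ω (gradMap (u t)) = 0 := by
  have hpos : ∀ t ∈ Ioc 0 T, divMap Ω (gradMap (u t)) = 0 := fun t ht =>
    h.divMap_eq_zero (hsol.mem_velocity t ⟨ht.1.le, ht.2⟩) (hsol.incompressible t ht)
  intro t ht
  rcases ht.1.eq_or_lt with h0 | h0
  swap
  · exact hpos t ⟨h0, ht.2⟩
  subst h0
  -- The constraint is imposed only for positive times. At time zero it follows by continuity in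
  -- `H^{k+1}`, which controls the divergence of `u 0 - u t`.
  have hlim : Tendsto (fun t => ‖divMap Ω‖ * ‖U 0 - U t‖) (𝓝[Ioc 0 T] 0) (𝓝 0) := by
    have h1 : Tendsto U (𝓝[Ioc 0 T] 0) (𝓝 (U 0)) :=
      (hc 0 ht).mono_left (nhdsWithin_mono _ Ioc_subset_Icc_self)
    have h2 := ((tendsto_const_nhds (x := U 0)).sub h1).norm.const_mul ‖divMap Ω‖
    simpa using h2
  have hne : (𝓝[Ioc 0 T] (0 : ℝ)).NeBot := by
    rw [nhdsWithin_Ioc_eq_nhdsGT hT]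
    infer_instance
  have hle : ‖divMap Ω (gradMap (u 0))‖ ≤ 0 := by
    refine ge_of_tendsto hlim ?_
    filter_upwards [self_mem_nhdsWithin] with t ht'
    have ht'' : t ∈ Icc 0 T := ⟨ht'.1.le, ht'.2⟩
    have h1 : divMap Ω (gradMap (u 0)) = divMap Ω (gradMap (u 0 - u t)) := by
      rw [map_sub, map_sub, hpos t ht', sub_zero]
    rw [h1]
    refine ((divMap Ω).le_opNorm _).trans ?_
    gcongr
    exact norm_gradMap_le h.isOpen h.pos _ _ ((hU 0 ht).sub (hU t ht''))
  exact norm_le_zero_iff.1 hle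

end Solution

end FracNSE

/-! ### The error estimate -/

open FracNSE in
set_option maxHeartbeats 1000000 in
theorem mainTheorem4 {d : ℕ} (hd : d = 2 ∨ d = 3)
    (Ω : Set (FracNSE.Sp d)) (hΩ : IsOpen Ω) (hΩb : Bornology.IsBounded Ω)
    (lam ν γ α T : ℝ) (hlam : 0 < lam) (hν : 0 < ν) (hγ : 0 ≤ γ) (hα : α ∈ Set.Ioo (0 : ℝ) 1)
    (hT : 0 < T) (k s : ℕ)
    (f : ℝ → FracNSE.L2 Ω (FracNSE.Sp d)) (u : ℝ → FracNSE.H1Vel Ω lam)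
    (p : ℝ → FracNSE.L2 Ω ℝ)
    (hsol : FracNSE.IsTruncatedSolution ν γ α T f u p)
    (hreg : FracNSE.IsRegular k s T f u p)
    (β C₀ : ℝ) (hβ : 0 < β) (hC₀ : 0 < C₀) :
    ∃ C : ℝ, 0 < C ∧
      ∀ (h : ℝ) (Xh : Submodule ℝ (FracNSE.H1Vel Ω lam)) (Qh : Submodule ℝ (FracNSE.L2 Ω ℝ)),
        0 < h → FracNSE.IsFEPair k s β C₀ h Xh Qh →
      ∀ (NT : ℕ) (Δt : ℝ), 1 ≤ NT → Δt = T / NT →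
      ∀ (uh : ℕ → FracNSE.H1Vel Ω lam) (ph : ℕ → FracNSE.L2 Ω ℝ),
        FracNSE.IsDiscreteSolution ν γ α Δt NT f Xh Qh uh ph →
      ∀ (e : ℕ → FracNSE.H1Vel Ω lam), (∀ n : ℕ, e n = u (n * Δt) - uh n) →
      ∀ N ≤ NT,
        1 / 2 * FracNSE.normL2 Ω (FracNSE.fn (e N)) ^ 2
          + 1 / 2 * Δt * ∑ n ∈ Finset.range N, ν * FracNSE.gradNorm (e (n + 1)) ^ 2
        ≤ C * (FracNSE.gradNorm (e 0) ^ 2 + FracNSE.normL2 Ω (FracNSE.fn (e 0)) ^ 2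
          + h ^ (2 * k) + h ^ (2 * s + 2) + Δt ^ 2) := by
  have hset : IsSetting Ω lam := ⟨hd, hΩ, hΩb, hlam⟩
  obtain ⟨U, hUr, -, -, U', hU'm, hU'd⟩ := hreg.velocity_Hk
  obtain ⟨P, hPr, -, MP, hMP⟩ := hreg.pressure
  choose! ut hut hmom using hsol.momentum
  obtain ⟨MU, hMU0, hMU⟩ := hU'd.exists_bound hT hU'm
  obtain ⟨I₂, hI₂0, hI₂⟩ := exists_truncation_bound hT hreg.velocity_H2
  have hdiv := hset.divMap_solution_eq_zero hT hsol hUr (hU'd.continuousOn hT hU'm)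
  obtain ⟨CP, hCP0, hCP⟩ := hset.exists_poincare
  obtain ⟨Kc, hKc0, hKc⟩ := hset.exists_skewForm_le
  -- This value makes `8 * (δ * MU) ≤ ν`, as absorption requires, and `MU + 1` covers the case `MU =
  -- 0`.
  have hδ0 : 0 < ν / (8 * (MU + 1)) := by positivity
  obtain ⟨K, hK0, hK⟩ := hset.exists_skewForm_le_add hδ0
  obtain ⟨Ca, hCa0, hCa⟩ := hset.exists_nonlocalForm_le hα
  set δ := ν / (8 * (MU + 1)) with hδdef
  have hδ : 8 * (δ * MU) ≤ ν := by
    calc 8 * (δ * MU) = ν * (MU / (MU + 1)) := by rw [hδdef]; field_simp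
      _ ≤ ν * 1 := by
          gcongr
          rw [div_le_one (by positivity)]
          linarith
      _ = ν := mul_one ν
  set A := (1 + ‖divMap Ω‖ / β) * C₀ with hA
  have hA0 : 0 ≤ A := by positivity
  have hMP0 : 0 ≤ MP := le_trans (Finset.sum_nonneg fun n _ => by positivity) (hMP 1 le_rfl)
  have hI₁0 : 0 ≤ ∫ r in (0 : ℝ)..T, ‖U' r‖ ^ 2 :=
    intervalIntegral.integral_nonneg hT.le fun r _ => sq_nonneg _
  -- In `a`, one Poincaré constant bounds the increment of `η` and the other the test function. `e`
  -- comes from the time lag of the transport field, and `m` from the two convection terms with a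
  -- projection error.
  obtain ⟨C, hC0, hC⟩ := exists_error_bound (T := T) (δM := δ * MU) (KM := K * MU)
    (a := CP * CP * A) (b := CP) (c := C₀ * ‖divMap Ω‖) (e := Kc * MU) (m := Kc * MU * (2 * (A * MU)))
    (G := γ * Ca * (A * MU) ^ 2) (E := A * MU) (E' := CP * (A * MU))
    (I₁ := ∫ r in (0 : ℝ)..T, ‖U' r‖ ^ 2) (I₂ := I₂) (M := MP) hν hT (by positivity) hδ
    (by positivity) hI₁0 hI₂0 hMP0
  refine ⟨C, hC0, fun h Xh Qh hh hFE NT Δt hNT hΔ uh ph hdisc e he N hN => ?_⟩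
  have hNT0 : (0 : ℝ) < NT := by exact_mod_cast hNT
  have hΔ0 : 0 < Δt := by rw [hΔ]; positivity
  have hNTΔ : NT * Δt = T := by rw [hΔ]; field_simp
  have hfin := hFE.finite_discreteGradients
  have hgrid : ∀ n ≤ NT, (n : ℝ) * Δt ∈ Icc 0 T := fun n hn => grid_mem hT hNT hΔ hn
  have hgrid' : ∀ n < NT, ((n + 1 : ℕ) : ℝ) * Δt ∈ Ioc 0 T := fun n hn =>
    ⟨by positivity, (hgrid (n + 1) hn).2⟩
  choose W hWX hW using fun n : ℕ => exists_gradMap_eq_projection (Xh := Xh) (Qh := Qh) (gradMap (u (n * Δt)))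
  have hWv : ∀ n, W n ∈ velocitySpace Ω lam := fun n => hFE.conforming_velocity (hWX n)
  have hUv : ∀ n ≤ NT, u (n * Δt) ∈ velocitySpace Ω lam := fun n hn =>
    hsol.mem_velocity _ (hgrid n hn)
  have huhv : ∀ n ≤ NT, uh n ∈ velocitySpace Ω lam := fun n hn =>
    hFE.conforming_velocity (hdisc.mem_velocity n hn)
  have bU : ∀ n ≤ NT, ‖gradMap (u (n * Δt))‖ ≤ MU := fun n hn =>
    (norm_gradMap_le hΩ hlam _ _ (hUr _ (hgrid n hn))).trans (hMU _ (hgrid n hn))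
  have bW : ∀ n ≤ NT, ‖gradMap (W n)‖ ≤ MU := fun n hn => by
    rw [hW]
    exact (Submodule.norm_starProjection_apply_le _ _).trans (bU n hn)
  have bη : ∀ n ≤ NT, ‖gradMap (u (n * Δt) - W n)‖ ≤ A * MU * h ^ k := fun n hn => by
    rw [map_sub, hW]
    refine (hFE.norm_sub_projection_le hβ (hUv n hn) (hdiv _ (hgrid n hn))
      (hUr _ (hgrid n hn))).trans ?_
    rw [← hA]
    calc A * h ^ k * ‖U (n * Δt)‖ ≤ A * h ^ k * MU := by
          gcongr
          exact hMU _ (hgrid n hn)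
      _ = _ := by ring
  have bηv : ∀ n ≤ NT, ‖valMap (u (n * Δt) - W n)‖ ≤ CP * (A * MU) * h ^ k := fun n hn => by
    refine (hCP _ (Submodule.sub_mem _ (hUv n hn) (hWv n))).trans ?_
    rw [mul_assoc CP]
    gcongr
    exact bη n hn
  have mφ : ∀ n < NT, gradMap (uh (n + 1) - W (n + 1)) ∈ discreteGradients Xh Qh := fun n hn => by
    rw [map_sub, hW]
    refine Submodule.sub_mem _ ⟨Submodule.mem_map_of_mem (hdisc.mem_velocity _ hn), fun q hq => ?_⟩
      (Submodule.starProjection_apply_mem _ _)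
    rw [← integral_mul_div, ← hdisc.incompressible n hn q hq]
    exact integral_congr_ae (Eventually.of_forall fun x => mul_comm _ _)
  have hstep := fun n (hn : n < NT) => hset.energy_step (ν := ν) (ε := A * MU * h ^ k)
    (dU := ‖U ((n + 1 : ℕ) * Δt) - U (n * Δt)‖)
    (εd := A * h ^ k * ‖U ((n + 1 : ℕ) * Δt) - U (n * Δt)‖)
    (π := C₀ * h ^ (s + 1) * ‖P ((n + 1 : ℕ) * Δt)‖ * ‖divMap Ω‖)
    hγ hα hΔ0 hCP0 hKc0 hδ0.le hK0 hCa0 (by positivity) hCP hKc hK hCa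
    (hUv (n + 1) hn) (hUv n hn.le) (huhv (n + 1) hn) (huhv n hn.le) (hWv (n + 1)) (hWv n)
    (by
      have h1 := coeFn_divMap (u ((n + 1 : ℕ) * Δt))
      rw [hdiv _ (hgrid (n + 1) hn)] at h1
      exact h1.symm.trans (Lp.coeFn_zero _ _ _))
    (hmom _ (hgrid' n hn) _ (Submodule.sub_mem _ (huhv (n + 1) hn) (hWv (n + 1))))
    (hdisc.momentum n hn _ (Submodule.sub_mem _ (hdisc.mem_velocity (n + 1) hn) (hWX (n + 1))))
    ((mφ n hn).2 _ (hdisc.mem_pressure n hn))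
    (by
      rw [map_sub, hW]
      exact Submodule.starProjection_inner_eq_zero _ _ (mφ n hn))
    (bU (n + 1) hn) (bU n hn.le) (bW (n + 1) hn) (bη (n + 1) hn) (bη n hn.le)
    (by
      -- By linearity of the projection, the increment of `η` has the gradient of a projection error
      -- of the increment of `u`, so the spatial rate multiplies `‖U(tⁿ⁺¹) - U(tⁿ)‖`.
      rw [sub_sub_sub_comm, map_sub, map_sub (gradMap) (W (n + 1)), hW, hW, ← map_sub, ← map_sub]
      refine hFE.norm_sub_projection_le hβ (Submodule.sub_mem _ (hUv (n + 1) hn) (hUv n hn.le)) ?_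
        ((hUr _ (hgrid (n + 1) hn)).sub (hUr _ (hgrid n hn.le)))
      rw [map_sub, map_sub, hdiv _ (hgrid (n + 1) hn), hdiv _ (hgrid n hn.le), sub_zero])
    (norm_gradMap_le hΩ hlam _ _ ((hUr _ (hgrid (n + 1) hn)).sub (hUr _ (hgrid n hn.le))))
    ((hFE.abs_pressure_le (hsol.mem_pressure _ (hgrid' n hn)) (hPr _ (hgrid' n hn))
      (mφ n hn)).trans_eq (by ring))
  have key := hC Δt (h ^ k) (h ^ (s + 1)) NT N (fun n => ‖valMap (uh n - W n)‖)
    (fun n => ‖gradMap (uh n - W n)‖) (fun n => ‖U ((n + 1 : ℕ) * Δt) - U (n * Δt)‖)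
    (fun n => ‖Δt⁻¹ • (valMap (u ((n + 1 : ℕ) * Δt)) - valMap (u (n * Δt))) - ut ((n + 1 : ℕ) * Δt)‖)
    (fun n => ‖P ((n + 1 : ℕ) * Δt)‖) (fun n => normL2 Ω (fn (e n))) (fun n => gradNorm (e n))
    hΔ0 hNTΔ hNT hN (norm_nonneg _) (norm_nonneg _) (fun n => Real.sqrt_nonneg _)
    (fun n => Real.sqrt_nonneg _)
    (fun n hn => (hstep n hn).trans_eq (by ring))
    (hU'd.sum_sq_le hT hU'm hNT hΔ hN) (hI₂ ut hut NT N Δt hNT hΔ hN)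
    (by
      refine le_trans ?_ (hMP NT hNT)
      rw [← hΔ, ← Finset.mul_sum]
      gcongr)
    (by
      -- The scheme may start from any discrete velocity, so the initial discrete part is bounded by
      -- the initial error plus the projection error.
      have h1 : uh 0 - W 0 = (u ((0 : ℕ) * Δt) - W 0) - e 0 := by rw [he]; abel
      rw [normL2_fn_eq_norm, h1, map_sub, add_comm]
      refine (norm_sub_le _ _).trans ?_
      gcongr
      exact bηv 0 (Nat.zero_le _))
    (by
      have h1 : uh 0 - W 0 = (u ((0 : ℕ) * Δt) - W 0) - e 0 := by rw [he]; abel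
      rw [gradNorm_eq_norm, h1, map_sub, add_comm]
      refine (norm_sub_le _ _).trans ?_
      gcongr
      exact bη 0 (Nat.zero_le _))
    (by
      have h1 : e N = (u (N * Δt) - W N) - (uh N - W N) := by rw [he]; abel
      rw [normL2_fn_eq_norm, h1, map_sub]
      refine (norm_sub_le _ _).trans ?_
      gcongr
      exact bηv N hN)
    (fun n hn => by
      have h1 : e (n + 1) = (u ((n + 1 : ℕ) * Δt) - W (n + 1)) - (uh (n + 1) - W (n + 1)) := by
        rw [he]; abel
      rw [gradNorm_eq_norm, h1, map_sub]
      refine (norm_sub_le _ _).trans ?_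
      gcongr
      exact bη (n + 1) hn)
  have h1 : h ^ (2 * k) = (h ^ k) ^ 2 := by rw [← pow_mul, mul_comm]
  have h2 : h ^ (2 * s + 2) = (h ^ (s + 1)) ^ 2 := by rw [← pow_mul]; ring
  rw [h1, h2]
  exact key
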